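/- Let $1\le p\le q$ and let $\mathfrak g=\mathfrak{sp}(p,q)$ be the real Lie algebra of quaternionic $(p+q)\times(p+q)$ matrices $X$ with $X^*I_{p,q}+I_{p,q}X=0$. Let $\Theta$ be a Cartan involution of $\mathfrak g$, let $\mathfrak a$ be a maximal abelian subspace of the $(-1)$-eigenspace of $\Theta$, let $\mathfrak g_\alpha=\{x : [H,x]=\alpha(H)x\ \text{for all } H\in\mathfrak a\}$ for $\alpha\in\mathfrak a^*$, and let $\mathfrak m$ be the subalgebra of the elements of $\mathfrak g_0$ fixed by $\Theta$. Let $e_1,\dots,e_p$ be a basis of $\mathfrak a^*$ for which the root system $\Delta$ of $(\mathfrak g,\mathfrak a)$ is the canonical one: its positive roots are the $2e_i$, the $e_i\pm e_j$ with $i<j$ and, if $p<q$, also the $e_i$. Let $\mathfrak g_+$ be the sum of the positive root spaces. Let $\mathfrak h$ be a subalgebra of $\mathfrak g$, let $\langle\cdot,\cdot\rangle$ be a symmetric bilinear form on $\mathfrak g$ with kernel $\mathfrak h$, and let $\delta\in\mathfrak a^*$ be non-zero, such that every $x\in\mathfrak a\oplus\mathfrak g_+$ satisfies $\langle[x,u],v\rangle+\langle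 u,[x,v]\rangle=c(x)\langle u,v\rangle$ for some $c(x)\in\mathbb R$ and all $u,v\in\mathfrak g$, with $c(x)=\delta(x)$ when $x\in\mathfrak a$. Let $\hat{\mathfrak g}(\delta)$ be the non-compact semisimple part (the sum of the non-compact simple ideals) of the reductive algebra $\mathfrak g_0\oplus\bigoplus_{\alpha\in\mathbb Z\delta\cap\Delta}\mathfrak g_\alpha$, put $\hat{\mathfrak m}=\mathfrak m\cap\hat{\mathfrak g}(\delta)$, and assume $\hat{\mathfrak m}\not\subseteq\mathfrak h$. Then $\hat{\mathfrak m}$ is isomorphic to $\mathfrak{so}(3)$ as a Lie algebra and, with $\mathfrak{so}(3)$ embedded in $\mathfrak g$ as $\hat{\mathfrak m}$, the projection $\mathfrak g\to\mathfrak g/\mathfrak h$ induces a linear isomorphism from the following direct sum onto $\mathfrak g/\mathfrak h$: 1. if $p<q$, $$\mathfrak g/\mathfrak h\simeq\mathfrak g_{-2e_1}\oplus\mathfrak g_{-e_1}\oplus\bigoplus_{i>1}\bigl(\mathfrak g_{-(e_1+e_i)}\oplus\mathfrak g_{-(e_1-e_i)}\bigr)\oplus\mathfrak{so}(3);$$ 2.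 if $p=q$, $$\mathfrak g/\mathfrak h\simeq\mathfrak g_{-2e_1}\oplus\bigoplus_{i>1}\bigl(\mathfrak g_{-(e_1+e_i)}\oplus\mathfrak g_{-(e_1-e_i)}\bigr)\oplus\mathfrak{so}(3).$$ -/

import Mathlib

open scoped Quaternion DirectSum

noncomputable section

-- The commutator bracket of an associative ring.
attribute [local instance 100] LieRing.ofAssociativeRing

section RootDecomposition

variable {𝔤 : Type*} [LieRing 𝔤] [LieAlgebra ℝ 𝔤]

/-- A Cartan involution of a real Lie algebra: an involutive automorphism `Θ` such that
`-B(X, Θ Y)` is positive definite, `B` being the Killing form. -/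
structure IsCartanInvolution (Θ : 𝔤 ≃ₗ⁅ℝ⁆ 𝔤) : Prop where
  involutive : ∀ x, Θ (Θ x) = x
  posDef : ∀ x, x ≠ 0 → 0 < -(killingForm ℝ 𝔤 x (Θ x))

/-- `𝔞` is an abelian subspace of the `-1` eigenspace of `Θ`. -/
structure IsAbelianInMinusPart (Θ : 𝔤 ≃ₗ⁅ℝ⁆ 𝔤) (𝔞 : Submodule ℝ 𝔤) : Prop where
  minus : ∀ x ∈ 𝔞, Θ x = -x
  abelian : ∀ x ∈ 𝔞, ∀ y ∈ 𝔞, ⁅x, y⁆ = 0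

/-- `𝔞` is a Cartan subspace associated with `Θ`: a maximal abelian subspace of the
`-1` eigenspace of `Θ`. -/
def IsCartanSubspace (Θ : 𝔤 ≃ₗ⁅ℝ⁆ 𝔤) (𝔞 : Submodule ℝ 𝔤) : Prop :=
  Maximal (IsAbelianInMinusPart Θ) 𝔞

/-- The joint eigenspace `𝔤_α = {x | [H, x] = α(H) x for all H ∈ 𝔞}`; for `α = 0` it is the
centralizer `𝔤_0` of `𝔞`. -/
def rootSpaceOf (𝔞 : Submodule ℝ 𝔤) (α : Module.Dual ℝ 𝔞) : Submodule ℝ 𝔤 where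
  carrier := {x | ∀ H : 𝔞, ⁅(H : 𝔤), x⁆ = α H • x}
  add_mem' {x y} hx hy H := by rw [lie_add, hx H, hy H, smul_add]
  zero_mem' H := by simp
  smul_mem' c x hx H := by rw [lie_smul, hx H, smul_comm]

/-- The set `Δ` of (restricted) roots of `(𝔤, 𝔞)`. -/
def rootSet (𝔞 : Submodule ℝ 𝔤) : Set (Module.Dual ℝ 𝔞) :=
  {α | α ≠ 0 ∧ rootSpaceOf 𝔞 α ≠ ⊥}

/-- The subalgebra `𝔪`: the elements fixed by `Θ` that centralize `𝔞`. -/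
def compactCentralizer (Θ : 𝔤 ≃ₗ⁅ℝ⁆ 𝔤) (𝔞 : Submodule ℝ 𝔤) : LieSubalgebra ℝ 𝔤 where
  carrier := {x | Θ x = x ∧ ∀ H ∈ 𝔞, ⁅H, x⁆ = 0}
  add_mem' {x y} hx hy := ⟨by rw [map_add, hx.1, hy.1], fun H hH => by
    rw [lie_add, hx.2 H hH, hy.2 H hH, add_zero]⟩
  zero_mem' := ⟨by simp, by simp⟩
  smul_mem' c x hx := ⟨by rw [map_smul, hx.1], fun H hH => by
    rw [lie_smul, hx.2 H hH, smul_zero]⟩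
  lie_mem' {x y} hx hy := ⟨by
    rw [LieEquiv.map_lie, show Θ x = x from hx.1, show Θ y = y from hy.1], fun H hH => by
    rw [leibniz_lie, hx.2 H hH, hy.2 H hH, zero_lie, lie_zero, add_zero]⟩

theorem lie_mem_rootSpaceOf {𝔞 : Submodule ℝ 𝔤} {α β : Module.Dual ℝ 𝔞} {x y : 𝔤}
    (hx : x ∈ rootSpaceOf 𝔞 α) (hy : y ∈ rootSpaceOf 𝔞 β) :
    ⁅x, y⁆ ∈ rootSpaceOf 𝔞 (α + β) := by
  intro H
  rw [leibniz_lie, hx H, hy H, smul_lie, lie_smul, LinearMap.add_apply, add_smul]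

/-- The subalgebra `𝔤_Γ = 𝔤_0 ⊕ ⨁_{α ∈ Γ} 𝔤_α` for `Γ = {n δ ∈ Δ | n ∈ ℤ}`. (The
spaces `𝔤_{nδ}` with `nδ ≠ 0` not a root vanish, and `n = 0` gives `𝔤_0`.) -/
def multiplesSubalgebra (𝔞 : Submodule ℝ 𝔤) (δ : Module.Dual ℝ 𝔞) : LieSubalgebra ℝ 𝔤 where
  toSubmodule := ⨆ n : ℤ, rootSpaceOf 𝔞 (n • δ)
  lie_mem' {x y} hx hy := by
    replace hx : x ∈ ⨆ n : ℤ, rootSpaceOf 𝔞 (n • δ) := hx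
    replace hy : y ∈ ⨆ n : ℤ, rootSpaceOf 𝔞 (n • δ) := hy
    change ⁅x, y⁆ ∈ ⨆ n : ℤ, rootSpaceOf 𝔞 (n • δ)
    induction hx using Submodule.iSup_induction' with
    | zero => rw [zero_lie]; exact Submodule.zero_mem _
    | add u v _ _ hu hv => rw [add_lie]; exact Submodule.add_mem _ hu hv
    | mem m u hu =>
      induction hy using Submodule.iSup_induction' with
      | zero => rw [lie_zero]; exact Submodule.zero_mem _
      | add v w _ _ hv hw => rw [lie_add]; exact Submodule.add_mem _ hv hw
      | mem n v hv =>
        refine Submodule.mem_iSup_of_mem (m + n) ?_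
        rw [add_smul]
        exact lie_mem_rootSpaceOf hu hv

end RootDecomposition

section NoncompactPart

variable (L : Type*) [LieRing L] [LieAlgebra ℝ L]

/-- A real Lie algebra whose Killing form is negative definite (compact semisimple). -/
def IsCompactSemisimple : Prop := ∀ x : L, x ≠ 0 → killingForm ℝ L x x < 0

/-- The non-compact semisimple part of a reductive real Lie algebra: the sum of its ideals that
are simple and not compact. -/
def noncompactPart : LieIdeal ℝ L :=
  sSup {I : LieIdeal ℝ L | LieAlgebra.IsSimple ℝ I ∧ ¬ IsCompactSemisimple I}

end NoncompactPart

section Conformal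

variable {𝔤 : Type*} [LieRing 𝔤] [LieAlgebra ℝ 𝔤]

/-- `𝔤̂(δ)`: the non-compact semisimple part of `𝔤_Γ`, `Γ = ℤ δ ∩ Δ`, as a subalgebra of `𝔤`. -/
def moebiusSubalgebra (𝔞 : Submodule ℝ 𝔤) (δ : Module.Dual ℝ 𝔞) : LieSubalgebra ℝ 𝔤 :=
  (LieIdeal.toLieSubalgebra ℝ _ (noncompactPart (multiplesSubalgebra 𝔞 δ))).map
    (multiplesSubalgebra 𝔞 δ).incl

/-- `𝔪̂ = 𝔪 ∩ 𝔤̂(δ)`. -/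
def mHat (Θ : 𝔤 ≃ₗ⁅ℝ⁆ 𝔤) (𝔞 : Submodule ℝ 𝔤) (δ : Module.Dual ℝ 𝔞) : LieSubalgebra ℝ 𝔤 :=
  compactCentralizer Θ 𝔞 ⊓ moebiusSubalgebra 𝔞 δ

/-- The subalgebra `𝔭` of the elements preserving a bilinear form up to scale. -/
def conformalStabilizer (B : LinearMap.BilinForm ℝ 𝔤) : LieSubalgebra ℝ 𝔤 where
  carrier := {x | ∃ c : ℝ, ∀ u v, B ⁅x, u⁆ v + B u ⁅x, v⁆ = c * B u v}
  add_mem' := by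
    rintro x y ⟨c, hc⟩ ⟨d, hd⟩
    refine ⟨c + d, fun u v => ?_⟩
    simp only [add_lie, map_add, LinearMap.add_apply]
    linear_combination hc u v + hd u v
  zero_mem' := ⟨0, by simp⟩
  smul_mem' := by
    rintro t x ⟨c, hc⟩
    refine ⟨t * c, fun u v => ?_⟩
    simp only [smul_lie, map_smul, LinearMap.smul_apply, smul_eq_mul]
    linear_combination t * hc u v
  lie_mem' := by
    rintro x y ⟨c, hc⟩ ⟨d, hd⟩
    refine ⟨0, fun u v => ?_⟩
    simp only [lie_lie, map_sub, LinearMap.sub_apply]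
    linear_combination hc ⁅y, u⁆ v + hc u ⁅y, v⁆ - hd ⁅x, u⁆ v - hd u ⁅x, v⁆ + c * hd u v
      - d * hc u v

/-- The algebraic data of a homogeneous conformal structure, relative to a Cartan subspace `𝔞`
and the sum `𝔫 = 𝔤₊` of the positive root spaces: a symmetric bilinear form `B` on `𝔤` with kernel
the subalgebra `𝔥`, preserved up to scale by `𝔞 ⊕ 𝔫`, the factor on `𝔞` being the non-trivial
distortion `δ`. -/
structure IsConformalTriple (𝔞 𝔫 : Submodule ℝ 𝔤) (𝔥 : LieSubalgebra ℝ 𝔤)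
    (B : LinearMap.BilinForm ℝ 𝔤) (δ : Module.Dual ℝ 𝔞) : Prop where
  symm : ∀ u v, B u v = B v u
  ker_eq : ∀ u, u ∈ 𝔥 ↔ ∀ v, B u v = 0
  le_stabilizer : 𝔞 ⊔ 𝔫 ≤ (conformalStabilizer B).toSubmodule
  distortion : ∀ (H : 𝔞) (u v : 𝔤), B ⁅(H : 𝔤), u⁆ v + B u ⁅(H : 𝔤), v⁆ = δ H * B u v
  distortion_ne_zero : δ ≠ 0

end Conformal

/-- The diagonal matrix `I_{p,q}` of the quaternionic Hermitian form of signature `(p, q)`. -/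
def signMatrix (p q : ℕ) : Matrix (Fin p ⊕ Fin q) (Fin p ⊕ Fin q) ℍ[ℝ] :=
  Matrix.diagonal (Sum.elim (fun _ => 1) (fun _ => -1))

/-- `𝔰𝔭(p, q)`: the quaternionic matrices `X` with `X* I_{p,q} + I_{p,q} X = 0`, the Lie algebra of
the group of right `ℍ`-linear automorphisms preserving `∑ |uᵢ|² - ∑ |vⱼ|²`. -/
def spLie (p q : ℕ) : LieSubalgebra ℝ (Matrix (Fin p ⊕ Fin q) (Fin p ⊕ Fin q) ℍ[ℝ]) where
  carrier := {X | X.conjTranspose * signMatrix p q + signMatrix p q * X = 0}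
  add_mem' {X Y} hX hY := by
    have hX' : X.conjTranspose * signMatrix p q + signMatrix p q * X = 0 := hX
    have hY' : Y.conjTranspose * signMatrix p q + signMatrix p q * Y = 0 := hY
    change (X + Y).conjTranspose * signMatrix p q + signMatrix p q * (X + Y) = 0
    rw [Matrix.conjTranspose_add, add_mul, mul_add, add_add_add_comm, hX', hY', add_zero]
  zero_mem' := by simp
  smul_mem' c X hX := by
    have hX' : X.conjTranspose * signMatrix p q + signMatrix p q * X = 0 := hX
    change (c • X).conjTranspose * signMatrix p q + signMatrix p q * (c • X) = 0
    have hc : (c • X).conjTranspose = c • X.conjTranspose := by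
      ext1 i j
      simp [Matrix.conjTranspose_apply, Quaternion.star_smul]
    rw [hc, smul_mul_assoc, mul_smul_comm, ← smul_add, hX', smul_zero]
  lie_mem' {X Y} hX hY := by
    have hX' := eq_neg_of_add_eq_zero_left
      (show X.conjTranspose * signMatrix p q + signMatrix p q * X = 0 from hX)
    have hY' := eq_neg_of_add_eq_zero_left
      (show Y.conjTranspose * signMatrix p q + signMatrix p q * Y = 0 from hY)
    change (⁅X, Y⁆).conjTranspose * signMatrix p q + signMatrix p q * ⁅X, Y⁆ = 0
    rw [Ring.lie_def, Matrix.conjTranspose_sub, Matrix.conjTranspose_mul,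
      Matrix.conjTranspose_mul, sub_mul, mul_assoc, mul_assoc, hX', hY', mul_neg, mul_neg,
      ← mul_assoc, ← mul_assoc, hX', hY']
    noncomm_ring

section CanonicalRoots

variable {V : Type*} [AddCommGroup V]

/-- The positive roots, for the canonical order, of the canonical root system of `𝔰𝔭(p, q)`,
`p ≤ q`: `2eᵢ`, `eᵢ ± eⱼ` for `i < j`, and, when `p < q`, also `eᵢ`. -/
def canonicalPosRoots (p q : ℕ) (e : Fin p → V) : Set V :=
  {α | (∃ i, α = 2 • e i) ∨ (∃ i j, i < j ∧ (α = e i + e j ∨ α = e i - e j)) ∨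
    (p < q ∧ ∃ i, α = e i)}

/-- The canonical root system of `𝔰𝔭(p, q)`: type `BC_p` if `p < q` and `C_p` if `p = q`. -/
def canonicalRoots (p q : ℕ) (e : Fin p → V) : Set V :=
  {α | α ∈ canonicalPosRoots p q e ∨ -α ∈ canonicalPosRoots p q e}

/-- The weights `-2e₁` and `-(e₁ ± eᵢ)`, `i > 1` (the index `1` is `0 : Fin p`). -/
def quotientWeightsEq {p : ℕ} [NeZero p] (e : Fin p → V) : Set V :=
  {α | α = -(2 • e 0) ∨ ∃ i, 0 < i ∧ (α = -(e 0 + e i) ∨ α = -(e 0 - e i))}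

/-- The weights `-2e₁`, `-e₁` and `-(e₁ ± eᵢ)`, `i > 1`. -/
def quotientWeightsLt {p : ℕ} [NeZero p] (e : Fin p → V) : Set V :=
  {α | α = -(2 • e 0) ∨ α = -e 0 ∨ ∃ i, 0 < i ∧ (α = -(e 0 + e i) ∨ α = -(e 0 - e i))}

end CanonicalRoots

open Classical in
/-- `𝔤/𝔥` is, naturally, the direct sum of the root spaces `𝔤_α`, `α ∈ S`, and of a copy of `𝔰𝔬(3)`
realized as the subalgebra `𝔨` of `𝔤`: for an isomorphism `ι : 𝔰𝔬(3) ≃ 𝔨` of Lie algebras, the map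
`((x_α), A) ↦ ∑ x_α + ι A mod 𝔥` is a linear isomorphism from the external direct sum onto `𝔤/𝔥`. -/
def QuotientDecomposes {𝔤 : Type*} [LieRing 𝔤] [LieAlgebra ℝ 𝔤] (𝔞 : Submodule ℝ 𝔤)
    (𝔥 𝔨 : LieSubalgebra ℝ 𝔤) (S : Set (Module.Dual ℝ 𝔞)) : Prop :=
  ∃ (ι : LieAlgebra.Orthogonal.so (Fin 3) ℝ ≃ₗ⁅ℝ⁆ 𝔨)
    (Φ : ((⨁ α : S, rootSpaceOf 𝔞 (α : Module.Dual ℝ 𝔞)) ×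
      LieAlgebra.Orthogonal.so (Fin 3) ℝ) ≃ₗ[ℝ] 𝔤 ⧸ 𝔥.toSubmodule),
    ∀ x A, Φ (x, A) = 𝔥.toSubmodule.mkQ
      (DirectSum.coeLinearMap (fun α : S => rootSpaceOf 𝔞 (α : Module.Dual ℝ 𝔞)) x + (ι A : 𝔤))

end

/-! Everything is read off from weights. Since `𝔞` scales `B` by `δ`, the spaces `𝔤_α` and `𝔤_β` are
`B`-orthogonal unless `α + β = δ`. A positive root vector `x` is a multiple of some `[H, x]`, so its
scaling factor vanishes and it acts skewly on `B`. An element of `𝔪̂` outside the kernel `𝔥` has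
weight 0, hence pairs non-trivially with `𝔤_δ`, and `δ` is a root. Skewness then excludes every root
but `-2e₁`: positive roots by a direct computation, the roots `-eᵢ` and `-(eᵢ ± eⱼ)` by comparing
two commuting relations in the algebra of `±2eᵢ` (`pairing_zero_of_short`), and `-2eᵢ` with `i > 1`
by means of the positive root `e₁ - eᵢ` (`pairing_zero_of_long`, `distortion_eq`).

Once `δ = -2e₁`, the algebra `𝔤̂(δ)` is a copy of `𝔰𝔭(1,1) = Im ℍ ⊕ ℍ ⊕ Im ℍ`, and `𝔪̂` is the
imaginary part of the middle term, that is `𝔰𝔬(3)`. On it, the pairing with `𝔤_δ ≅ Im ℍ` is a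
non-zero multiple of the scalar product (`exists_pairing_eq_dot`). So `𝔥` meets neither `𝔤_δ` nor
`𝔪̂`, and `𝔪̂` complements `𝔥 ∩ 𝔤_0` in `𝔤_0`. A root `α` outside the announced list has `δ - α`
neither a root nor zero, so `𝔤_α ⊆ 𝔥`. For the remaining short roots the hypothesis that `𝔥` is a
subalgebra is decisive: an `x` of such a root space in `𝔥`, applied repeatedly to a long root space
contained in `𝔥`, lands in `𝔥 ∩ 𝔤_{-2e₁} = 0`, which forces `x = 0`.

The computations take place in `ℍ^{p+q}`. The involution `Θ` is arbitrary, so an adapted basis must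
be constructed: symmetry of `ad H` for `-B(x, Θ y)`, with `B` here the Killing form, makes `𝔞`
diagonalizable on vectors, because `𝔤` is spanned by the products `wedge u v`. The canonical root
system then gives isotropic vectors `fᵢ`, `f'ᵢ` of weights `±eᵢ` (`exists_isWittFrame`). Since `p`
is the Witt index, these weights have quaternionic multiplicity one, and the weight-0 space is
anisotropic. -/

noncomputable section

open scoped RightActions Matrix

/-! ### The Hermitian space and the products spanning `𝔰𝔭(p, q)` -/

section HermitianSpace

variable {p q : ℕ}

/-- The right quaternionic space `ℍ^{p+q}` of column vectors. -/
abbrev QuatVec (p q : ℕ) : Type := Fin p ⊕ Fin q → ℍ[ℝ]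

/-- The diagonal entries of `I_{p,q}`, as real numbers. -/
def signEntry (p q : ℕ) : Fin p ⊕ Fin q → ℝ := Sum.elim (fun _ => 1) (fun _ => -1)

theorem signEntry_mul_self (k : Fin p ⊕ Fin q) : signEntry p q k * signEntry p q k = 1 := by
  rcases k with k | k <;> simp [signEntry]

theorem signMatrix_eq : signMatrix p q =
    Matrix.diagonal (fun k => ((signEntry p q k : ℝ) : ℍ[ℝ])) := by
  unfold signMatrix
  congr 1
  ext1 k
  rcases k with k | k <;> simp [signEntry]

/-- The quaternionic Hermitian form of signature `(p, q)`. -/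
def herm : QuatVec p q →ₗ[ℝ] QuatVec p q →ₗ[ℝ] ℍ[ℝ] :=
  LinearMap.mk₂ ℝ (fun u v => ∑ k, signEntry p q k • (star (u k) * v k))
    (fun u v w => by simp [add_mul, Finset.sum_add_distrib])
    (fun c u v => by
      simp only [Pi.smul_apply, Quaternion.star_smul, smul_mul_assoc, Finset.smul_sum]
      exact Finset.sum_congr rfl fun k _ => smul_comm _ _ _)
    (fun u v w => by simp [mul_add, Finset.sum_add_distrib])
    (fun c u v => by
      simp only [Pi.smul_apply, mul_smul_comm, Finset.smul_sum]
      exact Finset.sum_congr rfl fun k _ => smul_comm _ _ _)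

theorem herm_apply (u v : QuatVec p q) :
    herm u v = ∑ k, signEntry p q k • (star (u k) * v k) := rfl

theorem star_herm (u v : QuatVec p q) : star (herm u v) = herm v u := by
  simp [herm_apply, star_sum, Quaternion.star_smul]

theorem herm_rsmul_left (u v : QuatVec p q) (a : ℍ[ℝ]) :
    herm (u <• a) v = star a * herm u v := by
  simp [herm_apply, Finset.mul_sum, mul_assoc, -Fintype.sum_sum_type]

theorem herm_rsmul_right (u v : QuatVec p q) (a : ℍ[ℝ]) :
    herm u (v <• a) = herm u v * a := by
  simp [herm_apply, Finset.sum_mul, mul_assoc, -Fintype.sum_sum_type]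

theorem herm_swap_eq_zero {u v : QuatVec p q} (h : herm u v = 0) : herm v u = 0 := by
  rw [← star_herm, h, star_zero]

theorem herm_single (k : Fin p ⊕ Fin q) (w : QuatVec p q) :
    herm (Pi.single k 1) w = signEntry p q k • w k := by
  rw [herm_apply, Finset.sum_eq_single k]
  · simp
  · intro b _ hb
    simp [Pi.single_eq_of_ne hb]
  · simp

theorem exists_herm_ne_zero {v : QuatVec p q} (hv : v ≠ 0) : ∃ w, herm v w ≠ 0 := by
  obtain ⟨k, hk⟩ := Function.ne_iff.mp hv
  refine ⟨Pi.single k 1, fun h => hk ?_⟩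
  have h1 := herm_swap_eq_zero h
  rw [herm_single] at h1
  rcases smul_eq_zero.mp h1 with h2 | h2
  · have := signEntry_mul_self (p := p) (q := q) k
    rw [h2] at this
    norm_num at this
  · exact h2

/-- The action of `𝔰𝔭(p, q)` on `ℍ^{p+q}`. -/
def act : spLie p q →ₗ[ℝ] QuatVec p q →ₗ[ℝ] QuatVec p q :=
  LinearMap.mk₂ ℝ (fun X w => X.1 *ᵥ w)
    (fun X Y w => by simp [Matrix.add_mulVec])
    (fun c X w => by simp [Matrix.smul_mulVec])
    (fun X w z => by simp [Matrix.mulVec_add])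
    (fun c X w => by simp [Matrix.mulVec_smul])

theorem act_apply (X : spLie p q) (w : QuatVec p q) : act X w = X.1 *ᵥ w := rfl

theorem act_rsmul (X : spLie p q) (w : QuatVec p q) (a : ℍ[ℝ]) :
    act X (w <• a) = act X w <• a := by
  simp [act_apply, Matrix.mulVec_smul]

theorem act_lie (X Y : spLie p q) (w : QuatVec p q) :
    act ⁅X, Y⁆ w = act X (act Y w) - act Y (act X w) := by
  have h : (⁅X, Y⁆ : spLie p q).1 = X.1 * Y.1 - Y.1 * X.1 := rfl
  simp [act_apply, h, Matrix.sub_mulVec, Matrix.mulVec_mulVec]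

theorem spLie_ext {X Y : spLie p q} (h : ∀ w, act X w = act Y w) : X = Y := by
  apply Subtype.ext
  ext1 i j
  have := congrFun (h (Pi.single j 1)) i
  simpa [act_apply] using this

theorem mem_spLie_iff (X : Matrix (Fin p ⊕ Fin q) (Fin p ⊕ Fin q) ℍ[ℝ]) :
    X ∈ spLie p q ↔ ∀ i j, signEntry p q j • star (X j i) + signEntry p q i • X i j = 0 := by
  have h : X ∈ spLie p q ↔ X.conjTranspose * signMatrix p q + signMatrix p q * X = 0 := Iff.rfl
  rw [h, ← Matrix.ext_iff, signMatrix_eq]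
  simp [Matrix.mul_diagonal, Matrix.diagonal_mul, Matrix.conjTranspose_apply,
    Quaternion.coe_mul_eq_smul, Quaternion.mul_coe_eq_smul]

theorem herm_act_left (X : spLie p q) (u v : QuatVec p q) :
    herm (act X u) v = -herm u (act X v) := by
  have hX := (mem_spLie_iff X.1).mp X.2
  rw [eq_neg_iff_add_eq_zero]
  simp only [herm_apply, act_apply, Matrix.mulVec, dotProduct, star_sum, Finset.sum_mul,
    Finset.mul_sum, Finset.smul_sum, star_mul]
  rw [Finset.sum_comm, ← Finset.sum_add_distrib]
  refine Finset.sum_eq_zero fun i _ => ?_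
  rw [← Finset.sum_add_distrib]
  refine Finset.sum_eq_zero fun j _ => ?_
  have := congrArg (fun z => star (u i) * z * v j) (hX i j)
  simpa [mul_add, add_mul, mul_assoc] using this

/-- The matrix of `w ↦ u ⟨v, w⟩ - v ⟨u, w⟩`. -/
def wedgeMatrix (u v : QuatVec p q) : Matrix (Fin p ⊕ Fin q) (Fin p ⊕ Fin q) ℍ[ℝ] :=
  Matrix.of fun i j => signEntry p q j • (u i * star (v j) - v i * star (u j))

theorem wedgeMatrix_mem (u v : QuatVec p q) : wedgeMatrix u v ∈ spLie p q := by
  rw [mem_spLie_iff]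
  intro i j
  simp only [wedgeMatrix, Matrix.of_apply, Quaternion.star_smul, star_sub, star_mul, star_star,
    smul_smul, mul_comm (signEntry p q j)]
  rw [← smul_add]
  simp

/-- The element `w ↦ u ⟨v, w⟩ - v ⟨u, w⟩` of `𝔰𝔭(p, q)`. -/
def wedge : QuatVec p q →ₗ[ℝ] QuatVec p q →ₗ[ℝ] spLie p q :=
  LinearMap.mk₂ ℝ (fun u v => ⟨wedgeMatrix u v, wedgeMatrix_mem u v⟩)
    (fun u v w => by
      apply Subtype.ext
      change wedgeMatrix _ _ = wedgeMatrix _ _ + wedgeMatrix _ _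
      ext1 i j
      simp only [wedgeMatrix, Matrix.of_apply, Matrix.add_apply, ← smul_add, Pi.add_apply, add_mul,
        mul_add, star_add]
      congr 1; abel)
    (fun c u v => by
      apply Subtype.ext
      change wedgeMatrix _ _ = c • wedgeMatrix _ _
      ext1 i j
      simp only [wedgeMatrix, Matrix.of_apply, Matrix.smul_apply]
      rw [smul_comm c]
      simp [Quaternion.star_smul, smul_sub])
    (fun u v w => by
      apply Subtype.ext
      change wedgeMatrix _ _ = wedgeMatrix _ _ + wedgeMatrix _ _
      ext1 i j
      simp only [wedgeMatrix, Matrix.of_apply, Matrix.add_apply, ← smul_add, Pi.add_apply, add_mul,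
        mul_add, star_add]
      congr 1; abel)
    (fun c u v => by
      apply Subtype.ext
      change wedgeMatrix _ _ = c • wedgeMatrix _ _
      ext1 i j
      simp only [wedgeMatrix, Matrix.of_apply, Matrix.smul_apply]
      rw [smul_comm c]
      simp [Quaternion.star_smul, smul_sub])

theorem act_wedge (u v w : QuatVec p q) :
    act (wedge u v) w = u <• herm v w - v <• herm u w := by
  ext1 i
  have h : act (wedge u v) w i =
      ∑ j, (signEntry p q j • (u i * star (v j) - v i * star (u j))) * w j := rfl
  rw [h]
  simp only [Pi.sub_apply, Pi.smul_apply, MulOpposite.smul_eq_mul_unop, MulOpposite.unop_op,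
    herm_apply, Finset.mul_sum, ← Finset.sum_sub_distrib]
  refine Finset.sum_congr rfl fun j _ => ?_
  simp only [mul_smul_comm, smul_mul_assoc, ← smul_sub, sub_mul, mul_assoc]

/-- Skewness of `X` for the Hermitian form makes `ad X` a derivation of the product. This is the
bridge between weights of vectors and weights of `𝔤`. -/
theorem lie_wedge (X : spLie p q) (u v : QuatVec p q) :
    ⁅X, wedge u v⁆ = wedge (act X u) v + wedge u (act X v) := by
  apply spLie_ext
  intro w
  rw [act_lie, map_add, LinearMap.add_apply]
  simp only [act_wedge, map_sub, act_rsmul, herm_act_left, MulOpposite.op_neg, neg_smul]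
  abel

theorem wedge_rsmul_left (u v : QuatVec p q) (a : ℍ[ℝ]) :
    wedge (u <• a) v = wedge u (v <• star a) := by
  apply spLie_ext
  intro w
  simp only [act_wedge, herm_rsmul_left, star_star, ← mul_smul, ← MulOpposite.op_mul]

/-- Since `wedge v v = 0`, the square of a vector only becomes visible after twisting by an
imaginary quaternion. Such twisted squares supply the long root vectors. -/
theorem wedge_rsmul_self_apply {v : QuatVec p q} {a : ℍ[ℝ]} (ha : star a = -a) (w : QuatVec p q) :
    act (wedge (v <• a) v) w = (2 : ℝ) • (v <• (a * herm v w)) := by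
  rw [act_wedge, herm_rsmul_left, ha, ← mul_smul, ← MulOpposite.op_mul, ← sub_smul,
    ← MulOpposite.op_sub, neg_mul, sub_neg_eq_add, MulOpposite.op_add, add_smul, two_smul]

theorem eq_zero_of_wedge_rsmul_self {v : QuatVec p q} {a : ℍ[ℝ]} (ha : star a = -a) (ha0 : a ≠ 0)
    (h : wedge (v <• a) v = 0) : v = 0 := by
  by_contra hv
  obtain ⟨w, hw⟩ := exists_herm_ne_zero hv
  have h1 := wedge_rsmul_self_apply ha w (v := v)
  rw [h, map_zero, LinearMap.zero_apply] at h1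
  have h2 := (smul_eq_zero.mp h1.symm).resolve_left two_ne_zero
  obtain ⟨k, hk⟩ := Function.ne_iff.mp hv
  exact absurd (congrFun h2 k) (mul_ne_zero hk (mul_ne_zero ha0 hw))

/-- Every element of `𝔰𝔭(p, q)` is a sum of elements `wedge u v`. -/
theorem two_smul_eq_sum_wedge (X : spLie p q) :
    (2 : ℝ) • X = ∑ k, signEntry p q k • wedge (act X (Pi.single k 1)) (Pi.single k 1) := by
  have hs : ∀ w : QuatVec p q,
      w = ∑ k, signEntry p q k • ((Pi.single k 1 : QuatVec p q) <• herm (Pi.single k 1) w) := by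
    intro w
    ext1 i
    rw [Finset.sum_apply, Finset.sum_eq_single i]
    · rw [herm_single]
      simp [smul_smul, signEntry_mul_self]
    · intro b _ hb
      simp [Pi.single_eq_of_ne' hb]
    · simp
  apply spLie_ext
  intro w
  rw [map_sum, LinearMap.sum_apply]
  simp only [map_smul, LinearMap.smul_apply, act_wedge, herm_act_left, MulOpposite.op_neg, neg_smul,
    sub_neg_eq_add, smul_add, Finset.sum_add_distrib]
  rw [← hs (act X w)]
  conv_lhs => rw [two_smul]
  nth_rewrite 1 [hs w]
  simp only [map_sum, map_smul, act_rsmul]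

end HermitianSpace


/-! ### Quaternion units -/

section QuaternionUnits

/-- The quaternion `i`. -/
def quatI : ℍ[ℝ] := ⟨0, 1, 0, 0⟩
/-- The quaternion `j`. -/
def quatJ : ℍ[ℝ] := ⟨0, 0, 1, 0⟩
/-- The quaternion `k`. -/
def quatK : ℍ[ℝ] := ⟨0, 0, 0, 1⟩

@[simp] theorem quatI_re : quatI.re = 0 := rfl
@[simp] theorem quatI_imI : quatI.imI = 1 := rfl
@[simp] theorem quatI_imJ : quatI.imJ = 0 := rfl
@[simp] theorem quatI_imK : quatI.imK = 0 := rfl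
@[simp] theorem quatJ_re : quatJ.re = 0 := rfl
@[simp] theorem quatJ_imI : quatJ.imI = 0 := rfl
@[simp] theorem quatJ_imJ : quatJ.imJ = 1 := rfl
@[simp] theorem quatJ_imK : quatJ.imK = 0 := rfl
@[simp] theorem quatK_re : quatK.re = 0 := rfl
@[simp] theorem quatK_imI : quatK.imI = 0 := rfl
@[simp] theorem quatK_imJ : quatK.imJ = 0 := rfl
@[simp] theorem quatK_imK : quatK.imK = 1 := rfl
theorem star_quatI : star quatI = -quatI := by ext <;> simp
theorem star_quatJ : star quatJ = -quatJ := by ext <;> simp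
theorem star_quatK : star quatK = -quatK := by ext <;> simp
theorem quatI_mul_self : quatI * quatI = -1 := by ext <;> simp
theorem quatJ_mul_self : quatJ * quatJ = -1 := by ext <;> simp
theorem quatK_mul_self : quatK * quatK = -1 := by ext <;> simp
theorem quatI_ne_zero : quatI ≠ 0 := fun h => by
  simpa using congrArg (fun z : ℍ[ℝ] => z.imI) h
theorem quatK_ne_zero : quatK ≠ 0 := fun h => by
  simpa using congrArg (fun z : ℍ[ℝ] => z.imK) h

/-- For `a = i, j, k` the map `c ↦ a c a` changes the components of `c` by signs that depend on `a`
except on the real part; agreement of the three leaves only that part. -/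
theorem neg_quatI_conj_eq_re {c : ℍ[ℝ]} (h1 : quatI * c * quatI = quatJ * c * quatJ)
    (h2 : quatI * c * quatI = quatK * c * quatK) : -(quatI * c * quatI) = ((c.re : ℝ) : ℍ[ℝ]) := by
  have hi := congrArg (fun z : ℍ[ℝ] => z.imI) h1
  have hj := congrArg (fun z : ℍ[ℝ] => z.imJ) h1
  have hk := congrArg (fun z : ℍ[ℝ] => z.imK) h2
  simp only [Quaternion.imI_mul, Quaternion.imJ_mul, Quaternion.imK_mul, Quaternion.re_mul, quatI_re,
    quatI_imI, quatI_imJ, quatI_imK, quatJ_re, quatJ_imI, quatJ_imJ, quatJ_imK, quatK_re, quatK_imI,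
    quatK_imJ, quatK_imK] at hi hj hk
  ext
  · simp
  · simp; linarith
  · simp; linarith
  · simp; linarith

end QuaternionUnits

/-! ### Diagonalizability on vectors of elements of the `-1` eigenspace -/

section Diagonalization

/-- An endomorphism of a real vector space without non-real eigenvalues and without non-trivial
Jordan blocks is diagonalizable. -/
theorem iSup_eigenspace_eq_top_of_real_semisimple {V : Type*} [AddCommGroup V] [Module ℝ V]
    [FiniteDimensional ℝ V] (T : Module.End ℝ V)
    (h1 : ∀ (s : ℝ) (u : V), T (T u - s • u) = s • (T u - s • u) → T u = s • u)
    (h2 : ∀ (s t : ℝ) (u v : V), t ≠ 0 → T u = s • u + t • v → T v = s • v - t • u → u = 0) :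
    ⨆ μ : ℝ, T.eigenspace μ = ⊤ := by
  set E := ⨆ μ : ℝ, T.eigenspace μ with hE
  -- On each eigenvector in `E` the operator `T - s` is zero or invertible, so every `y ∈ E` differs
  -- from some `(T - s) z`, `z ∈ E`, by an element of `ker (T - s)`.
  have hsolve : ∀ (s : ℝ) (y : V), y ∈ E → ∃ z ∈ E, T (y - (T z - s • z)) = s • (y - (T z - s • z)) := by
    intro s y hy
    induction hy using Submodule.iSup_induction' with
    | mem μ x hx =>
      have hx' : T x = μ • x := Module.End.mem_eigenspace_iff.mp hx
      have hxE : x ∈ E := Submodule.mem_iSup_of_mem μ hx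
      by_cases hμ : μ = s
      · exact ⟨0, E.zero_mem, by simp [hx', hμ]⟩
      · refine ⟨(μ - s)⁻¹ • x, E.smul_mem _ hxE, ?_⟩
        have : x - (T ((μ - s)⁻¹ • x) - s • (μ - s)⁻¹ • x) = 0 := by
          rw [map_smul, hx', smul_comm s, ← smul_sub, ← sub_smul, smul_smul,
            inv_mul_cancel₀ (sub_ne_zero.mpr hμ), one_smul, sub_self]
        rw [this]; simp
    | zero => exact ⟨0, E.zero_mem, by simp⟩
    | add x y _ _ hx hy =>
      obtain ⟨z, hz, h⟩ := hx
      obtain ⟨z', hz', h'⟩ := hy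
      refine ⟨z + z', E.add_mem hz hz', ?_⟩
      have : x + y - (T (z + z') - s • (z + z')) =
          (x - (T z - s • z)) + (y - (T z' - s • z')) := by
        rw [map_add, smul_add]; abel
      rw [this, map_add, h, h', smul_add]
  -- Induction on the degree of an annihilating polynomial of `x`, removing either a real root or a
  -- pair of conjugate roots.
  have key : ∀ (n : ℕ) (P : Polynomial ℝ), P ≠ 0 → P.natDegree = n →
      ∀ x, Polynomial.aeval T P x = 0 → x ∈ E := by
    intro n
    induction n using Nat.strong_induction_on with
    | _ n ih =>
      intro P hP hdeg x hx
      by_cases hn : n = 0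
      · rw [hn] at hdeg
        rw [Polynomial.eq_C_of_natDegree_eq_zero hdeg] at hx hP
        have hc : P.coeff 0 ≠ 0 := fun h => hP (by rw [h, map_zero])
        rw [Polynomial.aeval_C, Module.algebraMap_end_apply] at hx
        rw [(smul_eq_zero.mp hx).resolve_left hc]
        exact E.zero_mem
      · have hdeg' : P.degree ≠ 0 := by
          rw [Polynomial.degree_eq_natDegree hP, hdeg]
          exact_mod_cast hn
        obtain ⟨z, hz⟩ := IsAlgClosed.exists_aeval_eq_zero ℂ P hdeg'
        by_cases him : z.im = 0
        · have hroot : P.IsRoot z.re := by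
            have hzr : z = algebraMap ℝ ℂ z.re := Complex.ext (by simp) (by simp [him])
            rw [hzr, Polynomial.aeval_algebraMap_apply] at hz
            have := (map_eq_zero_iff _ (algebraMap ℝ ℂ).injective).mp hz
            rwa [Polynomial.coe_aeval_eq_eval] at this
          obtain ⟨Q, rfl⟩ := Polynomial.dvd_iff_isRoot.mpr hroot
          have hQ : Q ≠ 0 := right_ne_zero_of_mul hP
          have hQd : Q.natDegree < n := by
            rw [← hdeg, Polynomial.natDegree_mul (Polynomial.X_sub_C_ne_zero _) hQ,
              Polynomial.natDegree_X_sub_C]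
            omega
          have hy : T x - z.re • x ∈ E := by
            refine ih _ hQd Q hQ rfl _ ?_
            rw [mul_comm, map_mul] at hx
            simpa using hx
          -- After subtracting `w`, the vector `(T - s)(x - w)` is killed by `T - s`; by `h1`, so is
          -- `x - w`.
          obtain ⟨w, hw, hw'⟩ := hsolve z.re _ hy
          have h3 : T x - z.re • x - (T w - z.re • w) = T (x - w) - z.re • (x - w) := by
            rw [map_sub, smul_sub]; abel
          rw [h3] at hw'
          have h4 := h1 _ _ hw'
          have h5 : x - w ∈ E := Submodule.mem_iSup_of_mem z.re (Module.End.mem_eigenspace_iff.mpr h4)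
          simpa using E.add_mem h5 hw
        · obtain ⟨Q, rfl⟩ := P.quadratic_dvd_of_aeval_eq_zero_im_ne_zero hz him
          have hQ : Q ≠ 0 := right_ne_zero_of_mul hP
          set R : Polynomial ℝ := Polynomial.X ^ 2 - Polynomial.C (2 * z.re) * Polynomial.X +
            Polynomial.C (‖z‖ ^ 2) with hR
          have hRd : R.natDegree = 2 := by
            rw [hR]; compute_degree!
          have hQd : Q.natDegree < n := by
            rw [← hdeg, Polynomial.natDegree_mul (left_ne_zero_of_mul hP) hQ, hRd]
            omega
          refine ih _ hQd Q hQ rfl _ ?_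
          rw [map_mul] at hx
          set y := Polynomial.aeval T Q x with hy
          have hx' : T (T y) - (2 * z.re) • T y + (‖z‖ ^ 2) • y = 0 := by
            have : Polynomial.aeval T R y = 0 := hx
            simpa [hR, pow_two, mul_smul, smul_comm (2 : ℝ)] using this
          have hnorm : ‖z‖ ^ 2 = z.re * z.re + z.im * z.im := by
            rw [← Complex.normSq_eq_norm_sq, Complex.normSq_apply]
          -- With the partner `(T y - s y) / t`, the relation `T² - 2 s T + s² + t² = 0` on `y` is
          -- exactly a rotation block, which `h2` forbids. Thus `Q` already annihilates `x`.
          refine h2 z.re z.im y (z.im⁻¹ • (T y - z.re • y)) him ?_ ?_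
          · rw [smul_smul, mul_inv_cancel₀ him, one_smul]; abel
          · rw [map_smul, map_sub, map_smul]
            have h6 : T (T y) = (2 * z.re) • T y - (‖z‖ ^ 2) • y := by
              rw [← sub_eq_zero, ← hx']; abel
            rw [h6, hnorm]
            match_scalars <;> field_simp <;> ring
  rw [eq_top_iff]
  intro x _
  exact key _ (minpoly ℝ T) (minpoly.ne_zero (Algebra.IsIntegral.isIntegral T)) rfl x
    (by rw [minpoly.aeval]; rfl)

variable {𝔤 : Type*} [LieRing 𝔤] [LieAlgebra ℝ 𝔤]

theorem killingForm_lie_apply_involution {Θ : 𝔤 ≃ₗ⁅ℝ⁆ 𝔤} {H : 𝔤} (hH : Θ H = -H) (x y : 𝔤) :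
    killingForm ℝ 𝔤 ⁅H, x⁆ (Θ y) = killingForm ℝ 𝔤 x (Θ ⁅H, y⁆) := by
  rw [LieEquiv.map_lie, hH, neg_lie, map_neg, ← lie_skew, map_neg, LinearMap.neg_apply,
    LieModule.traceForm_apply_lie_apply]

theorem IsCartanInvolution.nonneg {Θ : 𝔤 ≃ₗ⁅ℝ⁆ 𝔤} (hΘ : IsCartanInvolution Θ) (x : 𝔤) :
    0 ≤ -(killingForm ℝ 𝔤 x (Θ x)) := by
  by_cases hx : x = 0
  · simp [hx]
  · exact (hΘ.posDef x hx).le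

theorem IsCartanInvolution.eq_zero {Θ : 𝔤 ≃ₗ⁅ℝ⁆ 𝔤} (hΘ : IsCartanInvolution Θ) {x : 𝔤}
    (h : killingForm ℝ 𝔤 x (Θ x) = 0) : x = 0 := by
  by_contra hx
  have := hΘ.posDef x hx
  linarith

theorem IsCartanInvolution.shifted_symm {Θ : 𝔤 ≃ₗ⁅ℝ⁆ 𝔤} {H : 𝔤} (hH : Θ H = -H) (c : ℝ)
    (x y : 𝔤) : killingForm ℝ 𝔤 (⁅H, x⁆ - c • x) (Θ y) =
      killingForm ℝ 𝔤 x (Θ (⁅H, y⁆ - c • y)) := by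
  simp only [map_sub, LinearMap.sub_apply, map_smul, LinearMap.smul_apply,
    killingForm_lie_apply_involution hH]

/-- A symmetric operator has no Jordan blocks: if `y = S x` and `S y = 0`, then `⟨y, y⟩ = ⟨x, S y⟩ =
0`. -/
theorem IsCartanInvolution.shifted_sq {Θ : 𝔤 ≃ₗ⁅ℝ⁆ 𝔤} (hΘ : IsCartanInvolution Θ) {H : 𝔤}
    (hH : Θ H = -H) {c : ℝ} {x y : 𝔤} (hy : ⁅H, x⁆ - c • x = y) (h : ⁅H, y⁆ - c • y = 0) :
    y = 0 := by
  apply hΘ.eq_zero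
  conv_lhs => enter [1, 2]; rw [← hy]
  rw [IsCartanInvolution.shifted_symm hH, h, map_zero, map_zero]

/-- The square of a symmetric operator is non-negative, so it has no eigenvalue `-r < 0`. -/
theorem IsCartanInvolution.shifted_neg {Θ : 𝔤 ≃ₗ⁅ℝ⁆ 𝔤} (hΘ : IsCartanInvolution Θ) {H : 𝔤}
    (hH : Θ H = -H) {c r : ℝ} (hr : 0 < r) {x y : 𝔤} (hy : ⁅H, x⁆ - c • x = y)
    (h : ⁅H, y⁆ - c • y = -(r • x)) : x = 0 := by
  have h1 : killingForm ℝ 𝔤 y (Θ y) = -(r * killingForm ℝ 𝔤 x (Θ x)) := by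
    conv_lhs => enter [1, 2]; rw [← hy]
    rw [IsCartanInvolution.shifted_symm hH, h]
    simp
  have h2 := hΘ.nonneg y
  have h3 := hΘ.nonneg x
  apply hΘ.eq_zero
  rw [h1] at h2
  nlinarith

variable {p q : ℕ}

theorem exists_herm_eq_one {v : QuatVec p q} (hv : v ≠ 0) : ∃ w, herm v w = 1 := by
  obtain ⟨w, hw⟩ := exists_herm_ne_zero hv
  exact ⟨w <• (herm v w)⁻¹, by rw [herm_rsmul_right, mul_inv_cancel₀ hw]⟩

theorem rsmul_left_cancel {v : QuatVec p q} (hv : v ≠ 0) {a b : ℍ[ℝ]} (h : v <• a = v <• b) :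
    a = b := by
  obtain ⟨k, hk⟩ := Function.ne_iff.mp hv
  exact mul_left_cancel₀ hk (congrFun h k)

/-- A Jordan block on vectors would square to a Jordan chain of `ad H - 2s` of length three, ending
in a multiple of `wedge (v i) v`. Symmetry of `ad H` kills its last term, hence `v`. -/
theorem act_jordan_trivial {Θ : spLie p q ≃ₗ⁅ℝ⁆ spLie p q} (hΘ : IsCartanInvolution Θ)
    {H : spLie p q} (hH : Θ H = -H) (s : ℝ) (u : QuatVec p q)
    (h : act H (act H u - s • u) = s • (act H u - s • u)) : act H u = s • u := by
  set v := act H u - s • u with hv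
  have hu : act H u = s • u + v := by rw [hv]; abel
  have hv0 : v = 0 := by
    have h1 : ⁅H, wedge (u <• quatI) u⁆ - (2 * s) • wedge (u <• quatI) u =
        wedge (v <• quatI) u + wedge (u <• quatI) v := by
      rw [lie_wedge, act_rsmul, hu]
      simp only [smul_add, map_add, LinearMap.add_apply, smul_comm _ s, map_smul,
        LinearMap.smul_apply]
      module
    have h2 : ⁅H, wedge (v <• quatI) u + wedge (u <• quatI) v⁆ -
        (2 * s) • (wedge (v <• quatI) u + wedge (u <• quatI) v) = (2 : ℝ) • wedge (v <• quatI) v := by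
      rw [lie_add, lie_wedge, lie_wedge, act_rsmul, act_rsmul, hu, h]
      simp only [smul_add, map_add, LinearMap.add_apply, smul_comm _ s, map_smul,
        LinearMap.smul_apply]
      module
    have h3 : ⁅H, (2 : ℝ) • wedge (v <• quatI) v⁆ - (2 * s) • ((2 : ℝ) • wedge (v <• quatI) v) = 0 := by
      rw [lie_smul, lie_wedge, act_rsmul, h]
      simp only [smul_comm _ s, map_smul, LinearMap.smul_apply]
      module
    have h4 := hΘ.shifted_sq hH h2 h3
    rw [smul_eq_zero] at h4
    exact eq_zero_of_wedge_rsmul_self star_quatI quatI_ne_zero (h4.resolve_left two_ne_zero)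
  rw [hu, hv0, add_zero]

/-- A rotation with parameter `t` would make `wedge (u a) u - wedge (v a) v` an eigenvector of `(ad
H - 2s)²` for `-4t²`, so the two squares agree for every `a`. Testing on `a = i, j, k` shows that
`u` is a real multiple of `v`, and a real line admits no rotation. -/
theorem act_no_rotation {Θ : spLie p q ≃ₗ⁅ℝ⁆ spLie p q} (hΘ : IsCartanInvolution Θ)
    {H : spLie p q} (hH : Θ H = -H) (s t : ℝ) (u v : QuatVec p q) (ht : t ≠ 0)
    (hu : act H u = s • u + t • v) (hv : act H v = s • v - t • u) : u = 0 := by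
  by_contra hu0
  have key : ∀ a : ℍ[ℝ], wedge (u <• a) u = wedge (v <• a) v := by
    intro a
    have h1 : ⁅H, wedge (u <• a) u - wedge (v <• a) v⁆ -
        (2 * s) • (wedge (u <• a) u - wedge (v <• a) v) =
        (2 * t) • (wedge (v <• a) u + wedge (u <• a) v) := by
      rw [lie_sub, lie_wedge, lie_wedge, act_rsmul, act_rsmul, hu, hv]
      simp only [smul_add, smul_sub, map_add, map_sub, LinearMap.add_apply, LinearMap.sub_apply,
        smul_comm (MulOpposite.op a), map_smul, LinearMap.smul_apply]
      module
    have h2 : ⁅H, (2 * t) • (wedge (v <• a) u + wedge (u <• a) v)⁆ -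
        (2 * s) • ((2 * t) • (wedge (v <• a) u + wedge (u <• a) v)) =
        -((4 * t ^ 2) • (wedge (u <• a) u - wedge (v <• a) v)) := by
      rw [lie_smul, lie_add, lie_wedge, lie_wedge, act_rsmul, act_rsmul, hu, hv]
      simp only [smul_add, smul_sub, map_add, map_sub, LinearMap.add_apply, LinearMap.sub_apply,
        smul_comm (MulOpposite.op a), map_smul, LinearMap.smul_apply]
      module
    exact sub_eq_zero.mp (hΘ.shifted_neg hH (by positivity) h1 h2)
  obtain ⟨w, hw⟩ := exists_herm_eq_one hu0
  set c := herm v w with hc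
  -- Both squares are evaluated on a vector `w` with `⟨u, w⟩ = 1`.
  have hmul : ∀ a : ℍ[ℝ], star a = -a → u <• a = v <• (a * c) := by
    intro a ha
    have h1 := congrArg (fun X => act X w) (key a)
    simp only [wedge_rsmul_self_apply ha, hw, mul_one] at h1
    exact smul_right_injective _ (two_ne_zero' ℝ) h1
  have hv0 : v ≠ 0 := by
    rintro rfl
    have := hmul _ star_quatI
    rw [smul_zero] at this
    have := rsmul_left_cancel hu0 (a := quatI) (b := 0) (by rw [this]; simp)
    exact quatI_ne_zero this
  have hconj : ∀ a : ℍ[ℝ], star a = -a → a * a = -1 → u = v <• (-(a * c * a)) := by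
    intro a ha haa
    have h1 := congrArg (fun z => z <• a) (hmul a ha)
    simp only [← mul_smul, ← MulOpposite.op_mul, haa] at h1
    rw [MulOpposite.op_neg, neg_smul, MulOpposite.op_one, one_smul] at h1
    rw [MulOpposite.op_neg, neg_smul, ← h1, neg_neg]
  have hi := hconj _ star_quatI quatI_mul_self
  have hj := hconj _ star_quatJ quatJ_mul_self
  have hk := hconj _ star_quatK quatK_mul_self
  have hij := rsmul_left_cancel hv0 (hi.symm.trans hj)
  have hik := rsmul_left_cancel hv0 (hi.symm.trans hk)
  have hcr := neg_quatI_conj_eq_re (neg_injective hij) (neg_injective hik)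
  rw [hcr] at hi
  have hur : u = c.re • v := by
    rw [hi]; ext1 k
    simp [Quaternion.mul_coe_eq_smul]
  have h5 : (t + t * c.re ^ 2) • v = 0 := by
    have h6 := hu
    rw [hur, map_smul, hv, hur] at h6
    have : (t + t * c.re ^ 2) • v = (s • c.re • v + t • v) - c.re • (s • v - t • c.re • v) := by
      module
    rw [this, ← h6, sub_self]
  rcases smul_eq_zero.mp h5 with h | h
  · have : t * (1 + c.re ^ 2) = 0 := by linarith
    rcases mul_eq_zero.mp this with h | h
    · exact ht h
    · nlinarith [sq_nonneg c.re]
  · exact hv0 h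

end Diagonalization


/-! ### Weights of `𝔞` on vectors and on the algebra -/

section VectorWeights

variable {p q : ℕ}

/-- The vectors of weight `l` in `ℍ^{p+q}`, for the action of `𝔞`. -/
def vecWeight (𝔞 : Submodule ℝ (spLie p q)) (l : Module.Dual ℝ 𝔞) : Submodule ℝ (QuatVec p q) where
  carrier := {w | ∀ H : 𝔞, act (H : spLie p q) w = l H • w}
  add_mem' {x y} hx hy H := by rw [map_add, hx H, hy H, smul_add]
  zero_mem' H := by simp
  smul_mem' c x hx H := by rw [map_smul, hx H, smul_comm]

variable {𝔞 : Submodule ℝ (spLie p q)} {l m : Module.Dual ℝ 𝔞} {u v : QuatVec p q}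

theorem rsmul_mem_vecWeight (hu : u ∈ vecWeight 𝔞 l) (a : ℍ[ℝ]) : u <• a ∈ vecWeight 𝔞 l := by
  intro H
  rw [act_rsmul, hu H, smul_comm]

theorem act_mem_vecWeight {α : Module.Dual ℝ 𝔞} {X : spLie p q} (hX : X ∈ rootSpaceOf 𝔞 α)
    (hu : u ∈ vecWeight 𝔞 l) : act X u ∈ vecWeight 𝔞 (α + l) := by
  intro H
  have h := act_lie (H : spLie p q) X u
  rw [hX H, hu H, map_smul, map_smul, LinearMap.smul_apply] at h
  rw [LinearMap.add_apply, add_smul, h, sub_add_cancel]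

theorem wedge_mem_rootSpaceOf (hu : u ∈ vecWeight 𝔞 l) (hv : v ∈ vecWeight 𝔞 m) :
    wedge u v ∈ rootSpaceOf 𝔞 (l + m) := by
  intro H
  rw [lie_wedge, hu H, hv H, map_smul, map_smul, LinearMap.smul_apply, ← add_smul,
    LinearMap.add_apply]

theorem herm_eq_zero_of_weight (hu : u ∈ vecWeight 𝔞 l) (hv : v ∈ vecWeight 𝔞 m)
    (h : l + m ≠ 0) : herm u v = 0 := by
  obtain ⟨H, hH⟩ := DFunLike.ne_iff.mp h
  have h1 := herm_act_left (H : spLie p q) u v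
  rw [hu H, hv H, map_smul, LinearMap.smul_apply, map_smul, eq_neg_iff_add_eq_zero,
    ← add_smul] at h1
  exact (smul_eq_zero.mp h1).resolve_left hH

/-- Generalized eigenspaces of commuting operators decompose the space simultaneously; here they are
true eigenspaces, and on a non-zero one the eigenvalue depends linearly on `H`. -/
theorem iSup_vecWeight_eq_top {Θ : spLie p q ≃ₗ⁅ℝ⁆ spLie p q} (hΘ : IsCartanInvolution Θ)
    (h𝔞 : IsAbelianInMinusPart Θ 𝔞) : ⨆ l, vecWeight 𝔞 l = ⊤ := by
  have hgen : ∀ (H : 𝔞) (s : ℝ) (x : QuatVec p q),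
      x ∈ Module.End.maxGenEigenspace (act (H : spLie p q)) s → act (H : spLie p q) x = s • x := by
    intro H s x hx
    obtain ⟨k, hk⟩ := (Module.End.mem_maxGenEigenspace _ _ _).mp hx
    have : ∀ k, ((act (H : spLie p q) - s • (1 : Module.End ℝ (QuatVec p q))) ^ k) x = 0 →
        ((act (H : spLie p q) - s • (1 : Module.End ℝ (QuatVec p q))) ^ 1) x = 0 := by
      intro k
      induction k with
      | zero => intro h; rw [show x = 0 from h, map_zero]
      | succ k ih =>
        intro h
        cases k with
        | zero => exact h
        | succ k =>
          apply ih
          rw [pow_succ', pow_succ', Module.End.mul_apply, Module.End.mul_apply] at h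
          rw [pow_succ', Module.End.mul_apply]
          have h3 := act_jordan_trivial hΘ (h𝔞.minus H H.2) s _ (sub_eq_zero.mp h)
          exact sub_eq_zero.mpr h3
    have h1 := this k hk
    rw [pow_one] at h1
    exact sub_eq_zero.mp h1
  have hcomm : Pairwise fun H K : 𝔞 =>
      Commute (act (H : spLie p q) : Module.End ℝ (QuatVec p q)) (act (K : spLie p q)) := by
    intro H K _
    refine LinearMap.ext fun w => ?_
    have := act_lie (H : spLie p q) K w
    rw [h𝔞.abelian H H.2 K K.2, map_zero, LinearMap.zero_apply] at this
    exact (sub_eq_zero.mp this.symm)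
  have htop := Module.End.iSup_iInf_maxGenEigenspace_eq_top_of_iSup_maxGenEigenspace_eq_top_of_commute
    (fun H : 𝔞 => (act (H : spLie p q) : Module.End ℝ (QuatVec p q))) hcomm (fun H => by
      rw [eq_top_iff, ← iSup_eigenspace_eq_top_of_real_semisimple (act (H : spLie p q))
        (fun s u h => act_jordan_trivial hΘ (h𝔞.minus H H.2) s u h)
        (fun s t u v ht h h' => act_no_rotation hΘ (h𝔞.minus H H.2) s t u v ht h h')]
      exact iSup_mono fun s => (Module.End.genEigenspace _ s).monotone le_top)
  rw [eq_top_iff, ← htop]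
  refine iSup_le fun χ x hx => ?_
  have hx' : ∀ H : 𝔞, act (H : spLie p q) x = χ H • x := fun H =>
    hgen H _ x ((Submodule.mem_iInf _).mp hx H)
  by_cases hx0 : x = 0
  · rw [hx0]; exact Submodule.zero_mem _
  · refine Submodule.mem_iSup_of_mem
      { toFun := χ
        map_add' := fun H K => smul_left_injective ℝ hx0 ?_
        map_smul' := fun c H => smul_left_injective ℝ hx0 ?_ } hx'
    · change χ (H + K) • x = (χ H + χ K) • x
      rw [← hx', add_smul, ← hx', ← hx', Submodule.coe_add, map_add, LinearMap.add_apply]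
    · change χ (c • H) • x = (c • χ H) • x
      rw [← hx', smul_assoc, ← hx', Submodule.coe_smul, map_smul, LinearMap.smul_apply]

theorem iSup_rootSpaceOf_eq_top (h : ⨆ l, vecWeight 𝔞 l = ⊤) : ⨆ α, rootSpaceOf 𝔞 α = ⊤ := by
  have hw : ∀ u v : QuatVec p q, wedge u v ∈ ⨆ α, rootSpaceOf 𝔞 α := by
    intro u v
    have hu : u ∈ ⨆ l, vecWeight 𝔞 l := h ▸ Submodule.mem_top
    have hv : v ∈ ⨆ l, vecWeight 𝔞 l := h ▸ Submodule.mem_top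
    induction hu using Submodule.iSup_induction' with
    | zero => rw [map_zero]; exact Submodule.zero_mem _
    | add x y _ _ hx hy => rw [map_add]; exact Submodule.add_mem _ hx hy
    | mem l x hx =>
      induction hv using Submodule.iSup_induction' with
      | zero => rw [map_zero]; exact Submodule.zero_mem _
      | add y z _ _ hy hz => rw [map_add]; exact Submodule.add_mem _ hy hz
      | mem m y hy => exact Submodule.mem_iSup_of_mem _ (wedge_mem_rootSpaceOf hx hy)
  rw [eq_top_iff]
  intro X _
  have h2 : (2 : ℝ) • X ∈ ⨆ α, rootSpaceOf 𝔞 α := by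
    rw [two_smul_eq_sum_wedge]
    exact Submodule.sum_mem _ fun k _ => Submodule.smul_mem _ _ (hw _ _)
  simpa using Submodule.smul_mem _ (2⁻¹ : ℝ) h2

end VectorWeights

/-! ### The Witt index -/

section Isotropic

variable {p q : ℕ}

theorem eq_zero_of_isotropic_of_inl {z : QuatVec p q} (hz : herm z z = 0)
    (h : ∀ k, z (Sum.inl k) = 0) : z = 0 := by
  rw [herm_apply, Fintype.sum_sum_type] at hz
  simp only [h, mul_zero, smul_zero, Finset.sum_const_zero, zero_add] at hz
  have hre := congrArg (fun x : ℍ[ℝ] => x.re) hz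
  have h1 : ∀ k : Fin q, (star (z (Sum.inr k)) * z (Sum.inr k)) =
      ((Quaternion.normSq (z (Sum.inr k)) : ℝ) : ℍ[ℝ]) := fun k => Quaternion.star_mul_self _
  simp only [h1, signEntry, Sum.elim_inr, neg_smul, one_smul, Finset.sum_neg_distrib] at hre
  have h2 : ∑ k : Fin q, Quaternion.normSq (z (Sum.inr k)) = 0 := by
    have h3 : -∑ k : Fin q, ((Quaternion.normSq (z (Sum.inr k)) : ℝ) : ℍ[ℝ]) =
        ((-∑ k : Fin q, Quaternion.normSq (z (Sum.inr k)) : ℝ) : ℍ[ℝ]) := by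
      rw [Quaternion.coe_neg]
      congr 1
      exact (map_sum (algebraMap ℝ ℍ[ℝ]) _ _).symm
    rw [h3, Quaternion.re_coe] at hre
    simpa using hre
  ext1 k
  rcases k with k | k
  · exact h k
  · have := (Finset.sum_eq_zero_iff_of_nonneg (fun k _ => Quaternion.normSq_nonneg)).mp h2 k
      (Finset.mem_univ k)
    exact Quaternion.normSq_eq_zero.mp this

/-- `p` is the Witt index: an isotropic family with a dual family spans a maximal isotropic
subspace. -/
theorem eq_sum_of_isotropic {f f' : Fin p → QuatVec p q} (hff : ∀ i j, herm (f i) (f j) = 0)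
    (hf' : ∀ i j, herm (f' i) (f j) = if i = j then 1 else 0) {w : QuatVec p q}
    (hw : herm w w = 0) (hfw : ∀ j, herm (f j) w = 0) :
    w = ∑ j, f j <• herm (f' j) w := by
  let comb : (Fin p → ℍ[ℝ]) × ℍ[ℝ] →ₗ[ℝ] QuatVec p q :=
    { toFun := fun a => ∑ j, f j <• a.1 j + w <• a.2
      map_add' := fun a b => by
        simp only [Prod.fst_add, Prod.snd_add, Pi.add_apply, MulOpposite.op_add, add_smul,
          Finset.sum_add_distrib]
        abel
      map_smul' := fun c a => by
        simp only [Prod.smul_fst, Prod.smul_snd, Pi.smul_apply, MulOpposite.op_smul, smul_assoc,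
          RingHom.id_apply, smul_add, Finset.smul_sum] }
  have hcomb : ∀ a, comb a = ∑ j, f j <• a.1 j + w <• a.2 := fun a => rfl
  let head : QuatVec p q →ₗ[ℝ] (Fin p → ℍ[ℝ]) := LinearMap.funLeft ℝ _ Sum.inl
  -- There are `p + 1` quaternionic coefficients against `p` positive coordinates, so a non-trivial
  -- combination lies in the negative definite part. It is isotropic, hence zero, and pairing with
  -- the dual family shows that the coefficient of `w` is invertible.
  have hker : LinearMap.ker (head ∘ₗ comb) ≠ ⊥ := by
    apply LinearMap.ker_ne_bot_of_finrank_lt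
    simp [Module.finrank_prod, Module.finrank_pi_fintype, Quaternion.finrank_eq_four]
  obtain ⟨a, ha, ha0⟩ := (Submodule.ne_bot_iff _).mp hker
  have hzero : comb a = 0 := by
    refine eq_zero_of_isotropic_of_inl ?_ (fun k => congrFun ha k)
    have hwf : ∀ j, herm w (f j) = 0 := fun j => herm_swap_eq_zero (hfw j)
    rw [hcomb]
    simp only [map_add, map_sum, LinearMap.add_apply, LinearMap.sum_apply, herm_rsmul_left,
      herm_rsmul_right, hff, hw, hfw, hwf]
    simp
  have ha1 : ∀ j, a.1 j = -(herm (f' j) w * a.2) := by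
    intro j
    have := congrArg (herm (f' j)) hzero
    rw [hcomb] at this
    simp only [map_add, map_sum, herm_rsmul_right, hf', map_zero, ite_mul, one_mul, zero_mul,
      Finset.sum_ite_eq, Finset.mem_univ, if_true] at this
    exact eq_neg_of_add_eq_zero_left this
  have ha2 : a.2 ≠ 0 := by
    intro h
    apply ha0
    ext1
    · ext1 j
      rw [ha1, h]; simp
    · exact h
  rw [hcomb] at hzero
  have h1 : w <• a.2 = (∑ j, f j <• herm (f' j) w) <• a.2 := by
    rw [Finset.smul_sum]
    rw [add_comm] at hzero
    rw [eq_neg_of_add_eq_zero_left hzero, ← Finset.sum_neg_distrib]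
    refine Finset.sum_congr rfl fun j _ => ?_
    rw [ha1, MulOpposite.op_neg, neg_smul, neg_neg, MulOpposite.op_mul, mul_smul]
  have h2 := congrArg (fun z : QuatVec p q => z <• a.2⁻¹) h1
  simpa only [← mul_smul, ← MulOpposite.op_mul, mul_inv_cancel₀ ha2, MulOpposite.op_one,
    one_smul] using h2

end Isotropic

/-! ### Witt bases adapted to `𝔞` -/

section Frame

variable {p q : ℕ}

/-- A Witt basis of `ℍ^{p+q}` adapted to `𝔞`: the weights of `f i` and `f' i` are `e i` and `-e i`,
and `h` is the basis of `𝔞` dual to `e`. -/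
structure IsWittFrame (𝔞 : Submodule ℝ (spLie p q)) (e : Fin p → Module.Dual ℝ 𝔞) (h : Fin p → 𝔞)
    (f f' : Fin p → QuatVec p q) : Prop where
  span : ⨆ l, vecWeight 𝔞 l = ⊤
  coord : ∀ i j, e i (h j) = if i = j then 1 else 0
  ext_coord : ∀ l m : Module.Dual ℝ 𝔞, (∀ i, l (h i) = m (h i)) → l = m
  mem_f : ∀ i, f i ∈ vecWeight 𝔞 (e i)
  mem_f' : ∀ i, f' i ∈ vecWeight 𝔞 (-e i)
  herm_ff' : ∀ i j, herm (f i) (f' j) = if i = j then 1 else 0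

variable {𝔞 : Submodule ℝ (spLie p q)} {e : Fin p → Module.Dual ℝ 𝔞} {h : Fin p → 𝔞}
  {f f' : Fin p → QuatVec p q}

namespace IsWittFrame

variable (F : IsWittFrame 𝔞 e h f f')
include F

theorem herm_f'f (i j : Fin p) : herm (f' i) (f j) = if i = j then 1 else 0 := by
  rw [← star_herm, F.herm_ff']
  by_cases hij : j = i
  · simp [hij]
  · simp [hij, Ne.symm hij]

theorem e_add_e_ne_zero (i j : Fin p) : e i + e j ≠ 0 := by
  intro h0
  have := congrArg (fun l : Module.Dual ℝ 𝔞 => l (h i)) h0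
  simp only [LinearMap.add_apply, F.coord, if_true, LinearMap.zero_apply] at this
  split_ifs at this <;> norm_num at this

theorem e_injective {i j : Fin p} (hij : e i = e j) : i = j := by
  by_contra hne
  have := congrArg (fun l : Module.Dual ℝ 𝔞 => l (h i)) hij
  simp [F.coord, Ne.symm hne] at this

theorem e_ne_zero (i : Fin p) : e i ≠ 0 := fun h0 => F.e_add_e_ne_zero i i (by simp [h0])

theorem herm_ff (i j : Fin p) : herm (f i) (f j) = 0 :=
  herm_eq_zero_of_weight (F.mem_f i) (F.mem_f j) (F.e_add_e_ne_zero i j)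

theorem herm_f'f' (i j : Fin p) : herm (f' i) (f' j) = 0 :=
  herm_eq_zero_of_weight (F.mem_f' i) (F.mem_f' j) (by
    rw [← neg_add, neg_ne_zero]; exact F.e_add_e_ne_zero i j)

theorem eq_zero_of_orthogonal {w : QuatVec p q} (hw : herm w w = 0) (h1 : ∀ j, herm (f j) w = 0)
    (h2 : ∀ j, herm (f' j) w = 0) : w = 0 := by
  rw [eq_sum_of_isotropic F.herm_ff F.herm_f'f hw h1]
  simp [h2]

theorem eq_rsmul_f {i : Fin p} {w : QuatVec p q} (hw : w ∈ vecWeight 𝔞 (e i)) :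
    w = f i <• herm (f' i) w := by
  have h1 := eq_sum_of_isotropic F.herm_ff F.herm_f'f
    (herm_eq_zero_of_weight hw hw (F.e_add_e_ne_zero i i))
    (fun j => herm_eq_zero_of_weight (F.mem_f j) hw (F.e_add_e_ne_zero j i))
  rw [Finset.sum_eq_single i] at h1
  · exact h1
  · intro j _ hj
    rw [herm_eq_zero_of_weight (F.mem_f' j) hw, MulOpposite.op_zero, zero_smul]
    rw [neg_add_eq_sub, sub_ne_zero]
    exact fun h0 => hj (F.e_injective h0).symm
  · simp

theorem eq_rsmul_f' {i : Fin p} {w : QuatVec p q} (hw : w ∈ vecWeight 𝔞 (-e i)) :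
    w = f' i <• herm (f i) w := by
  rw [← sub_eq_zero]
  have hmem : w - f' i <• herm (f i) w ∈ vecWeight 𝔞 (-e i) :=
    Submodule.sub_mem _ hw (rsmul_mem_vecWeight (F.mem_f' i) _)
  have hneg : ∀ j, -e j + -e i ≠ 0 := fun j => by
    rw [← neg_add, neg_ne_zero]; exact F.e_add_e_ne_zero j i
  refine F.eq_zero_of_orthogonal (herm_eq_zero_of_weight hmem hmem (hneg i)) (fun j => ?_)
    (fun j => herm_eq_zero_of_weight (F.mem_f' j) hmem (hneg j))
  by_cases hj : j = i
  · subst hj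
    rw [map_sub, herm_rsmul_right, F.herm_ff', if_pos rfl, one_mul, sub_self]
  · refine herm_eq_zero_of_weight (F.mem_f j) hmem ?_
    rw [← sub_eq_add_neg, sub_ne_zero]
    exact fun h0 => hj (F.e_injective h0)

/-- For a weight other than `0` and `±eᵢ`, a vector is isotropic and orthogonal to the whole frame;
maximality of the span of the `f i` leaves only zero. -/
theorem eq_zero_of_weight {l : Module.Dual ℝ 𝔞} {w : QuatVec p q} (hw : w ∈ vecWeight 𝔞 l)
    (h0 : l ≠ 0) (h1 : ∀ i, l ≠ e i) (h2 : ∀ i, l ≠ -e i) : w = 0 := by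
  refine F.eq_zero_of_orthogonal (herm_eq_zero_of_weight hw hw ?_)
    (fun j => herm_eq_zero_of_weight (F.mem_f j) hw ?_)
    (fun j => herm_eq_zero_of_weight (F.mem_f' j) hw ?_)
  · rw [← two_smul ℝ l]
    exact smul_ne_zero two_ne_zero h0
  · intro h3
    exact h2 j (eq_neg_of_add_eq_zero_right h3)
  · intro h3
    exact h1 j (neg_add_eq_zero.mp h3).symm

/-- The weight-0 space is orthogonal to the frame, so an isotropic vector in it would enlarge a
maximal isotropic subspace. -/
theorem eq_zero_of_isotropic {w : QuatVec p q} (hw : w ∈ vecWeight 𝔞 0) (h0 : herm w w = 0) :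
    w = 0 := by
  refine F.eq_zero_of_orthogonal h0 (fun j => herm_eq_zero_of_weight (F.mem_f j) hw ?_)
    (fun j => herm_eq_zero_of_weight (F.mem_f' j) hw ?_)
  · rw [add_zero]; exact F.e_ne_zero j
  · rw [add_zero, neg_ne_zero]; exact F.e_ne_zero j

theorem ext_act {X Y : spLie p q} (h1 : ∀ i, act X (f i) = act Y (f i))
    (h2 : ∀ i, act X (f' i) = act Y (f' i)) (h3 : ∀ w ∈ vecWeight 𝔞 0, act X w = act Y w) :
    X = Y := by
  apply spLie_ext
  intro w
  have hw : w ∈ ⨆ l, vecWeight 𝔞 l := F.span ▸ Submodule.mem_top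
  induction hw using Submodule.iSup_induction' with
  | zero => simp
  | add x y _ _ hx hy => rw [map_add, map_add, hx, hy]
  | mem l x hx =>
    by_cases h0 : l = 0
    · exact h3 x (h0 ▸ hx)
    · by_cases he : ∃ i, l = e i
      · obtain ⟨i, rfl⟩ := he
        rw [F.eq_rsmul_f hx, act_rsmul, act_rsmul, h1]
      · by_cases he' : ∃ i, l = -e i
        · obtain ⟨i, rfl⟩ := he'
          rw [F.eq_rsmul_f' hx, act_rsmul, act_rsmul, h2]
        · push Not at he he'
          rw [F.eq_zero_of_weight hx h0 he he']
          simp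

/-- A weight of `ℍ^{p+q}` has coordinates `0` and `±1`. -/
theorem eq_zero_of_coord {l : Module.Dual ℝ 𝔞} {w : QuatVec p q} (hw : w ∈ vecWeight 𝔞 l)
    (i : Fin p) (hi : 1 < |l (h i)|) : w = 0 := by
  refine F.eq_zero_of_weight hw ?_ ?_ ?_
  · rintro rfl
    norm_num at hi
  · rintro j rfl
    rw [F.coord] at hi
    split_ifs at hi <;> norm_num at hi
  · rintro j rfl
    rw [LinearMap.neg_apply, F.coord] at hi
    split_ifs at hi <;> norm_num at hi

/-- A weight of `ℍ^{p+q}` has at most one non-zero coordinate. -/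
theorem eq_zero_of_two_coords {l : Module.Dual ℝ 𝔞} {w : QuatVec p q} (hw : w ∈ vecWeight 𝔞 l)
    {i j : Fin p} (hij : i ≠ j) (hi : l (h i) ≠ 0) (hj : l (h j) ≠ 0) : w = 0 := by
  refine F.eq_zero_of_weight hw ?_ ?_ ?_
  · rintro rfl
    simp at hi
  · rintro k rfl
    rw [F.coord] at hi hj
    simp only [ne_eq, ite_eq_right_iff, one_ne_zero, imp_false, not_not] at hi hj
    exact hij (hi.symm.trans hj)
  · rintro k rfl
    rw [LinearMap.neg_apply, F.coord] at hi hj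
    simp only [ne_eq, neg_eq_zero, ite_eq_right_iff, one_ne_zero, imp_false, not_not] at hi hj
    exact hij (hi.symm.trans hj)

end IsWittFrame

/-- Roots are sorted by their `i`-th coordinate. The values `0` and `1` are left without
identification of the root, because later arguments need only the coordinate there. -/
theorem canonicalRoots_coord {e : Fin p → Module.Dual ℝ 𝔞} {h : Fin p → 𝔞}
    (coord : ∀ i j, e i (h j) = if i = j then 1 else 0) {α : Module.Dual ℝ 𝔞}
    (hα : α ∈ canonicalRoots p q e) (i : Fin p) :
    (α (h i) = 2 ∧ α = 2 • e i) ∨ (α (h i) = -2 ∧ α = -(2 • e i)) ∨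
    (α (h i) = -1 ∧ ((p < q ∧ α = -e i) ∨
      ∃ j, j ≠ i ∧ (α = -(e i + e j) ∨ α = -(e i - e j)))) ∨ α (h i) = 0 ∨ α (h i) = 1 := by
  have hc : ∀ j, e j (h i) = if j = i then 1 else 0 := fun j => coord j i
  rcases hα with (⟨k, rfl⟩ | ⟨k, l, hkl, rfl | rfl⟩ | ⟨hpq, k, rfl⟩) |
    (⟨k, hk⟩ | ⟨k, l, hkl, hk | hk⟩ | ⟨hpq, k, hk⟩)
  · by_cases hki : k = i
    · subst hki; left; simp [hc]
    · simp [hc, hki]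
  · by_cases hki : k = i
    · have : l ≠ i := by omega
      simp [hc, hki, this]
    · by_cases hli : l = i <;> simp [hc, hki, hli]
  · by_cases hki : k = i
    · have : l ≠ i := by omega
      simp [hc, hki, this]
    · by_cases hli : l = i
      · right; right; left
        subst hli
        exact ⟨by simp [hc, hki], Or.inr ⟨k, hki, Or.inr (by abel)⟩⟩
      · simp [hc, hki, hli]
  · by_cases hki : k = i <;> simp [hc, hki]
  · obtain rfl : α = -(2 • e k) := by rw [← hk, neg_neg]
    by_cases hki : k = i
    · subst hki; right; left; simp [hc]
    · simp [hc, hki]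
  · obtain rfl : α = -(e k + e l) := by rw [← hk, neg_neg]
    by_cases hki : k = i
    · subst hki
      have : l ≠ k := by omega
      right; right; left
      exact ⟨by simp [hc, this], Or.inr ⟨l, this, Or.inl rfl⟩⟩
    · by_cases hli : l = i
      · right; right; left
        subst hli
        exact ⟨by simp [hc, hki], Or.inr ⟨k, hki, Or.inl (by abel)⟩⟩
      · simp [hc, hki, hli]
  · obtain rfl : α = -(e k - e l) := by rw [← hk, neg_neg]
    by_cases hki : k = i
    · subst hki
      have : l ≠ k := by omega
      right; right; left
      exact ⟨by simp [hc, this], Or.inr ⟨l, this, Or.inr rfl⟩⟩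
    · by_cases hli : l = i <;> simp [hc, hki, hli]
  · obtain rfl : α = -e k := by rw [← hk, neg_neg]
    by_cases hki : k = i
    · subst hki
      right; right; left
      exact ⟨by simp [hc], Or.inl ⟨hpq, rfl⟩⟩
    · simp [hc, hki]

end Frame

/-! ### Construction of a Witt basis from the root system -/

section FrameExistence

variable {p q : ℕ} {𝔞 : Submodule ℝ (spLie p q)}

theorem double_weight_mem {l : Module.Dual ℝ 𝔞} {u : QuatVec p q} (hu : u ∈ vecWeight 𝔞 l)
    (hu0 : u ≠ 0) (hl : l ≠ 0) : 2 • l ∈ rootSet 𝔞 := by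
  refine ⟨smul_ne_zero two_ne_zero hl, fun hbot => hu0 ?_⟩
  have := wedge_mem_rootSpaceOf (rsmul_mem_vecWeight hu quatI) hu
  rw [← two_nsmul, hbot, Submodule.mem_bot] at this
  exact eq_zero_of_wedge_rsmul_self star_quatI quatI_ne_zero this

theorem exists_dual_coord (e : Module.Basis (Fin p) ℝ (Module.Dual ℝ 𝔞)) :
    ∃ h : Fin p → 𝔞, (∀ i j, e i (h j) = if i = j then 1 else 0) ∧
      ∀ l m : Module.Dual ℝ 𝔞, (∀ i, l (h i) = m (h i)) → l = m := by
  let h : Fin p → 𝔞 := fun j => (Module.evalEquiv ℝ 𝔞).symm (e.coord j)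
  have hh : ∀ (l : Module.Dual ℝ 𝔞) j, l (h j) = e.repr l j := fun l j => by
    rw [Module.apply_evalEquiv_symm_apply]; rfl
  refine ⟨h, fun i j => ?_, fun l m hlm => e.repr.injective (Finsupp.ext fun i => ?_)⟩
  · rw [hh, e.repr_self, Finsupp.single_apply]
  · rw [← hh, ← hh, hlm]

theorem exists_isWittFrame {Θ : spLie p q ≃ₗ⁅ℝ⁆ spLie p q} (hΘ : IsCartanInvolution Θ)
    (h𝔞 : IsAbelianInMinusPart Θ 𝔞) (e : Module.Basis (Fin p) ℝ (Module.Dual ℝ 𝔞))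
    (hΔ : rootSet 𝔞 = canonicalRoots p q e) : ∃ h f f', IsWittFrame 𝔞 e h f f' := by
  have hspan := iSup_vecWeight_eq_top hΘ h𝔞
  obtain ⟨h, coord, ext_coord⟩ := exists_dual_coord e
  -- The twisted square of a weight vector shows that `2l` is a root, whose coordinates have
  -- absolute value at most 2; the value `-2` occurs only for `-2eᵢ`.
  have hbound : ∀ (l : Module.Dual ℝ 𝔞) (u : QuatVec p q), u ∈ vecWeight 𝔞 l → u ≠ 0 → l ≠ 0 →
      ∀ i, |l (h i)| ≤ 1 ∧ (l (h i) = -1 → l = -e i) := by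
    intro l u hu hu0 hl i
    have h2 : (2 • l) (h i) = 2 * l (h i) := by simp
    have := canonicalRoots_coord coord (hΔ ▸ double_weight_mem hu hu0 hl) i
    rw [h2] at this
    rcases this with ⟨h3, _⟩ | ⟨h3, h4⟩ | ⟨h3, _⟩ | h3 | h3
    · have : l (h i) = 1 := by linarith
      rw [this]; norm_num
    · refine ⟨by rw [show l (h i) = -1 by linarith]; norm_num, fun _ => ?_⟩
      ext x
      have := congrArg (fun l : Module.Dual ℝ 𝔞 => l x) h4
      simp only [LinearMap.smul_apply, LinearMap.neg_apply, nsmul_eq_mul, Nat.cast_ofNat] at this ⊢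
      linarith
    · rw [show l (h i) = -1 / 2 by linarith]; norm_num [abs_le]
    · rw [show l (h i) = 0 by linarith]; norm_num
    · rw [show l (h i) = 1 / 2 by linarith]; norm_num [abs_le]
  have hex : ∀ i, ∃ u v : QuatVec p q, u ∈ vecWeight 𝔞 (e i) ∧ v ∈ vecWeight 𝔞 (-e i) ∧
      herm u v = 1 := by
    intro i
    have hroot : 2 • e i ∈ rootSet 𝔞 := hΔ ▸ Or.inl (Or.inl ⟨i, rfl⟩)
    obtain ⟨X, hX, hX0⟩ := (Submodule.ne_bot_iff _).mp hroot.2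
    have hw : ∃ l, ∃ w ∈ vecWeight 𝔞 l, act X w ≠ 0 := by
      by_contra! hcon
      apply hX0
      apply spLie_ext
      intro w
      rw [map_zero, LinearMap.zero_apply]
      have hw : w ∈ ⨆ l, vecWeight 𝔞 l := hspan ▸ Submodule.mem_top
      induction hw using Submodule.iSup_induction' with
      | zero => simp
      | add x y _ _ hx hy => rw [map_add, hx, hy, add_zero]
      | mem l x hx => exact hcon l x hx
    obtain ⟨l, w, hw, hXw⟩ := hw
    have hw0 : w ≠ 0 := fun h0 => hXw (by rw [h0, map_zero])
    have hmem := act_mem_vecWeight hX hw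
    have hval : ((2 • e i : Module.Dual ℝ 𝔞) + l) (h i) = 2 + l (h i) := by simp [coord]
    -- The image `act X w` has weight `2eᵢ + l`. The bounds `-1 ≤ l(hᵢ)` and `2 + l(hᵢ) ≤ 1` leave
    -- `l(hᵢ) = -1`; zero weights are treated apart because `hbound` concerns non-zero ones.
    have hl : l = -e i := by
      by_cases hl0 : l = 0
      · have hl2 : (2 • e i : Module.Dual ℝ 𝔞) + l ≠ 0 := by
          rw [hl0, add_zero]; exact hroot.1
        have := (hbound _ _ hmem hXw hl2 i).1
        rw [hval, hl0] at this
        norm_num at this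
      · have hb := hbound _ _ hw hw0 hl0 i
        by_cases hl2 : (2 • e i : Module.Dual ℝ 𝔞) + l = 0
        · rw [hl2] at hval
          simp only [LinearMap.zero_apply] at hval
          rw [show l (h i) = -2 by linarith] at hb
          norm_num at hb
        · have := (hbound _ _ hmem hXw hl2 i).1
          rw [hval] at this
          exact hb.2 (by linarith [(abs_le.mp this).2, (abs_le.mp hb.1).1])
    rw [hl, two_nsmul, add_assoc, add_neg_cancel, add_zero] at hmem
    have hz : ∃ m, ∃ z ∈ vecWeight 𝔞 m, herm (act X w) z ≠ 0 := by
      by_contra! hcon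
      obtain ⟨z, hz⟩ := exists_herm_ne_zero hXw
      apply hz
      have hz' : z ∈ ⨆ l, vecWeight 𝔞 l := hspan ▸ Submodule.mem_top
      induction hz' using Submodule.iSup_induction' with
      | zero => simp
      | add x y _ _ hx hy =>
        rw [map_add]
        by_cases h1 : herm (act X w) x = 0
        · by_cases h2 : herm (act X w) y = 0
          · rw [h1, h2, add_zero]
          · exact absurd (hy h2) h2
        · exact absurd (hx h1) h1
      | mem l x hx => exact hcon l x hx
    obtain ⟨m, z, hz, hne⟩ := hz
    have hm : m = -e i := by
      by_contra hm
      exact hne (herm_eq_zero_of_weight hmem hz fun h0 => hm (eq_neg_of_add_eq_zero_right h0))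
    refine ⟨act X w, z <• (herm (act X w) z)⁻¹, hmem, rsmul_mem_vecWeight (hm ▸ hz) _, ?_⟩
    rw [herm_rsmul_right, mul_inv_cancel₀ hne]
  choose f f' hf hf' hff' using hex
  refine ⟨h, f, f', hspan, coord, ext_coord, hf, hf', fun i j => ?_⟩
  by_cases hij : i = j
  · subst hij; rw [if_pos rfl, hff']
  · rw [if_neg hij]
    refine herm_eq_zero_of_weight (hf i) (hf' j) fun h0 => hij ?_
    have := congrArg (fun l : Module.Dual ℝ 𝔞 => l (h i)) h0
    simp [coord, Ne.symm hij] at this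

end FrameExistence


/-! ### The copy of `𝔰𝔭(1, 1)` attached to a hyperbolic pair -/

section HyperbolicPair

variable {p q : ℕ}

/-- The real linear map `r ↦ wedge (u r) v`. -/
def tilt (u v : QuatVec p q) : ℍ[ℝ] →ₗ[ℝ] spLie p q where
  toFun r := wedge (u <• r) v
  map_add' r s := by rw [MulOpposite.op_add, add_smul, map_add, LinearMap.add_apply]
  map_smul' c r := by
    rw [MulOpposite.op_smul, smul_assoc, map_smul, LinearMap.smul_apply, RingHom.id_apply]

theorem tilt_apply (u v : QuatVec p q) (r : ℍ[ℝ]) : tilt u v r = wedge (u <• r) v := rfl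

/-- The real linear map which sends an imaginary `r` to the endomorphism `w ↦ u r ⟨u, w⟩`. -/
def square (u : QuatVec p q) : ℍ[ℝ] →ₗ[ℝ] spLie p q := (2⁻¹ : ℝ) • tilt u u

theorem square_apply (u : QuatVec p q) (r : ℍ[ℝ]) : square u r = (2⁻¹ : ℝ) • wedge (u <• r) u := rfl

theorem act_square {r : ℍ[ℝ]} (hr : star r = -r) (u w : QuatVec p q) :
    act (square u r) w = u <• (r * herm u w) := by
  rw [square_apply, map_smul, LinearMap.smul_apply, wedge_rsmul_self_apply hr, smul_smul]
  norm_num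

theorem act_tilt (u v w : QuatVec p q) (r : ℍ[ℝ]) :
    act (tilt u v r) w = u <• (r * herm v w) - v <• (star r * herm u w) := by
  rw [tilt_apply, act_wedge, herm_rsmul_left, ← mul_smul, ← MulOpposite.op_mul]

theorem eq_zero_of_square_eq_zero {u : QuatVec p q} {r : ℍ[ℝ]} (hr : star r = -r) (hr0 : r ≠ 0)
    (h : square u r = 0) : u = 0 := by
  rw [square_apply, smul_eq_zero] at h
  exact eq_zero_of_wedge_rsmul_self hr hr0 (h.resolve_left (by norm_num))

variable {u v : QuatVec p q}

/-- The two opposite copies of `Im ℍ` bracket into `ℍ` by quaternion multiplication. For `r = s⁻¹`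
the bracket is `tilt u v 1`, so every non-zero imaginary `s` belongs to an `𝔰𝔩₂`-triple. -/
theorem lie_square_square (huv : herm u v = 1) {r s : ℍ[ℝ]} (hr : star r = -r) (hs : star s = -s) :
    ⁅square u r, square v s⁆ = tilt u v (r * s) := by
  have hvu : herm v u = 1 := by rw [← star_herm, huv, star_one]
  apply spLie_ext
  intro w
  rw [act_lie, act_square hr, act_square hs, act_square hs, act_square hr, act_tilt,
    herm_rsmul_right, herm_rsmul_right, huv, hvu, star_mul, hr, hs]
  simp only [one_mul, mul_assoc, neg_mul, mul_neg, neg_neg]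

theorem lie_tilt_square_right (hvv : herm v v = 0) (huv : herm u v = 1) {r s : ℍ[ℝ]} (hs : star s = -s) :
    ⁅tilt u v r, square v s⁆ = square v (-(star r * s + s * r)) := by
  have hvu : herm v u = 1 := by rw [← star_herm, huv, star_one]
  have hs' : star (-(star r * s + s * r)) = -(-(star r * s + s * r)) := by
    simp [hs]
  apply spLie_ext
  intro w
  rw [act_lie, act_square hs, act_square hs, act_square hs', act_tilt, act_tilt, map_sub,
    herm_rsmul_right, herm_rsmul_right, herm_rsmul_right, herm_rsmul_right, huv, hvv, hvu]
  simp only [one_mul, zero_mul, mul_zero, MulOpposite.op_zero, zero_smul, zero_sub, sub_zero,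
    ← neg_smul, ← MulOpposite.op_neg, ← sub_smul, ← MulOpposite.op_sub]
  congr 2
  noncomm_ring

theorem lie_tilt_square_left (huu : herm u u = 0) (huv : herm u v = 1) {r s : ℍ[ℝ]} (hs : star s = -s) :
    ⁅tilt u v r, square u s⁆ = square u (r * s + s * star r) := by
  have hvu : herm v u = 1 := by rw [← star_herm, huv, star_one]
  have hs' : star (r * s + s * star r) = -(r * s + s * star r) := by
    simp [hs]
  apply spLie_ext
  intro w
  rw [act_lie, act_square hs, act_square hs, act_square hs', act_tilt, act_tilt, map_sub,
    herm_rsmul_right, herm_rsmul_right, herm_rsmul_right, herm_rsmul_right, huv, huu, hvu]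
  simp only [one_mul, zero_mul, mul_zero, MulOpposite.op_zero, zero_smul, zero_sub, sub_zero,
    ← sub_smul, ← MulOpposite.op_sub]
  congr 2
  noncomm_ring

theorem lie_tilt_tilt (huu : herm u u = 0) (hvv : herm v v = 0) (huv : herm u v = 1) (r s : ℍ[ℝ]) :
    ⁅tilt u v r, tilt u v s⁆ = tilt u v (r * s - s * r) := by
  have hvu : herm v u = 1 := by rw [← star_herm, huv, star_one]
  rw [tilt_apply u v s, lie_wedge, act_tilt, act_tilt, herm_rsmul_right, herm_rsmul_right, huu, hvv,
    huv, hvu, map_sub]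
  simp only [zero_mul, mul_zero, MulOpposite.op_zero, zero_smul, zero_sub, map_neg, one_mul, mul_one]
  rw [← wedge_rsmul_left, ← mul_smul, ← MulOpposite.op_mul, map_zero, sub_zero, tilt_apply,
    MulOpposite.op_sub, sub_smul, map_sub, LinearMap.sub_apply, sub_eq_add_neg]

end HyperbolicPair

/-! ### Root vectors of a Witt basis -/

section WittFrameElements

variable {p q : ℕ} {𝔞 : Submodule ℝ (spLie p q)} {e : Fin p → Module.Dual ℝ 𝔞} {h : Fin p → 𝔞}
  {f f' : Fin p → QuatVec p q}

namespace IsWittFrame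

variable (F : IsWittFrame 𝔞 e h f f')
include F

theorem herm_ff'_self (i : Fin p) : herm (f i) (f' i) = 1 := by rw [F.herm_ff', if_pos rfl]

theorem herm_f'f_self (i : Fin p) : herm (f' i) (f i) = 1 := by rw [F.herm_f'f, if_pos rfl]

theorem herm_f_zero (i : Fin p) {w : QuatVec p q} (hw : w ∈ vecWeight 𝔞 0) : herm (f i) w = 0 :=
  herm_eq_zero_of_weight (F.mem_f i) hw (by rw [add_zero]; exact F.e_ne_zero i)

theorem herm_f'_zero (i : Fin p) {w : QuatVec p q} (hw : w ∈ vecWeight 𝔞 0) : herm (f' i) w = 0 :=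
  herm_eq_zero_of_weight (F.mem_f' i) hw (by rw [add_zero, neg_ne_zero]; exact F.e_ne_zero i)

theorem tilt_one (i : Fin p) : tilt (f i) (f' i) 1 = (h i : spLie p q) := by
  refine F.ext_act (fun j => ?_) (fun j => ?_) (fun w hw => ?_)
  · rw [act_tilt, F.mem_f j, F.herm_ff, F.herm_f'f, F.coord]
    by_cases hij : i = j
    · subst hij; simp
    · simp [hij, Ne.symm hij]
  · rw [act_tilt, F.mem_f' j, F.herm_f'f', F.herm_ff', LinearMap.neg_apply, F.coord]
    by_cases hij : i = j
    · subst hij; simp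
    · simp [hij, Ne.symm hij]
  · rw [act_tilt, hw (h i), F.herm_f_zero i hw, F.herm_f'_zero i hw]
    simp

theorem square_f_mem (i : Fin p) (r : ℍ[ℝ]) : square (f i) r ∈ rootSpaceOf 𝔞 (2 • e i) := by
  rw [square_apply, two_nsmul]
  exact Submodule.smul_mem _ _ (wedge_mem_rootSpaceOf (rsmul_mem_vecWeight (F.mem_f i) r) (F.mem_f i))

theorem square_f'_mem (i : Fin p) (r : ℍ[ℝ]) : square (f' i) r ∈ rootSpaceOf 𝔞 (-(2 • e i)) := by
  rw [square_apply, two_nsmul, neg_add]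
  exact Submodule.smul_mem _ _
    (wedge_mem_rootSpaceOf (rsmul_mem_vecWeight (F.mem_f' i) r) (F.mem_f' i))

theorem tilt_mem (i : Fin p) (r : ℍ[ℝ]) : tilt (f i) (f' i) r ∈ rootSpaceOf 𝔞 0 := by
  have := wedge_mem_rootSpaceOf (rsmul_mem_vecWeight (F.mem_f i) r) (F.mem_f' i)
  rwa [add_neg_cancel] at this

/-- The root space of `-2eᵢ` consists of the elements `square (f' i) r` with `r` imaginary. -/
theorem exists_eq_square_f' {i : Fin p} {X : spLie p q} (hX : X ∈ rootSpaceOf 𝔞 (-(2 • e i))) :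
    ∃ r, star r = -r ∧ X = square (f' i) r := by
  have hmem : act X (f i) ∈ vecWeight 𝔞 (-e i) := by
    have := act_mem_vecWeight hX (F.mem_f i)
    rwa [show -(2 • e i) + e i = -e i by rw [two_nsmul]; abel] at this
  have hr : star (herm (f i) (act X (f i))) = -herm (f i) (act X (f i)) := by
    rw [star_herm, herm_act_left]
  -- `X` lowers the `i`-th coordinate by 2, which leaves the range of weights unless that coordinate
  -- was positive; so only `f i` survives.
  have hbig : ∀ (l : Module.Dual ℝ 𝔞) (w : QuatVec p q), w ∈ vecWeight 𝔞 l → l (h i) ≤ 0 →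
      act X w = 0 := by
    intro l w hw hl
    refine F.eq_zero_of_coord (act_mem_vecWeight hX hw) i ?_
    have : (-(2 • e i) + l) (h i) = -2 + l (h i) := by simp [F.coord]
    rw [this, lt_abs]
    right; linarith
  refine ⟨herm (f i) (act X (f i)), hr, F.ext_act (fun j => ?_) (fun j => ?_) (fun w hw => ?_)⟩
  · rw [act_square hr]
    by_cases hij : j = i
    · subst hij
      rw [F.herm_f'f_self, mul_one]
      exact F.eq_rsmul_f' hmem
    · rw [F.herm_f'f, if_neg (Ne.symm hij), mul_zero, MulOpposite.op_zero, zero_smul]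
      exact hbig _ _ (F.mem_f j) (by rw [F.coord, if_neg hij])
  · rw [act_square hr, F.herm_f'f', mul_zero, MulOpposite.op_zero, zero_smul]
    refine hbig _ _ (F.mem_f' j) ?_
    rw [LinearMap.neg_apply, F.coord]
    split_ifs <;> norm_num
  · rw [act_square hr, F.herm_f'_zero i hw, mul_zero, MulOpposite.op_zero, zero_smul]
    exact hbig _ _ hw (by simp)

end IsWittFrame

end WittFrameElements

/-! ### Conformal invariance and weights -/

section BilinearForms

variable {𝔤 : Type*} [LieRing 𝔤] [LieAlgebra ℝ 𝔤] {𝔞 𝔫 : Submodule ℝ 𝔤} {𝔥 : LieSubalgebra ℝ 𝔤}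
  {B : LinearMap.BilinForm ℝ 𝔤} {δ α β : Module.Dual ℝ 𝔞}

namespace IsConformalTriple

variable (hB : IsConformalTriple 𝔞 𝔫 𝔥 B δ)
include hB

theorem pairing_eq_zero {x y : 𝔤} (hx : x ∈ rootSpaceOf 𝔞 α) (hy : y ∈ rootSpaceOf 𝔞 β)
    (h : α + β ≠ δ) : B x y = 0 := by
  obtain ⟨H, hH⟩ := DFunLike.ne_iff.mp h
  have h1 := hB.distortion H x y
  rw [hx H, hy H, map_smul, map_smul, LinearMap.smul_apply, smul_eq_mul, smul_eq_mul] at h1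
  have h2 : ((α + β) H - δ H) * B x y = 0 := by
    rw [LinearMap.add_apply]; linarith
  exact (mul_eq_zero.mp h2).resolve_left (sub_ne_zero.mpr hH)

/-- The scaling factor is a character, hence vanishes on `x`, which is a multiple of `[H, x]`
whenever `α(H) ≠ 0`. -/
theorem invariant {x : 𝔤} (hx : x ∈ rootSpaceOf 𝔞 α) (hα : α ≠ 0) (hn : x ∈ 𝔫) (u v : 𝔤) :
    B ⁅x, u⁆ v = -B u ⁅x, v⁆ := by
  obtain ⟨H, hH⟩ := DFunLike.ne_iff.mp hα
  obtain ⟨c, hc⟩ : ∃ c : ℝ, ∀ u v, B ⁅x, u⁆ v + B u ⁅x, v⁆ = c * B u v :=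
    hB.le_stabilizer (Submodule.mem_sup_right hn)
  have hd := hB.distortion H
  have h1 : ∀ w : 𝔤, α H • ⁅x, w⁆ = ⁅(H : 𝔤), ⁅x, w⁆⁆ - ⁅x, ⁅(H : 𝔤), w⁆⁆ := fun w => by
    rw [← smul_lie, ← hx H, lie_lie]
  have h2 : α H * (B ⁅x, u⁆ v + B u ⁅x, v⁆) = 0 := by
    have h3 : α H * B ⁅x, u⁆ v = B ⁅(H : 𝔤), ⁅x, u⁆⁆ v - B ⁅x, ⁅(H : 𝔤), u⁆⁆ v := by
      rw [← smul_eq_mul, ← LinearMap.smul_apply, ← map_smul, h1, map_sub, LinearMap.sub_apply]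
    have h4 : α H * B u ⁅x, v⁆ = B u ⁅(H : 𝔤), ⁅x, v⁆⁆ - B u ⁅x, ⁅(H : 𝔤), v⁆⁆ := by
      rw [← smul_eq_mul, ← map_smul, h1, map_sub]
    rw [mul_add, h3, h4]
    linear_combination hd ⁅x, u⁆ v - hc ⁅(H : 𝔤), u⁆ v + hd u ⁅x, v⁆ - hc u ⁅(H : 𝔤), v⁆ +
      δ H * hc u v - c * hd u v
  exact eq_neg_of_add_eq_zero_left ((mul_eq_zero.mp h2).resolve_left hH)

theorem mem_of_pairing (htop : ⨆ α, rootSpaceOf 𝔞 α = ⊤) {x : 𝔤} (hx : x ∈ rootSpaceOf 𝔞 α)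
    (h : ∀ y ∈ rootSpaceOf 𝔞 (δ - α), B x y = 0) : x ∈ 𝔥 := by
  rw [hB.ker_eq]
  intro y
  have hy : y ∈ ⨆ α, rootSpaceOf 𝔞 α := htop ▸ Submodule.mem_top
  induction hy using Submodule.iSup_induction' with
  | zero => rw [map_zero]
  | add y z _ _ hy hz => rw [map_add, hy, hz, add_zero]
  | mem β y hy =>
    by_cases hαβ : α + β = δ
    · exact h y (by rwa [← hαβ, add_sub_cancel_left])
    · exact hB.pairing_eq_zero hx hy hαβ

/-- The distortion is not a positive root, unless it pairs trivially with `𝔤_0`. -/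
theorem pairing_zero_of_pos (hpos : rootSpaceOf 𝔞 δ ≤ 𝔫) {v x : 𝔤} (hv : v ∈ rootSpaceOf 𝔞 0) (hx : x ∈ rootSpaceOf 𝔞 δ) : B v x = 0 := by
  obtain ⟨H, hH⟩ := DFunLike.ne_iff.mp hB.distortion_ne_zero
  rw [LinearMap.zero_apply] at hH
  have hinv := fun y (hy : y ∈ rootSpaceOf 𝔞 δ) =>
    hB.invariant hy hB.distortion_ne_zero (hpos hy)
  have hlie : ∀ y ∈ rootSpaceOf 𝔞 δ, ⁅y, (H : 𝔤)⁆ = -(δ H • y) := fun y hy => by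
    rw [← lie_skew, hy H]
  -- Skewness of `y` on the pair `(H, H)` doubles `δ(H) B(H, y)` instead of cancelling it. For
  -- general `v`, moving `x` from `[x, H]` onto `v` reduces to this case.
  have h1 : ∀ y ∈ rootSpaceOf 𝔞 δ, B H y = 0 := by
    intro y hy
    have h2 := hinv y hy H H
    rw [hlie y hy, map_neg, map_neg, map_smul, map_smul, LinearMap.neg_apply, LinearMap.smul_apply,
      hB.symm y, smul_eq_mul] at h2
    have : δ H * B H y = 0 := by linarith
    exact (mul_eq_zero.mp this).resolve_left hH
  have h3 := hinv x hx H v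
  have h4 : ⁅x, v⁆ ∈ rootSpaceOf 𝔞 δ := by simpa using lie_mem_rootSpaceOf hx hv
  rw [h1 _ h4, neg_zero, hlie x hx, map_neg, map_smul, LinearMap.neg_apply, LinearMap.smul_apply,
    neg_eq_zero, smul_eq_mul, hB.symm] at h3
  exact (mul_eq_zero.mp h3).resolve_left hH

end IsConformalTriple

/-- A bilinear form on the quaternions which satisfies `b (r s) s = 0` for imaginary `r` and `s` is,
on the imaginary quaternions, a multiple of the scalar product. -/
theorem exists_eq_dot (b : ℍ[ℝ] →ₗ[ℝ] ℍ[ℝ] →ₗ[ℝ] ℝ)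
    (hb : ∀ r s : ℍ[ℝ], star r = -r → star s = -s → b (r * s) s = 0) :
    ∃ c : ℝ, ∀ r s : ℍ[ℝ], star s = -s →
      b r s = c * (r.imI * s.imI + r.imJ * s.imJ + r.imK * s.imK) := by
  have hexp : ∀ r : ℍ[ℝ], r = r.re • 1 + r.imI • quatI + r.imJ • quatJ + r.imK • quatK := by
    intro r
    ext <;> simp
  have e1 : quatI * quatJ = quatK := by ext <;> simp
  have e2 : quatJ * quatK = quatI := by ext <;> simp
  have e3 : quatK * quatI = quatJ := by ext <;> simp
  have e4 : quatJ * quatI = -quatK := by ext <;> simp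
  have e5 : quatK * quatJ = -quatI := by ext <;> simp
  have e6 : quatI * quatK = -quatJ := by ext <;> simp
  have hIJ : star (quatI - quatJ) = -(quatI - quatJ) := by
    rw [star_sub, star_quatI, star_quatJ]; abel
  have hJK : star (quatJ - quatK) = -(quatJ - quatK) := by
    rw [star_sub, star_quatJ, star_quatK]; abel
  have h1 := hb _ _ star_quatI star_quatJ
  have h2 := hb _ _ star_quatJ star_quatK
  have h3 := hb _ _ star_quatK star_quatI
  have h4 := hb _ _ star_quatJ star_quatI
  have h5 := hb _ _ star_quatK star_quatJ
  have h6 := hb _ _ star_quatI star_quatK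
  have h7 := hb _ _ star_quatI star_quatI
  have h8 := hb _ _ star_quatJ star_quatJ
  have h9 := hb _ _ star_quatK star_quatK
  -- Since `k (i - j) = i + j`, this relation equates the diagonal values at `i` and `j` once the
  -- mixed terms vanish; the next one does the same for `j` and `k`.
  have h10 := hb _ _ star_quatK hIJ
  have h11 := hb _ _ star_quatI hJK
  rw [mul_sub, e3, e5] at h10
  rw [mul_sub, e1, e6] at h11
  rw [e1] at h1
  rw [e2] at h2
  rw [e3] at h3
  rw [e4] at h4
  rw [e5] at h5
  rw [e6] at h6
  rw [quatI_mul_self] at h7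
  rw [quatJ_mul_self] at h8
  rw [quatK_mul_self] at h9
  simp only [map_neg, map_sub, LinearMap.neg_apply, neg_eq_zero, sub_neg_eq_add,
    map_add, LinearMap.add_apply] at h1 h2 h3 h4 h5 h6 h7 h8 h9 h10 h11
  refine ⟨b quatI quatI, fun r s hs => ?_⟩
  have hsre : s.re = 0 := by
    have := congrArg (fun z : ℍ[ℝ] => z.re) hs
    simp only [Quaternion.re_star, Quaternion.re_neg] at this
    linarith
  have hJ : b quatJ quatJ = b quatI quatI := by linarith
  have hK : b quatK quatK = b quatI quatI := by linarith
  conv_lhs => rw [hexp r, hexp s, hsre]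
  simp only [zero_smul, zero_add, map_add, map_smul, LinearMap.add_apply, LinearMap.smul_apply,
    smul_eq_mul, h1, h2, h3, h4, h5, h6, h7, h8, h9, hJ, hK]
  ring

end BilinearForms


/-! ### The distortion is the opposite of the highest root -/

section Distortion

variable {p q : ℕ} {𝔞 : Submodule ℝ (spLie p q)} {e : Fin p → Module.Dual ℝ 𝔞} {h : Fin p → 𝔞}
  {f f' : Fin p → QuatVec p q} {𝔥 : LieSubalgebra ℝ (spLie p q)}
  {B : LinearMap.BilinForm ℝ (spLie p q)} {δ : Module.Dual ℝ 𝔞}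

theorem rootSpaceOf_eq_bot (hΔ : rootSet 𝔞 = canonicalRoots p q e) {α : Module.Dual ℝ 𝔞}
    (h0 : α ≠ 0) (hα : α ∉ canonicalRoots p q e) : rootSpaceOf 𝔞 α = ⊥ := by
  by_contra hne
  exact hα (hΔ ▸ ⟨h0, hne⟩)

theorem rootSpaceOf_le_positive {α : Module.Dual ℝ 𝔞} (hα : α ∈ canonicalPosRoots p q e) :
    rootSpaceOf 𝔞 α ≤ ⨆ α ∈ canonicalPosRoots p q e, rootSpaceOf 𝔞 α :=
  le_iSup₂_of_le α hα le_rfl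

theorem ne_zero_of_mem_pos {α : Module.Dual ℝ 𝔞} (hΔ : rootSet 𝔞 = canonicalRoots p q e)
    (hα : α ∈ canonicalPosRoots p q e) : α ≠ 0 := by
  have : α ∈ rootSet 𝔞 := hΔ ▸ Or.inl hα
  exact this.1

namespace IsWittFrame

variable (F : IsWittFrame 𝔞 e h f f') (hΔ : rootSet 𝔞 = canonicalRoots p q e)
  (hB : IsConformalTriple 𝔞 (⨆ α ∈ canonicalPosRoots p q e, rootSpaceOf 𝔞 α) 𝔥 B δ)

include F

theorem rootSpaceOf_eq_bot_of_coord (hΔ : rootSet 𝔞 = canonicalRoots p q e) {α : Module.Dual ℝ 𝔞}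
    (i : Fin p) (hi : 2 < |α (h i)|) : rootSpaceOf 𝔞 α = ⊥ := by
  apply rootSpaceOf_eq_bot hΔ
  · rintro rfl
    norm_num at hi
  · intro hα
    rcases canonicalRoots_coord F.coord hα i with ⟨h1, _⟩ | ⟨h1, _⟩ | ⟨h1, _⟩ | h1 | h1 <;>
      rw [h1] at hi <;> norm_num at hi

include hΔ hB

/-- If `δ + 2eᵢ` is a positive root `β` with `β(hᵢ) = 1`, then `𝔤_0` and `𝔤_δ` are orthogonal. -/
theorem pairing_zero_of_short (i : Fin p) {β : Module.Dual ℝ 𝔞} (hβ : β ∈ canonicalPosRoots p q e)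
    (hδ : β + -(2 • e i) = δ) (hβi : β (h i) = 1) {v w : spLie p q} (hv : v ∈ rootSpaceOf 𝔞 0)
    (hw : w ∈ rootSpaceOf 𝔞 δ) : B v w = 0 := by
  have hδi : δ (h i) = -1 := by
    rw [← hδ]; simp [hβi, F.coord]; norm_num
  have hinv := fun x (hx : x ∈ rootSpaceOf 𝔞 β) =>
    hB.invariant hx (ne_zero_of_mem_pos hΔ hβ) (rootSpaceOf_le_positive hβ hx)
  -- As `x = -[x, hᵢ]`, the pairing with `𝔤_β` is governed by the functional `φ = B(·, hᵢ)` on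
  -- `𝔤_δ`. The aim is to prove `φ = 0`.
  have hpair : ∀ x ∈ rootSpaceOf 𝔞 β, ∀ y, B y x = B ⁅x, y⁆ (h i) := by
    intro x hx y
    have hxh : ⁅x, ((h i : 𝔞) : spLie p q)⁆ = -x := by
      rw [← lie_skew, hx (h i), hβi, one_smul]
    rw [hinv x hx, hxh, map_neg, neg_neg]
  have hmain : ∀ x ∈ rootSpaceOf 𝔞 β, ∀ y, ∀ v ∈ rootSpaceOf 𝔞 0,
      B ⁅x, y⁆ v = B ⁅v, ⁅x, y⁆⁆ (h i) - B ⁅x, ⁅v, y⁆⁆ (h i) := by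
    intro x hx y v hv
    have hxv : ⁅x, v⁆ ∈ rootSpaceOf 𝔞 β := by simpa using lie_mem_rootSpaceOf hx hv
    rw [hinv x hx, hpair _ hxv, lie_lie, map_sub, LinearMap.sub_apply]
    ring
  -- In the `𝔰𝔩₂`-triple through `s`, elements of `𝔤_δ` are lowest weight vectors of weight `-1`, so
  -- they come from `𝔤_β` by bracketing with `square (f' i) s`.
  have hsurj : ∀ s : ℍ[ℝ], star s = -s → s ≠ 0 → ∀ w ∈ rootSpaceOf 𝔞 δ,
      ∃ x ∈ rootSpaceOf 𝔞 β, ⁅x, square (f' i) s⁆ = w := by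
    intro s hs hs0 w hw
    have hs' : star s⁻¹ = -s⁻¹ := by rw [star_inv₀, hs, inv_neg]
    have h1 := lie_square_square (F.herm_ff'_self i) hs' hs
    rw [inv_mul_cancel₀ hs0, F.tilt_one] at h1
    have h2 : ⁅w, square (f' i) s⁆ = 0 := by
      have h3 := lie_mem_rootSpaceOf hw (F.square_f'_mem i s)
      rw [F.rootSpaceOf_eq_bot_of_coord hΔ i] at h3
      · exact h3
      · have : (δ + -(2 • e i)) (h i) = -3 := by
          simp [hδi, F.coord]; norm_num
        rw [this]; norm_num
    refine ⟨-⁅square (f i) s⁻¹, w⁆, ?_, ?_⟩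
    · have h3 := lie_mem_rootSpaceOf (F.square_f_mem i s⁻¹) hw
      rw [← hδ, add_comm, neg_add_cancel_right] at h3
      exact Submodule.neg_mem _ h3
    · rw [neg_lie, lie_lie, h2, lie_zero, zero_sub, neg_neg, h1, ← lie_skew, hw (h i), hδi]
      simp
  -- The element `tilt i` commutes with `square i`, giving `B(w, tilt i) = φ([tilt i, w])` on all of
  -- `𝔤_δ`. Its bracket with `square j` is non-zero, and the same formula acquires an extra term
  -- `φ([x, square 2k])`, which must vanish.
  have hI0 : ⁅tilt (f i) (f' i) quatI, square (f' i) quatI⁆ = 0 := by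
    rw [lie_tilt_square_right (F.herm_f'f' i i) (F.herm_ff'_self i) star_quatI, star_quatI]
    simp
  have hIJ : ⁅tilt (f i) (f' i) quatI, square (f' i) quatJ⁆ = square (f' i) ((2 : ℝ) • quatK) := by
    rw [lie_tilt_square_right (F.herm_f'f' i i) (F.herm_ff'_self i) star_quatJ, star_quatI]
    congr 1
    ext <;> simp <;> norm_num
  have hφ : ∀ w ∈ rootSpaceOf 𝔞 δ, B w (h i) = 0 := by
    intro w hw
    have hK : star ((2 : ℝ) • quatK) = -((2 : ℝ) • quatK) := by
      rw [Quaternion.star_smul, star_quatK, smul_neg]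
    have hI : ∀ w ∈ rootSpaceOf 𝔞 δ, B w (tilt (f i) (f' i) quatI) =
        B ⁅tilt (f i) (f' i) quatI, w⁆ (h i) := by
      intro w hw
      obtain ⟨x, hx, rfl⟩ := hsurj _ star_quatI quatI_ne_zero w hw
      rw [hmain x hx _ _ (F.tilt_mem i _), hI0, lie_zero, map_zero, LinearMap.zero_apply, sub_zero]
    obtain ⟨x, hx, rfl⟩ := hsurj _ hK (smul_ne_zero two_ne_zero quatK_ne_zero) w hw
    have h1 := hmain x hx (square (f' i) quatJ) _ (F.tilt_mem i quatI)
    have hmem : ⁅x, square (f' i) quatJ⁆ ∈ rootSpaceOf 𝔞 δ :=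
      hδ ▸ lie_mem_rootSpaceOf hx (F.square_f'_mem i quatJ)
    rw [hI _ hmem, hIJ] at h1
    linarith
  obtain ⟨x, hx, rfl⟩ := hsurj _ star_quatI quatI_ne_zero w hw
  rw [hB.symm, hinv x hx, hpair _ (by simpa using lie_mem_rootSpaceOf hx hv), neg_eq_zero]
  exact hφ _ (by
    rw [← hδ, ← add_zero β]
    exact lie_mem_rootSpaceOf (lie_mem_rootSpaceOf hx hv) (F.square_f'_mem i _))

/-- The pairing of `𝔤_0` with `𝔤_{-2eᵢ}`, on the subalgebra of the root `2eᵢ`. -/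
theorem exists_pairing_eq_dot (i : Fin p) :
    ∃ c : ℝ, ∀ r s : ℍ[ℝ], star s = -s → B (tilt (f i) (f' i) r) (square (f' i) s) =
      c * (r.imI * s.imI + r.imJ * s.imJ + r.imK * s.imK) := by
  have hpos : 2 • e i ∈ canonicalPosRoots p q e := Or.inl ⟨i, rfl⟩
  refine exists_eq_dot (B.compl₁₂ (tilt (f i) (f' i)) (square (f' i))) fun r s hr hs => ?_
  -- Taking the same element twice in the skewness relation gives `B(tilt (r s), square s) = 0`, the
  -- hypothesis of `exists_eq_dot`.
  have h1 := hB.invariant (F.square_f_mem i r) (ne_zero_of_mem_pos hΔ hpos)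
    (rootSpaceOf_le_positive hpos (F.square_f_mem i r)) (square (f' i) s) (square (f' i) s)
  rw [hB.symm (square (f' i) s), lie_square_square (F.herm_ff'_self i) hr hs] at h1
  rw [LinearMap.compl₁₂_apply]
  linarith

/-- `δ = -2eᵢ` pairs non-trivially with `𝔤_0` only for the first index. -/
theorem pairing_zero_of_long {i k : Fin p} (hki : k < i) (hδ : δ = -(2 • e i)) {v w : spLie p q}
    (hv : v ∈ rootSpaceOf 𝔞 0) (hw : w ∈ rootSpaceOf 𝔞 δ) : B v w = 0 := by
  obtain ⟨c, hc⟩ := F.exists_pairing_eq_dot hΔ hB i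
  have hpos : e k - e i ∈ canonicalPosRoots p q e := Or.inr (Or.inl ⟨k, i, hki, Or.inr rfl⟩)
  have hβi : (e k - e i) (h i) = -1 := by simp [F.coord, hki.ne]
  have hinv := fun x (hx : x ∈ rootSpaceOf 𝔞 (e k - e i)) =>
    hB.invariant hx (ne_zero_of_mem_pos hΔ hpos) (rootSpaceOf_le_positive hpos hx)
  -- The vector `hᵢ` is `tilt 1`, and the scalar product ignores the real part.
  have hh : ∀ w ∈ rootSpaceOf 𝔞 δ, B (h i) w = 0 := by
    intro w hw
    rw [hδ] at hw
    obtain ⟨s, hs, rfl⟩ := F.exists_eq_square_f' hw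
    rw [← F.tilt_one, hc 1 s hs]
    simp
  have hpair : ∀ x ∈ rootSpaceOf 𝔞 (e k - e i), ∀ y ∈ rootSpaceOf 𝔞 (-(e k + e i)), B x y = 0 := by
    intro x hx y hy
    have hxh : ⁅x, ((h i : 𝔞) : spLie p q)⁆ = x := by
      rw [← lie_skew, hx (h i), hβi, neg_one_smul, neg_neg]
    have h1 := hinv x hx (h i) y
    rw [hxh] at h1
    rw [h1, hh, neg_zero]
    have := lie_mem_rootSpaceOf hx hy
    rwa [show e k - e i + -(e k + e i) = δ by rw [hδ, two_nsmul]; abel] at this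
  rw [hδ] at hw
  obtain ⟨s, hs, rfl⟩ := F.exists_eq_square_f' hw
  have hx : wedge (f k) (f' i) ∈ rootSpaceOf 𝔞 (e k - e i) := by
    rw [sub_eq_add_neg]; exact wedge_mem_rootSpaceOf (F.mem_f k) (F.mem_f' i)
  have hy : wedge (f' k <• s) (f' i) ∈ rootSpaceOf 𝔞 (-(e k + e i)) := by
    rw [neg_add]
    exact wedge_mem_rootSpaceOf (rsmul_mem_vecWeight (F.mem_f' k) s) (F.mem_f' i)
  -- Every element of `𝔤_{-2eᵢ}` is a bracket of `𝔤_{eₖ - eᵢ}` with `𝔤_{-(eₖ + eᵢ)}`, so skewness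
  -- moves the pairing onto these two spaces, which are orthogonal by `hpair`.
  have hxy : ⁅wedge (f k) (f' i), wedge (f' k <• s) (f' i)⁆ = (-2 : ℝ) • square (f' i) s := by
    rw [lie_wedge, act_wedge, act_wedge, herm_rsmul_right, herm_rsmul_right, F.herm_ff', F.herm_f'f',
      F.herm_f'f', F.herm_ff', if_pos rfl, if_neg hki.ne, square_apply, smul_smul]
    simp
  have hxv : ⁅wedge (f k) (f' i), v⁆ ∈ rootSpaceOf 𝔞 (e k - e i) := by
    simpa using lie_mem_rootSpaceOf hx hv
  have h1 := hinv _ hx v (wedge (f' k <• s) (f' i))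
  rw [hpair _ hxv _ hy, hxy, map_smul, smul_eq_mul] at h1
  linarith

/-- If `𝔤_0` and `𝔤_δ` are not orthogonal, then `δ` is the opposite of the highest root. -/
theorem distortion_eq [NeZero p] {v w : spLie p q}
    (hv : v ∈ rootSpaceOf 𝔞 0) (hw : w ∈ rootSpaceOf 𝔞 δ) (hvw : B v w ≠ 0) : δ = -(2 • e 0) := by
  have hw0 : w ≠ 0 := fun h0 => hvw (by rw [h0, map_zero])
  have hδΔ : δ ∈ canonicalRoots p q e :=
    hΔ ▸ ⟨hB.distortion_ne_zero, fun hbot => hw0 (by rwa [hbot, Submodule.mem_bot] at hw)⟩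
  rcases hδΔ with hpos | (⟨i, hi⟩ | ⟨i, j, hij, hi | hi⟩ | ⟨hpq, i, hi⟩)
  · exact absurd (hB.pairing_zero_of_pos (rootSpaceOf_le_positive hpos) hv hw) hvw
  · have hδ : δ = -(2 • e i) := by rw [← hi, neg_neg]
    by_cases hi0 : i = 0
    · rw [hδ, hi0]
    · exact absurd (F.pairing_zero_of_long hΔ hB (Fin.pos_iff_ne_zero.mpr hi0) hδ hv hw) hvw
  -- Adding `2eᵢ`, with `i` the smaller index, reverses the sign of `eᵢ` and gives a positive root.
  -- The other short roots are handled likewise.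
  · refine absurd (F.pairing_zero_of_short hΔ hB i (β := e i - e j)
      (Or.inr (Or.inl ⟨i, j, hij, Or.inr rfl⟩)) ?_ ?_ hv hw) hvw
    · rw [← neg_neg δ, hi, two_nsmul]; abel
    · simp [F.coord, hij.ne']
  · refine absurd (F.pairing_zero_of_short hΔ hB i (β := e i + e j)
      (Or.inr (Or.inl ⟨i, j, hij, Or.inl rfl⟩)) ?_ ?_ hv hw) hvw
    · rw [← neg_neg δ, hi, two_nsmul]; abel
    · simp [F.coord, hij.ne']
  · refine absurd (F.pairing_zero_of_short hΔ hB i (β := e i) (Or.inr (Or.inr ⟨hpq, i, rfl⟩)) ?_ ?_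
      hv hw) hvw
    · rw [← neg_neg δ, hi, two_nsmul]; abel
    · simp [F.coord]

end IsWittFrame

end Distortion


/-! ### Simple ideals and compactness -/

section SimpleIdeals

variable {L : Type*} [LieRing L] [LieAlgebra ℝ L]

/-- A real Lie algebra with trivial center and a positive definite invariant form has a negative
definite Killing form. -/
theorem isCompactSemisimple_of_invariant [FiniteDimensional ℝ L] (β : LinearMap.BilinForm ℝ L)
    (symm : ∀ x y, β x y = β y x) (pos : ∀ x, x ≠ 0 → 0 < β x x)
    (inv : ∀ z x y : L, β ⁅z, x⁆ y = -β x ⁅z, y⁆)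
    (center : ∀ x : L, (∀ y : L, ⁅x, y⁆ = 0) → x = 0) :
    IsCompactSemisimple L := by
  intro x hx
  have nonneg : ∀ y, 0 ≤ β y y := fun y => by
    by_cases hy : y = 0
    · simp [hy]
    · exact (pos y hy).le
  let core : InnerProductSpace.Core ℝ L :=
    { inner := fun x y => β x y
      conj_inner_symm := fun x y => symm y x
      re_inner_nonneg := fun x => nonneg x
      add_left := fun x y z => by rw [map_add, LinearMap.add_apply]
      smul_left := fun x y r => by rw [map_smul, LinearMap.smul_apply]; rfl
      definite := fun x hx0 => by
        by_contra hne
        exact (pos x hne).ne' hx0 }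
  let _ : NormedAddCommGroup L := core.toNormedAddCommGroup
  let _ : InnerProductSpace ℝ L := InnerProductSpace.ofCore core.toCore
  have hinner : ∀ x y : L, inner ℝ x y = β x y := fun x y => rfl
  let b := stdOrthonormalBasis ℝ L
  rw [killingForm_apply_apply, LinearMap.trace_eq_sum_inner _ b]
  -- In an orthonormal basis, the trace of `(ad x)²` is minus the sum of the squared lengths of the
  -- `[x, bᵢ]`.
  have hterm : ∀ i, inner ℝ (b i) ((LieAlgebra.ad ℝ L x ∘ₗ LieAlgebra.ad ℝ L x) (b i)) =
      -β ⁅x, b i⁆ ⁅x, b i⁆ := by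
    intro i
    rw [hinner, LinearMap.comp_apply, LieAlgebra.ad_apply, LieAlgebra.ad_apply, inv, neg_neg]
  simp only [hterm, Finset.sum_neg_distrib, neg_lt_zero]
  obtain ⟨i, hi⟩ : ∃ i, ⁅x, b i⁆ ≠ 0 := by
    by_contra! hcon
    apply hx
    apply center
    intro y
    have : LieAlgebra.ad ℝ L x = 0 := b.toBasis.ext fun i => by simpa using hcon i
    rw [← LieAlgebra.ad_apply (R := ℝ), this, LinearMap.zero_apply]
  exact Finset.sum_pos' (fun i _ => nonneg _) ⟨i, Finset.mem_univ i, pos _ hi⟩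

theorem exists_lie_ne_zero_of_isSimple (I : LieIdeal ℝ L) (hI : LieAlgebra.IsSimple ℝ I) :
    ∃ x ∈ I, ∃ y ∈ I, ⁅x, y⁆ ≠ 0 := by
  by_contra! hcon
  exact hI.non_abelian ⟨fun x y => Subtype.ext (hcon x x.2 y y.2)⟩

/-- A simple ideal `I` meets trivially, or is contained in, every subspace which it normalizes. -/
theorem simple_ideal_dichotomy (I : LieIdeal ℝ L) (hI : LieAlgebra.IsSimple ℝ I)
    (J : Submodule ℝ L) (hJ : ∀ x ∈ I, ∀ y ∈ I, y ∈ J → ⁅x, y⁆ ∈ J) :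
    (∀ x ∈ I, x ∈ J → x = 0) ∨ ∀ x ∈ I, x ∈ J := by
  let K : LieIdeal ℝ I :=
    { carrier := {x | (x : L) ∈ J}
      add_mem' := fun {x y} hx hy => J.add_mem hx hy
      zero_mem' := J.zero_mem
      smul_mem' := fun c {x} hx => J.smul_mem c hx
      lie_mem := fun {x y} hy => hJ x x.2 y y.2 hy }
  rcases hI.eq_bot_or_eq_top K with hK | hK
  · left
    intro x hx hxJ
    have : (⟨x, hx⟩ : I) ∈ K := hxJ
    rw [hK, LieSubmodule.mem_bot] at this
    exact congrArg Subtype.val this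
  · right
    intro x hx
    have : (⟨x, hx⟩ : I) ∈ K := hK ▸ LieSubmodule.mem_top _
    exact this

theorem mem_span_lie_of_isSimple (I : LieIdeal ℝ L) (hI : LieAlgebra.IsSimple ℝ I) :
    ∀ x ∈ I, x ∈ Submodule.span ℝ {z | ∃ x ∈ I, ∃ y ∈ I, ⁅x, y⁆ = z} := by
  refine (simple_ideal_dichotomy I hI (Submodule.span ℝ {z | ∃ x ∈ I, ∃ y ∈ I, ⁅x, y⁆ = z})
    fun x hx y hy _ =>
    Submodule.subset_span ⟨x, hx, y, hy, rfl⟩).resolve_left fun hcon => ?_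
  obtain ⟨x, hx, y, hy, hxy⟩ := exists_lie_ne_zero_of_isSimple I hI
  exact hxy (hcon ⁅x, y⁆ (lie_mem_right ℝ L I x y hy) (Submodule.subset_span ⟨x, hx, y, hy, rfl⟩))

theorem center_trivial_of_isSimple (I : LieIdeal ℝ L) (hI : LieAlgebra.IsSimple ℝ I) :
    ∀ x ∈ I, (∀ y ∈ I, ⁅x, y⁆ = 0) → x = 0 := by
  let J : Submodule ℝ L :=
    { carrier := {x | ∀ y ∈ I, ⁅x, y⁆ = 0}
      add_mem' := fun {x y} hx hy z hz => by rw [add_lie, hx z hz, hy z hz, add_zero]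
      zero_mem' := fun z _ => zero_lie z
      smul_mem' := fun c x hx z hz => by rw [smul_lie, hx z hz, smul_zero] }
  rcases simple_ideal_dichotomy I hI J (fun x hx y _ hyJ => by
    rw [← lie_skew, hyJ x hx, neg_zero]; exact J.zero_mem) with h | h
  · exact h
  · obtain ⟨x, hx, y, hy, hxy⟩ := exists_lie_ne_zero_of_isSimple I hI
    exact absurd (h x hx y hy) hxy

end SimpleIdeals

/-! ### The centralizer of a Cartan subspace -/

section CartanSubspace

variable {𝔤 : Type*} [LieRing 𝔤] [LieAlgebra ℝ 𝔤] {Θ : 𝔤 ≃ₗ⁅ℝ⁆ 𝔤} {𝔞 : Submodule ℝ 𝔤}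

theorem lie_eq_zero_of_mem_zero {x y : 𝔤} (hx : x ∈ 𝔞) (hy : y ∈ rootSpaceOf 𝔞 0) : ⁅x, y⁆ = 0 := by
  have := hy ⟨x, hx⟩
  simpa using this

theorem involution_mem_zero (h𝔞 : IsCartanSubspace Θ 𝔞) {y : 𝔤}
    (hy : y ∈ rootSpaceOf 𝔞 0) : Θ y ∈ rootSpaceOf 𝔞 0 := by
  intro H
  have h1 : (H : 𝔤) = Θ (-(H : 𝔤)) := by rw [map_neg, h𝔞.prop.minus H H.2, neg_neg]
  rw [h1, ← LieEquiv.map_lie, neg_lie, hy H]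
  simp

/-- The difference lies in the `-1` eigenspace and commutes with `𝔞`, so maximality of `𝔞` absorbs
it. -/
theorem sub_involution_mem (hΘ : IsCartanInvolution Θ) (h𝔞 : IsCartanSubspace Θ 𝔞) {y : 𝔤}
    (hy : y ∈ rootSpaceOf 𝔞 0) : y - Θ y ∈ 𝔞 := by
  set w := y - Θ y with hw
  have hwΘ : Θ w = -w := by rw [hw, map_sub, hΘ.involutive, neg_sub]
  have hw0 : w ∈ rootSpaceOf 𝔞 0 := Submodule.sub_mem _ hy (involution_mem_zero h𝔞 hy)
  have hbig : IsAbelianInMinusPart Θ (𝔞 ⊔ Submodule.span ℝ {w}) := by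
    constructor
    · intro x hx
      obtain ⟨a, ha, b, hb, rfl⟩ := Submodule.mem_sup.mp hx
      obtain ⟨c, rfl⟩ := Submodule.mem_span_singleton.mp hb
      rw [map_add, map_smul, hwΘ, h𝔞.prop.minus a ha, smul_neg, neg_add]
    · intro x hx x' hx'
      obtain ⟨a, ha, b, hb, rfl⟩ := Submodule.mem_sup.mp hx
      obtain ⟨c, rfl⟩ := Submodule.mem_span_singleton.mp hb
      obtain ⟨a', ha', b', hb', rfl⟩ := Submodule.mem_sup.mp hx'
      obtain ⟨c', rfl⟩ := Submodule.mem_span_singleton.mp hb'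
      have h1 : ⁅w, a'⁆ = 0 := by rw [← lie_skew, lie_eq_zero_of_mem_zero ha' hw0, neg_zero]
      simp [h𝔞.prop.abelian a ha a' ha', lie_eq_zero_of_mem_zero ha hw0, h1]
  have hle := h𝔞.le_of_ge hbig le_sup_left
  exact hle (Submodule.mem_sup_right (Submodule.mem_span_singleton_self w))

/-- Modulo `𝔞`, which is central in `𝔤_0`, every element of `𝔤_0` is fixed by `Θ`; brackets do not
see the difference. -/
theorem involution_lie_of_mem_zero (hΘ : IsCartanInvolution Θ) (h𝔞 : IsCartanSubspace Θ 𝔞) {y z : 𝔤}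
    (hy : y ∈ rootSpaceOf 𝔞 0) (hz : z ∈ rootSpaceOf 𝔞 0) : Θ ⁅y, z⁆ = ⁅y, z⁆ := by
  have h1 : ⁅y, z⁆ = ⁅Θ y, z⁆ := by
    rw [← sub_eq_zero, ← sub_lie, lie_eq_zero_of_mem_zero (sub_involution_mem hΘ h𝔞 hy) hz]
  have h2 : ⁅Θ y, z⁆ = ⁅Θ y, Θ z⁆ := by
    rw [← sub_eq_zero, ← lie_sub, ← lie_skew, lie_eq_zero_of_mem_zero
      (sub_involution_mem hΘ h𝔞 hz) (involution_mem_zero h𝔞 hy), neg_zero]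
  rw [LieEquiv.map_lie, ← h2, ← h1]

end CartanSubspace

/-! ### Simplicity of the algebra of a hyperbolic plane -/

section PlaneCore

variable {p q : ℕ}

/-- The subspace of the elements of `𝔰𝔭(p, q)` that vanish on the orthogonal of `u` and `v`. -/
def planeCore (u v : QuatVec p q) : Submodule ℝ (spLie p q) where
  carrier := {X | ∀ w, herm u w = 0 → herm v w = 0 → act X w = 0}
  add_mem' {X Y} hX hY w h1 h2 := by
    rw [map_add, LinearMap.add_apply, hX w h1 h2, hY w h1 h2, add_zero]
  zero_mem' w _ _ := by rw [map_zero, LinearMap.zero_apply]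
  smul_mem' c X hX w h1 h2 := by rw [map_smul, LinearMap.smul_apply, hX w h1 h2, smul_zero]

variable {u v : QuatVec p q}

theorem square_left_mem_planeCore (r : ℍ[ℝ]) : square u r ∈ planeCore u v := by
  intro w h1 _
  rw [square_apply, map_smul, LinearMap.smul_apply, act_wedge, herm_rsmul_left, h1]
  simp

theorem square_right_mem_planeCore (r : ℍ[ℝ]) : square v r ∈ planeCore u v := by
  intro w _ h2
  rw [square_apply, map_smul, LinearMap.smul_apply, act_wedge, herm_rsmul_left, h2]
  simp

theorem tilt_mem_planeCore (r : ℍ[ℝ]) : tilt u v r ∈ planeCore u v := by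
  intro w h1 h2
  rw [act_tilt, h1, h2]
  simp

/-- By skewness, an element that kills the orthogonal of the plane has its image in the plane. -/
theorem act_eq_of_mem_planeCore (huu : herm u u = 0) (hvv : herm v v = 0) (huv : herm u v = 1)
    {X : spLie p q} (hX : X ∈ planeCore u v) (z : QuatVec p q) :
    act X z = u <• herm v (act X z) + v <• herm u (act X z) := by
  have hvu : herm v u = 1 := by rw [← star_herm, huv, star_one]
  obtain ⟨y, hy⟩ : ∃ y, y = act X z - (u <• herm v (act X z) + v <• herm u (act X z)) := ⟨_, rfl⟩
  have hyu : herm y u = 0 := by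
    apply herm_swap_eq_zero
    rw [hy, map_sub, map_add, herm_rsmul_right, herm_rsmul_right, huu, huv]
    simp
  have hyv : herm y v = 0 := by
    apply herm_swap_eq_zero
    rw [hy, map_sub, map_add, herm_rsmul_right, herm_rsmul_right, hvu, hvv]
    simp
  by_contra hne
  obtain ⟨w, hw⟩ := exists_herm_ne_zero (sub_ne_zero.mpr hne)
  apply hw
  rw [← hy]
  obtain ⟨w', hw'⟩ : ∃ w', w' = w - (u <• herm v w + v <• herm u w) := ⟨_, rfl⟩
  have h1 : herm u w' = 0 := by
    rw [hw', map_sub, map_add, herm_rsmul_right, herm_rsmul_right, huu, huv]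
    simp
  have h2 : herm v w' = 0 := by
    rw [hw', map_sub, map_add, herm_rsmul_right, herm_rsmul_right, hvu, hvv]
    simp
  have h3 : herm y w = herm y w' := by
    rw [hw', map_sub, map_add, herm_rsmul_right, herm_rsmul_right, hyu, hyv]
    simp
  rw [h3, hy, map_sub, map_add, LinearMap.sub_apply, LinearMap.add_apply, herm_rsmul_left,
    herm_rsmul_left, h1, h2, herm_act_left, hX w' h1 h2]
  simp

theorem exists_eq_of_mem_planeCore (huu : herm u u = 0) (hvv : herm v v = 0) (huv : herm u v = 1)
    {X : spLie p q} (hX : X ∈ planeCore u v) : ∃ r s t : ℍ[ℝ], star r = -r ∧ star s = -s ∧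
      X = square u r + tilt u v t + square v s := by
  have hvu : herm v u = 1 := by rw [← star_herm, huv, star_one]
  have hr : star (herm v (act X v)) = -herm v (act X v) := by rw [star_herm, herm_act_left]
  have hs : star (herm u (act X u)) = -herm u (act X u) := by rw [star_herm, herm_act_left]
  have ht : star (herm u (act X v)) = -herm v (act X u) := by rw [star_herm, herm_act_left]
  have ht' : star (herm v (act X u)) = -herm u (act X v) := by rw [star_herm, herm_act_left]
  refine ⟨herm v (act X v), herm u (act X u), herm v (act X u), hr, hs, spLie_ext fun w => ?_⟩
  have h1 : herm v (act X w) = herm v (act X v) * herm u w + herm v (act X u) * herm v w := by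
    have h2 := herm_act_left X v w
    rw [act_eq_of_mem_planeCore huu hvv huv hX v, map_add, LinearMap.add_apply, herm_rsmul_left,
      herm_rsmul_left, hr, ht] at h2
    rw [← neg_inj, ← h2, neg_mul, neg_mul, neg_add]
  have h2 : herm u (act X w) = herm u (act X v) * herm u w + herm u (act X u) * herm v w := by
    have h2 := herm_act_left X u w
    rw [act_eq_of_mem_planeCore huu hvv huv hX u, map_add, LinearMap.add_apply, herm_rsmul_left,
      herm_rsmul_left, hs, ht'] at h2
    rw [← neg_inj, ← h2, neg_mul, neg_mul, neg_add]
  rw [act_eq_of_mem_planeCore huu hvv huv hX w, h1, h2, map_add, map_add, LinearMap.add_apply,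
    LinearMap.add_apply, act_square hr, act_square hs, act_tilt, ht', neg_mul, MulOpposite.op_neg,
    neg_smul, sub_neg_eq_add]
  simp only [MulOpposite.op_add, add_smul]
  abel

/-- The algebra `planeCore u v` of a hyperbolic plane, which is isomorphic to `𝔰𝔭(1, 1)`, has no
non-trivial ideal. -/
theorem planeCore_le_of_ideal (huu : herm u u = 0) (hvv : herm v v = 0) (huv : herm u v = 1)
    {J : Submodule ℝ (spLie p q)} (hJ : J ≤ planeCore u v)
    (hideal : ∀ Y ∈ planeCore u v, ∀ X ∈ J, ⁅Y, X⁆ ∈ J) {X : spLie p q} (hX : X ∈ J) (hX0 : X ≠ 0) :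
    planeCore u v ≤ J := by
  obtain ⟨r, s, t, hr, hs, rfl⟩ := exists_eq_of_mem_planeCore huu hvv huv (hJ hX)
  have hvu : herm v u = 1 := by rw [← star_herm, huv, star_one]
  have hlu : ∀ r : ℍ[ℝ], star r = -r → ⁅tilt u v 1, square u r⁆ = (2 : ℝ) • square u r := by
    intro r hr
    rw [lie_tilt_square_left huu huv hr, star_one, mul_one, one_mul, map_add, two_smul]
  have hlv : ∀ r : ℍ[ℝ], star r = -r → ⁅tilt u v 1, square v r⁆ = -((2 : ℝ) • square v r) := by
    intro r hr
    rw [lie_tilt_square_right hvv huv hr, star_one, mul_one, one_mul, map_neg, map_add, two_smul]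
  have hlt : ⁅tilt u v 1, tilt u v t⁆ = 0 := by
    rw [lie_tilt_tilt huu hvv huv, one_mul, mul_one, sub_self, map_zero]
  have hH := tilt_mem_planeCore (u := u) (v := v) 1
  have h1 := hideal _ hH _ hX
  rw [lie_add, lie_add, hlt, hlu r hr, hlv s hs, add_zero] at h1
  have h2 := hideal _ hH _ h1
  rw [lie_add, lie_smul, lie_neg, lie_smul, hlu r hr, hlv s hs] at h2
  -- The grading element has eigenvalues `2, 0, -2`. From its first and second brackets `2a - 2c`
  -- and `4a + 4c`, the coefficients `1/8` and `1/4` isolate each extreme component.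
  have hr_mem : square u r ∈ J := by
    have h3 := J.add_mem (J.smul_mem (8⁻¹ : ℝ) h2) (J.smul_mem (4⁻¹ : ℝ) h1)
    convert h3 using 1
    module
  have hs_mem : square v s ∈ J := by
    have h3 := J.sub_mem (J.smul_mem (8⁻¹ : ℝ) h2) (J.smul_mem (4⁻¹ : ℝ) h1)
    convert h3 using 1
    module
  have ht_mem : tilt u v t ∈ J := by
    have h3 := J.sub_mem (J.sub_mem hX hr_mem) hs_mem
    convert h3 using 1
    abel
  have hfull_of_u : ∀ r : ℍ[ℝ], star r = -r → square u r ∈ J → square u r ≠ 0 → tilt u v 1 ∈ J := by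
    intro r hr hmem hne
    have hr0 : r ≠ 0 := fun h0 => hne (by rw [h0, map_zero])
    have hr' : star r⁻¹ = -r⁻¹ := by rw [star_inv₀, hr, inv_neg]
    have h3 := hideal _ (square_right_mem_planeCore r⁻¹) _ hmem
    rw [← lie_skew, lie_square_square huv hr hr', mul_inv_cancel₀ hr0] at h3
    exact J.neg_mem_iff.mp h3
  have hH_mem : tilt u v 1 ∈ J := by
    by_cases hr0 : square u r = 0
    · by_cases hs0 : square v s = 0
      · have ht0 : t ≠ 0 := by
          rintro rfl
          rw [hr0, hs0] at hX0
          simp at hX0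
        -- If only the middle component survives, some bracket moves it to the degree-2 part; `x =
        -- i` and `x = j` already detect all components of `t`.
        have hx : ∃ x : ℍ[ℝ], star x = -x ∧ t * x + x * star t ≠ 0 := by
          by_contra! hcon
          have hI := hcon _ star_quatI
          have hJ := hcon _ star_quatJ
          apply ht0
          have hI1 := congrArg (fun z : ℍ[ℝ] => z.imI) hI
          have hI2 := congrArg (fun z : ℍ[ℝ] => z.imJ) hI
          have hI3 := congrArg (fun z : ℍ[ℝ] => z.imK) hI
          have hJ3 := congrArg (fun z : ℍ[ℝ] => z.imK) hJ
          simp at hI1 hI2 hI3 hJ3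
          ext <;> simp <;> linarith
        obtain ⟨x, hx, hne⟩ := hx
        have hx' : star (t * x + x * star t) = -(t * x + x * star t) := by
          simp [hx]
        have h3 := hideal _ (square_left_mem_planeCore x) _ ht_mem
        rw [← lie_skew, lie_tilt_square_left huu huv hx] at h3
        refine hfull_of_u _ hx' (J.neg_mem_iff.mp h3) fun h0 => ?_
        have := eq_zero_of_square_eq_zero hx' hne h0
        rw [this] at huv
        simp at huv
      · have hs0' : s ≠ 0 := fun h0 => hs0 (by rw [h0, map_zero])
        have hs' : star s⁻¹ = -s⁻¹ := by rw [star_inv₀, hs, inv_neg]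
        have h3 := hideal _ (square_left_mem_planeCore s⁻¹) _ hs_mem
        rwa [lie_square_square huv hs' hs, inv_mul_cancel₀ hs0'] at h3
    · exact hfull_of_u r hr hr_mem hr0
  have hu_mem : ∀ r : ℍ[ℝ], star r = -r → square u r ∈ J := by
    intro r hr
    have h3 := hideal _ (square_left_mem_planeCore r) _ hH_mem
    rw [← lie_skew, hlu r hr] at h3
    have h4 := J.smul_mem (2⁻¹ : ℝ) (J.neg_mem_iff.mp h3)
    rwa [smul_smul, inv_mul_cancel₀ two_ne_zero, one_smul] at h4
  have hv_mem : ∀ r : ℍ[ℝ], star r = -r → square v r ∈ J := by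
    intro r hr
    have h3 := hideal _ (square_right_mem_planeCore r) _ hH_mem
    rw [← lie_skew, hlv r hr, neg_neg] at h3
    have h4 := J.smul_mem (2⁻¹ : ℝ) h3
    rwa [smul_smul, inv_mul_cancel₀ two_ne_zero, one_smul] at h4
  have hprod : ∀ r s : ℍ[ℝ], star r = -r → star s = -s → tilt u v (r * s) ∈ J := by
    intro r s hr hs
    rw [← lie_square_square huv hr hs]
    exact hideal _ (square_left_mem_planeCore r) _ (hv_mem s hs)
  have ht_all : ∀ t : ℍ[ℝ], tilt u v t ∈ J := by
    intro t
    have : t = t.re • 1 + t.imI • (quatJ * quatK) + t.imJ • (quatK * quatI) +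
        t.imK • (quatI * quatJ) := by
      ext <;> simp
    rw [this]
    simp only [map_add, map_smul]
    exact J.add_mem (J.add_mem (J.add_mem (J.smul_mem _ hH_mem)
      (J.smul_mem _ (hprod _ _ star_quatJ star_quatK)))
      (J.smul_mem _ (hprod _ _ star_quatK star_quatI)))
      (J.smul_mem _ (hprod _ _ star_quatI star_quatJ))
  intro Y hY
  obtain ⟨r, s, t, hr, hs, rfl⟩ := exists_eq_of_mem_planeCore huu hvv huv hY
  exact J.add_mem (J.add_mem (hu_mem r hr) (ht_all t)) (hv_mem s hs)

end PlaneCore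


/-! ### Simplicity and non-compactness of an ideal of a subalgebra -/

section Subideal

variable {𝔤 : Type*} [LieRing 𝔤] [LieAlgebra ℝ 𝔤] {L : LieSubalgebra ℝ 𝔤} (I : LieIdeal ℝ L)

theorem isSimple_of_forall_le (C : Submodule ℝ 𝔤) (hmem : ∀ x : L, x ∈ I ↔ (x : 𝔤) ∈ C)
    (hCL : ∀ x ∈ C, x ∈ L)
    (hC : ∀ J : Submodule ℝ 𝔤, J ≤ C → (∀ y ∈ C, ∀ z ∈ J, ⁅y, z⁆ ∈ J) → ∀ x ∈ J, x ≠ 0 → C ≤ J)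
    (hne : ∃ x ∈ C, ∃ y ∈ C, ⁅x, y⁆ ≠ 0) : LieAlgebra.IsSimple ℝ I where
  eq_bot_or_eq_top K := by
    by_cases hK : K = ⊥
    · exact Or.inl hK
    right
    obtain ⟨X, hX, hX0⟩ := (Submodule.ne_bot_iff _).mp
      fun h0 => hK ((LieSubmodule.toSubmodule_eq_bot K).mp h0)
    have hle := hC (K.toSubmodule.map (L.toSubmodule.subtype ∘ₗ I.toSubmodule.subtype))
      (by rintro _ ⟨Y, _, rfl⟩; exact (hmem _).mp Y.2)
      (by
        rintro Y hY _ ⟨Z, hZ, rfl⟩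
        exact ⟨⁅(⟨⟨Y, hCL Y hY⟩, (hmem _).mpr hY⟩ : I), Z⁆, K.lie_mem hZ, rfl⟩)
      _ ⟨X, hX, rfl⟩ (fun h0 => hX0 (Subtype.ext (Subtype.ext h0)))
    rw [eq_top_iff]
    intro Y _
    obtain ⟨Z, hZ, hZY⟩ := hle ((hmem _).mp Y.2)
    have : Z = Y := Subtype.ext (Subtype.ext hZY)
    exact this ▸ hZ
  non_abelian := by
    intro hab
    obtain ⟨x, hx, y, hy, hxy⟩ := hne
    have h3 := hab.trivial (⟨⟨x, hCL x hx⟩, (hmem _).mpr hx⟩ : I) ⟨⟨y, hCL y hy⟩, (hmem _).mpr hy⟩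
    exact hxy (congrArg (fun Z : I => ((Z : L) : 𝔤)) h3)

/-- When `(ad x)³ = 0`, the operator `(ad x)²` is nilpotent, so the Killing form vanishes on the
non-zero `x`. -/
theorem not_isCompactSemisimple_of_lie_thrice {x : L} (hxI : x ∈ I) (hx : (x : 𝔤) ≠ 0)
    (hcube : ∀ y : 𝔤, ⁅(x : 𝔤), ⁅(x : 𝔤), ⁅(x : 𝔤), y⁆⁆⁆ = 0) : ¬ IsCompactSemisimple I := by
  intro hcomp
  have hcube' : ∀ y : I, ⁅(⟨x, hxI⟩ : I), ⁅(⟨x, hxI⟩ : I), ⁅(⟨x, hxI⟩ : I), y⁆⁆⁆ = 0 := fun y =>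
    Subtype.ext (Subtype.ext (hcube _))
  have hnil : IsNilpotent (LieAlgebra.ad ℝ I ⟨x, hxI⟩ ∘ₗ LieAlgebra.ad ℝ I ⟨x, hxI⟩) := by
    refine ⟨2, LinearMap.ext fun y => ?_⟩
    rw [pow_two]
    simp only [Module.End.mul_apply, LinearMap.comp_apply, LieAlgebra.ad_apply, hcube', lie_zero,
      LinearMap.zero_apply]
  have := hcomp ⟨x, hxI⟩ fun h0 => hx (congrArg (fun Z : I => ((Z : L) : 𝔤)) h0)
  rw [killingForm_apply_apply, (LinearMap.isNilpotent_trace_of_isNilpotent hnil).eq_zero] at this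
  exact lt_irrefl _ this

end Subideal

/-! ### Identification of `𝔤̂(δ)` and `𝔪̂` for a long root -/

section MoebiusSubalgebra

variable {p q : ℕ} {𝔞 : Submodule ℝ (spLie p q)} {e : Fin p → Module.Dual ℝ 𝔞} {h : Fin p → 𝔞}
  {f f' : Fin p → QuatVec p q}

theorem lie_square_thrice {u : QuatVec p q} (huu : herm u u = 0) {r : ℍ[ℝ]} (hr : star r = -r)
    (Y : spLie p q) : ⁅square u r, ⁅square u r, ⁅square u r, Y⁆⁆⁆ = 0 := by
  have hsq : ∀ w, act (square u r) (act (square u r) w) = 0 := fun w => by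
    rw [act_square hr, act_square hr, herm_rsmul_right, huu]
    simp
  apply spLie_ext
  intro w
  simp only [act_lie, map_sub, hsq]
  simp

/-- A simple ideal is spanned by brackets, and `Θ` fixes brackets in `𝔤_0`. On it the Killing form
of `𝔤` is therefore negative definite, and its opposite is the required invariant form. -/
theorem isCompactSemisimple_of_mem_zero {Θ : spLie p q ≃ₗ⁅ℝ⁆ spLie p q} (hΘ : IsCartanInvolution Θ)
    (h𝔞 : IsCartanSubspace Θ 𝔞) {L : LieSubalgebra ℝ (spLie p q)} (I : LieIdeal ℝ L)
    (hI : LieAlgebra.IsSimple ℝ I) (h0 : ∀ x ∈ I, (x : spLie p q) ∈ rootSpaceOf 𝔞 0) :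
    IsCompactSemisimple I := by
  let S : Submodule ℝ L :=
    { carrier := {x | Θ (x : spLie p q) = x}
      add_mem' := fun {x y} hx hy => by
        change Θ ((x : spLie p q) + y) = x + y
        rw [map_add, hx, hy]
      zero_mem' := map_zero Θ
      smul_mem' := fun c x hx => by
        change Θ (c • (x : spLie p q)) = c • (x : spLie p q)
        rw [map_smul, hx] }
  have hfix : ∀ x ∈ I, Θ (x : spLie p q) = x := by
    have hle : Submodule.span ℝ {z | ∃ x ∈ I, ∃ y ∈ I, ⁅x, y⁆ = z} ≤ S := by
      refine Submodule.span_le.mpr ?_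
      rintro _ ⟨x, hx, y, hy, rfl⟩
      exact involution_lie_of_mem_zero hΘ h𝔞 (h0 x hx) (h0 y hy)
    exact fun x hx => hle (mem_span_lie_of_isSimple I hI x hx)
  let j : I →ₗ[ℝ] spLie p q := L.toSubmodule.subtype ∘ₗ I.toSubmodule.subtype
  refine isCompactSemisimple_of_invariant (-(killingForm ℝ (spLie p q)).compl₁₂ j j) ?_ ?_ ?_ ?_
  · intro x y
    simp only [LinearMap.neg_apply, LinearMap.compl₁₂_apply]
    rw [LieModule.traceForm_comm]
  · intro x hx
    simp only [LinearMap.neg_apply, LinearMap.compl₁₂_apply]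
    have h1 := hΘ.posDef (j x) fun h2 => hx (Subtype.ext (Subtype.ext h2))
    rwa [show Θ (j x) = j x from hfix x x.2] at h1
  · intro z x y
    simp only [LinearMap.neg_apply, LinearMap.compl₁₂_apply]
    have h1 : j ⁅z, x⁆ = ⁅j z, j x⁆ := rfl
    have h2 : j ⁅z, y⁆ = ⁅j z, j y⁆ := rfl
    rw [h1, h2, ← lie_skew, map_neg, LinearMap.neg_apply, LieModule.traceForm_apply_lie_apply]
  · intro x hx
    apply Subtype.ext
    exact center_trivial_of_isSimple I hI x x.2 fun y hy => congrArg Subtype.val (hx ⟨y, hy⟩)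

namespace IsWittFrame

variable (F : IsWittFrame 𝔞 e h f f')
include F

theorem exists_eq_of_mem_multiples (hΔ : rootSet 𝔞 = canonicalRoots p q e) (i : Fin p) {X : spLie p q}
    (hX : X ∈ multiplesSubalgebra 𝔞 (-(2 • e i))) : ∃ a ∈ rootSpaceOf 𝔞 (2 • e i),
      ∃ b ∈ rootSpaceOf 𝔞 0, ∃ c ∈ rootSpaceOf 𝔞 (-(2 • e i)), X = a + b + c := by
  replace hX : X ∈ ⨆ n : ℤ, rootSpaceOf 𝔞 (n • (-(2 • e i))) := hX
  induction hX using Submodule.iSup_induction' with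
  | zero => exact ⟨0, zero_mem _, 0, zero_mem _, 0, zero_mem _, by simp⟩
  | add x y _ _ hx hy =>
    obtain ⟨a, ha, b, hb, c, hc, rfl⟩ := hx
    obtain ⟨a', ha', b', hb', c', hc', rfl⟩ := hy
    exact ⟨a + a', add_mem ha ha', b + b', add_mem hb hb', c + c', add_mem hc hc', by abel⟩
  | mem n x hx =>
    by_cases h0 : n = 0
    · subst h0
      rw [zero_smul] at hx
      exact ⟨0, zero_mem _, x, hx, 0, zero_mem _, by simp⟩
    · by_cases h1 : n = 1
      · subst h1
        rw [one_smul] at hx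
        exact ⟨0, zero_mem _, 0, zero_mem _, x, hx, by simp⟩
      · by_cases h2 : n = -1
        · subst h2
          rw [neg_smul, one_smul, neg_neg] at hx
          exact ⟨x, hx, 0, zero_mem _, 0, zero_mem _, by simp⟩
        · have hval : (n • (-(2 • e i)) : Module.Dual ℝ 𝔞) (h i) = -2 * n := by
            simp [F.coord, mul_comm]
          rw [F.rootSpaceOf_eq_bot_of_coord hΔ i, Submodule.mem_bot] at hx
          · exact ⟨0, zero_mem _, 0, zero_mem _, 0, zero_mem _, by simp [hx]⟩
          · rw [hval, abs_mul]
            have h3 : 2 ≤ |n| := by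
              rcases abs_cases n with ⟨h4, _⟩ | ⟨h4, _⟩ <;> omega
            have h4 : (2 : ℝ) ≤ |(n : ℝ)| := by exact_mod_cast h3
            norm_num
            linarith

/-- The algebra `𝔤_Γ` preserves the plane of `f i` and `f' i`, hence by skewness its orthogonal. -/
theorem orthogonal_act (hΔ : rootSet 𝔞 = canonicalRoots p q e) (i : Fin p) {X : spLie p q}
    (hX : X ∈ multiplesSubalgebra 𝔞 (-(2 • e i))) {w : QuatVec p q} (h1 : herm (f i) w = 0)
    (h2 : herm (f' i) w = 0) : herm (f i) (act X w) = 0 ∧ herm (f' i) (act X w) = 0 := by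
  obtain ⟨a, ha, b, hb, c, hc, rfl⟩ := F.exists_eq_of_mem_multiples hΔ i hX
  have key : ∀ z l, z ∈ vecWeight 𝔞 l → l = e i ∨ l = -e i ∨ 1 < |l (h i)| → herm z w = 0 := by
    rintro z l hz (rfl | rfl | hl)
    · rw [F.eq_rsmul_f hz, herm_rsmul_left, h1, mul_zero]
    · rw [F.eq_rsmul_f' hz, herm_rsmul_left, h2, mul_zero]
    · rw [F.eq_zero_of_coord hz i hl, map_zero, LinearMap.zero_apply]
  rw [← neg_eq_zero, ← herm_act_left, ← neg_eq_zero (a := herm (f' i) _), ← herm_act_left]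
  simp only [map_add, LinearMap.add_apply]
  rw [key _ _ (act_mem_vecWeight ha (F.mem_f i)), key _ _ (act_mem_vecWeight hb (F.mem_f i)),
    key _ _ (act_mem_vecWeight hc (F.mem_f i)), key _ _ (act_mem_vecWeight ha (F.mem_f' i)),
    key _ _ (act_mem_vecWeight hb (F.mem_f' i)), key _ _ (act_mem_vecWeight hc (F.mem_f' i))]
  · simp
  · right; right
    simp [F.coord]
    norm_num
  · right; left; rw [zero_add]
  · left; rw [two_nsmul]; abel
  · right; left; rw [two_nsmul]; abel
  · left; rw [zero_add]
  · right; right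
    simp [F.coord]
    norm_num

/-- The ideal of `𝔤_Γ`, `Γ = {±2eᵢ}`, attached to the hyperbolic plane of `f i` and `f' i`. -/
def coreIdeal (hΔ : rootSet 𝔞 = canonicalRoots p q e) (i : Fin p) :
    LieIdeal ℝ (multiplesSubalgebra 𝔞 (-(2 • e i))) where
  toSubmodule := (planeCore (f i) (f' i)).comap (multiplesSubalgebra 𝔞 (-(2 • e i))).toSubmodule.subtype
  lie_mem {X Y} hY w h1 h2 := by
    change act ⁅(X : spLie p q), (Y : spLie p q)⁆ w = 0
    obtain ⟨h3, h4⟩ := F.orthogonal_act hΔ i X.2 h1 h2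
    have h5 : act (Y : spLie p q) w = 0 := hY w h1 h2
    have h6 : act (Y : spLie p q) (act (X : spLie p q) w) = 0 := hY _ h3 h4
    rw [act_lie, h5, h6, map_zero, sub_zero]

theorem mem_coreIdeal (hΔ : rootSet 𝔞 = canonicalRoots p q e) (i : Fin p)
    (X : multiplesSubalgebra 𝔞 (-(2 • e i))) :
    X ∈ F.coreIdeal hΔ i ↔ (X : spLie p q) ∈ planeCore (f i) (f' i) := Iff.rfl

theorem planeCore_le_multiples (i : Fin p) {X : spLie p q} (hX : X ∈ planeCore (f i) (f' i)) :
    X ∈ multiplesSubalgebra 𝔞 (-(2 • e i)) := by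
  obtain ⟨r, s, t, hr, hs, rfl⟩ :=
    exists_eq_of_mem_planeCore (F.herm_ff i i) (F.herm_f'f' i i) (F.herm_ff'_self i) hX
  have hle : ∀ n : ℤ, rootSpaceOf 𝔞 (n • (-(2 • e i))) ≤
      (multiplesSubalgebra 𝔞 (-(2 • e i))).toSubmodule :=
    fun n => le_iSup (fun n : ℤ => rootSpaceOf 𝔞 (n • (-(2 • e i)))) n
  refine add_mem (add_mem (hle (-1) ?_) (hle 0 ?_)) (hle 1 ?_)
  · rw [neg_smul, one_smul, neg_neg]; exact F.square_f_mem i r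
  · rw [zero_smul]; exact F.tilt_mem i t
  · rw [one_smul]; exact F.square_f'_mem i s

theorem isSimple_coreIdeal (hΔ : rootSet 𝔞 = canonicalRoots p q e) (i : Fin p) :
    LieAlgebra.IsSimple ℝ (F.coreIdeal hΔ i) := by
  refine isSimple_of_forall_le _ (planeCore (f i) (f' i)) (F.mem_coreIdeal hΔ i)
    (fun X hX => F.planeCore_le_multiples i hX) ?_ ?_
  · intro J hJ hJn x hx hx0
    exact planeCore_le_of_ideal (F.herm_ff i i) (F.herm_f'f' i i) (F.herm_ff'_self i) hJ hJn hx hx0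
  · refine ⟨_, square_left_mem_planeCore quatI, _, square_right_mem_planeCore quatI, fun h4 => ?_⟩
    rw [lie_square_square (F.herm_ff'_self i) star_quatI star_quatI, quatI_mul_self, map_neg,
      neg_eq_zero, F.tilt_one] at h4
    have h5 : e i (h i) = 0 := by rw [Subtype.ext (a1 := h i) (a2 := 0) h4, map_zero]
    rw [F.coord, if_pos rfl] at h5
    exact one_ne_zero h5

theorem not_isCompactSemisimple_coreIdeal (hΔ : rootSet 𝔞 = canonicalRoots p q e) (i : Fin p) :
    ¬ IsCompactSemisimple (F.coreIdeal hΔ i) := by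
  have h1 := square_left_mem_planeCore (u := f i) (v := f' i) quatI
  refine not_isCompactSemisimple_of_lie_thrice _ (x := ⟨_, F.planeCore_le_multiples i h1⟩) h1 ?_
    (lie_square_thrice (F.herm_ff i i) star_quatI)
  intro h2
  have h3 := F.herm_ff'_self i
  rw [eq_zero_of_square_eq_zero star_quatI quatI_ne_zero h2] at h3
  simp at h3

theorem eq_zero_of_commute (i : Fin p) {a b c : spLie p q} (ha : a ∈ rootSpaceOf 𝔞 (2 • e i))
    (hb : b ∈ rootSpaceOf 𝔞 0) (hc : c ∈ rootSpaceOf 𝔞 (-(2 • e i)))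
    (hcomm : ⁅((h i : 𝔞) : spLie p q), a + b + c⁆ = 0) : a = 0 ∧ c = 0 := by
  have hval : (2 • e i : Module.Dual ℝ 𝔞) (h i) = 2 := by simp [F.coord]
  have hval' : (-(2 • e i) : Module.Dual ℝ 𝔞) (h i) = -2 := by simp [F.coord]
  have hac : (2 : ℝ) • a = (2 : ℝ) • c := by
    rw [lie_add, lie_add, ha, hb, hc, hval, hval', LinearMap.zero_apply, zero_smul, add_zero,
      neg_smul, ← sub_eq_add_neg, sub_eq_zero] at hcomm
    exact hcomm
  have hac' : a = c := smul_right_injective _ (two_ne_zero' ℝ) hac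
  have h4 : (4 : ℝ) • a = 0 := by
    have h5 := hc (h i)
    rw [← hac', ha, hval, hval'] at h5
    have : (4 : ℝ) • a = (2 : ℝ) • a - (-2 : ℝ) • a := by module
    rw [this, h5, sub_self]
  have ha0 : a = 0 := (smul_eq_zero.mp h4).resolve_left (by norm_num)
  exact ⟨ha0, hac' ▸ ha0⟩

/-- A simple ideal not contained in the core meets it trivially, so it commutes with `hᵢ`, lies in
`𝔤_0`, and is compact. The core itself is simple and not compact. -/
theorem noncompactPart_eq {Θ : spLie p q ≃ₗ⁅ℝ⁆ spLie p q} (hΘ : IsCartanInvolution Θ)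
    (h𝔞 : IsCartanSubspace Θ 𝔞) (hΔ : rootSet 𝔞 = canonicalRoots p q e) (i : Fin p) :
    noncompactPart (multiplesSubalgebra 𝔞 (-(2 • e i))) = F.coreIdeal hΔ i := by
  apply le_antisymm
  · refine sSup_le ?_
    rintro I ⟨hI, hnc⟩
    rcases simple_ideal_dichotomy I hI (F.coreIdeal hΔ i).toSubmodule
      (fun x _ y _ hy => (F.coreIdeal hΔ i).lie_mem hy) with hdisj | hle
    · refine absurd (isCompactSemisimple_of_mem_zero hΘ h𝔞 I hI fun x hx => ?_) hnc
      have hH := tilt_mem_planeCore (u := f i) (v := f' i) 1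
      let H : multiplesSubalgebra 𝔞 (-(2 • e i)) := ⟨_, F.planeCore_le_multiples i hH⟩
      have hH' : H ∈ F.coreIdeal hΔ i := hH
      have hcomm : ⁅H, x⁆ = 0 :=
        hdisj _ (lie_mem_right ℝ _ I _ _ hx) (lie_mem_left ℝ _ (F.coreIdeal hΔ i) _ _ hH')
      have hcomm' : ⁅((h i : 𝔞) : spLie p q), (x : spLie p q)⁆ = 0 := by
        rw [← F.tilt_one]; exact congrArg Subtype.val hcomm
      obtain ⟨a, ha, b, hb, c, hc, hx⟩ := F.exists_eq_of_mem_multiples hΔ i x.2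
      rw [hx] at hcomm' ⊢
      obtain ⟨rfl, rfl⟩ := F.eq_zero_of_commute i ha hb hc hcomm'
      rw [zero_add, add_zero]
      exact hb
    · exact hle
  · exact le_sSup ⟨F.isSimple_coreIdeal hΔ i, F.not_isCompactSemisimple_coreIdeal hΔ i⟩

theorem mem_mHat_iff {Θ : spLie p q ≃ₗ⁅ℝ⁆ spLie p q} (hΘ : IsCartanInvolution Θ)
    (h𝔞 : IsCartanSubspace Θ 𝔞) (hΔ : rootSet 𝔞 = canonicalRoots p q e) (i : Fin p) (X : spLie p q) :
    X ∈ mHat Θ 𝔞 (-(2 • e i)) ↔ ∃ r, star r = -r ∧ X = tilt (f i) (f' i) r := by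
  have hmoeb : X ∈ moebiusSubalgebra 𝔞 (-(2 • e i)) ↔ X ∈ planeCore (f i) (f' i) := by
    unfold moebiusSubalgebra
    rw [F.noncompactPart_eq hΘ h𝔞 hΔ i]
    constructor
    · rintro ⟨Y, hY, rfl⟩
      exact hY
    · intro hX
      exact ⟨⟨X, F.planeCore_le_multiples i hX⟩, hX, rfl⟩
  have hmem : X ∈ mHat Θ 𝔞 (-(2 • e i)) ↔ X ∈ compactCentralizer Θ 𝔞 ∧
      X ∈ moebiusSubalgebra 𝔞 (-(2 • e i)) := Iff.rfl
  have hcent : X ∈ compactCentralizer Θ 𝔞 ↔ Θ X = X ∧ ∀ H ∈ 𝔞, ⁅H, X⁆ = 0 := Iff.rfl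
  rw [hmem, hmoeb, hcent]
  have hfix : ∀ r : ℍ[ℝ], star r = -r → Θ (tilt (f i) (f' i) r) = tilt (f i) (f' i) r := by
    intro r hr
    have hre : r.re = 0 := by
      have := congrArg (fun z : ℍ[ℝ] => z.re) hr
      simp only [Quaternion.re_star, Quaternion.re_neg] at this
      linarith
    -- Imaginary quaternions are sums of commutators, so imaginary tilts are sums of brackets in
    -- `𝔤_0`, fixed by `Θ`. In contrast `tilt 1 = hᵢ` changes sign, which removes the real part
    -- below.
    have hdec : r = (r.imI / 2) • (quatJ * quatK - quatK * quatJ) +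
        (r.imJ / 2) • (quatK * quatI - quatI * quatK) +
        (r.imK / 2) • (quatI * quatJ - quatJ * quatI) := by
      ext <;> simp [hre] <;> ring
    rw [hdec]
    simp only [map_add, map_smul,
      ← lie_tilt_tilt (F.herm_ff i i) (F.herm_f'f' i i) (F.herm_ff'_self i)]
    simp only [involution_lie_of_mem_zero hΘ h𝔞 (F.tilt_mem i _) (F.tilt_mem i _)]
  constructor
  · rintro ⟨⟨hΘX, hX0⟩, hXc⟩
    obtain ⟨r, s, t, hr, hs, hX⟩ :=
      exists_eq_of_mem_planeCore (F.herm_ff i i) (F.herm_f'f' i i) (F.herm_ff'_self i) hXc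
    have hcomm := hX0 _ (h i).2
    rw [hX] at hcomm
    obtain ⟨h1, h2⟩ := F.eq_zero_of_commute i (F.square_f_mem i r) (F.tilt_mem i t)
      (F.square_f'_mem i s) hcomm
    rw [h1, h2, zero_add, add_zero] at hX
    subst hX
    have hdec : t = t.re • 1 + (t - t.re • 1) := by abel
    have him : star (t - t.re • 1) = -(t - t.re • 1) := by ext <;> simp
    have h3 := hΘX
    rw [hdec, map_add, map_smul, map_add, hfix _ him, F.tilt_one, map_smul,
      h𝔞.prop.minus _ (h i).2, add_left_inj, smul_neg] at h3
    replace h3 : (2 : ℝ) • t.re • ((h i : 𝔞) : spLie p q) = 0 := by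
      rw [two_smul]
      nth_rewrite 1 [← h3]
      exact neg_add_cancel _
    rw [smul_eq_zero, smul_eq_zero, or_iff_right two_ne_zero] at h3
    rcases h3 with h3 | h3
    · refine ⟨t, ?_, rfl⟩
      rw [h3, zero_smul, sub_zero] at him
      exact him
    · have h5 : e i (h i) = 0 := by rw [Subtype.ext (a1 := h i) (a2 := 0) h3, map_zero]
      rw [F.coord, if_pos rfl] at h5
      exact absurd h5 one_ne_zero
  · rintro ⟨r, hr, rfl⟩
    exact ⟨⟨hfix r hr, fun H hH => lie_eq_zero_of_mem_zero hH (F.tilt_mem i r)⟩, tilt_mem_planeCore r⟩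

end IsWittFrame

end MoebiusSubalgebra


/-! ### From weight spaces to the quotient -/

section Decomposition

variable {𝔤 : Type*} [LieRing 𝔤] [LieAlgebra ℝ 𝔤] {𝔞 𝔫 : Submodule ℝ 𝔤} {𝔥 𝔨 : LieSubalgebra ℝ 𝔤}
  {B : LinearMap.BilinForm ℝ 𝔤} {δ : Module.Dual ℝ 𝔞} {S : Set (Module.Dual ℝ 𝔞)}

open Classical in
theorem IsConformalTriple.coeLinearMap_pairing (hB : IsConformalTriple 𝔞 𝔫 𝔥 B δ) (α : S)
    (x : ⨁ α : S, rootSpaceOf 𝔞 (α : Module.Dual ℝ 𝔞)) {y : 𝔤}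
    (hy : y ∈ rootSpaceOf 𝔞 (δ - α)) :
    B (DirectSum.coeLinearMap (fun α : S => rootSpaceOf 𝔞 (α : Module.Dual ℝ 𝔞)) x) y =
      B (x α) y := by
  induction x using DirectSum.induction_on with
  | zero => simp
  | add x z hx hz => simp only [map_add, DirectSum.add_apply, LinearMap.add_apply, hx, hz,
      Submodule.coe_add]
  | of β x =>
    rw [DirectSum.coeLinearMap_of]
    by_cases hαβ : β = α
    · subst hαβ
      rw [DirectSum.of_eq_same]
    · rw [DirectSum.of_eq_of_ne _ _ _ (Ne.symm hαβ), Submodule.coe_zero, map_zero,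
        LinearMap.zero_apply]
      refine hB.pairing_eq_zero x.2 hy fun h => hαβ (Subtype.ext ?_)
      rwa [add_sub_left_comm, add_eq_left, sub_eq_zero] at h

/-- Pairing with `𝔤_{δ - α}` extracts the component of weight `α`, so injectivity modulo `𝔥` can be
tested one weight at a time; surjectivity follows since the weight spaces span `𝔤`. -/
theorem IsConformalTriple.quotientDecomposes (hB : IsConformalTriple 𝔞 𝔫 𝔥 B δ)
    (htop : ⨆ α, rootSpaceOf 𝔞 α = ⊤) (ι : LieAlgebra.Orthogonal.so (Fin 3) ℝ ≃ₗ⁅ℝ⁆ 𝔨)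
    (hS0 : (0 : Module.Dual ℝ 𝔞) ∉ S) (hS : ∀ α ∈ S, ∀ x ∈ rootSpaceOf 𝔞 α, x ∈ 𝔥 → x = 0)
    (hSc : ∀ α, α ≠ 0 → α ∉ S → ∀ x ∈ rootSpaceOf 𝔞 α, x ∈ 𝔥)
    (h𝔨0 : ∀ x ∈ 𝔨, x ∈ rootSpaceOf 𝔞 0) (h𝔨 : ∀ x ∈ 𝔨, x ∈ 𝔥 → x = 0)
    (h0 : ∀ x ∈ rootSpaceOf 𝔞 0, ∃ y ∈ 𝔨, x - y ∈ 𝔥) : QuotientDecomposes 𝔞 𝔥 𝔨 S := by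
  classical
  let T : ((⨁ α : S, rootSpaceOf 𝔞 (α : Module.Dual ℝ 𝔞)) ×
      LieAlgebra.Orthogonal.so (Fin 3) ℝ) →ₗ[ℝ] 𝔤 :=
    (DirectSum.coeLinearMap (fun α : S => rootSpaceOf 𝔞 (α : Module.Dual ℝ 𝔞))).coprod
      (𝔨.toSubmodule.subtype ∘ₗ (ι : LieAlgebra.Orthogonal.so (Fin 3) ℝ →ₗ[ℝ] 𝔨))
  have hT : ∀ x A, T (x, A) =
      DirectSum.coeLinearMap (fun α : S => rootSpaceOf 𝔞 (α : Module.Dual ℝ 𝔞)) x + (ι A : 𝔤) :=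
    fun x A => LinearMap.coprod_apply _ _ _
  have hinj : Function.Injective (𝔥.toSubmodule.mkQ ∘ₗ T) := by
    rw [injective_iff_map_eq_zero]
    rintro ⟨x, A⟩ hxA
    rw [LinearMap.comp_apply, Submodule.mkQ_apply, Submodule.Quotient.mk_eq_zero, hT] at hxA
    have hx : x = 0 := by
      refine DFinsupp.ext fun α => Subtype.ext (hS α α.2 _ (x α).2 ?_)
      refine hB.mem_of_pairing htop (x α).2 fun y hy => ?_
      have h1 := (hB.ker_eq _).mp hxA y
      rw [map_add, LinearMap.add_apply, hB.coeLinearMap_pairing α x hy,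
        hB.pairing_eq_zero (h𝔨0 _ (ι A).2) hy, add_zero] at h1
      · exact h1
      · rw [zero_add, ne_eq, sub_eq_self]
        exact fun h => hS0 (h ▸ α.2)
    rw [hx, map_zero, zero_add] at hxA
    have hA : ι A = 0 := Subtype.ext (h𝔨 _ (ι A).2 hxA)
    rw [hx, ι.injective (hA.trans (map_zero ι).symm), Prod.mk_zero_zero]
  have hsurj : Function.Surjective (𝔥.toSubmodule.mkQ ∘ₗ T) := by
    rw [← LinearMap.range_eq_top, LinearMap.range_comp, ← top_le_iff]
    rintro z -
    obtain ⟨z, rfl⟩ := 𝔥.toSubmodule.mkQ_surjective z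
    have hz : z ∈ ⨆ α, rootSpaceOf 𝔞 α := htop ▸ Submodule.mem_top
    induction hz using Submodule.iSup_induction' with
    | zero => rw [map_zero]; exact zero_mem _
    | add x y _ _ hx hy => rw [map_add]; exact add_mem hx hy
    | mem α x hx =>
      by_cases hα0 : α = 0
      · subst hα0
        obtain ⟨y, hy, hxy⟩ := h0 x hx
        refine ⟨_, ⟨(0, ι.symm ⟨y, hy⟩), rfl⟩, ?_⟩
        rw [hT, map_zero, zero_add, LieEquiv.apply_symm_apply, eq_comm, ← sub_eq_zero, ← map_sub,
          Submodule.mkQ_apply, Submodule.Quotient.mk_eq_zero]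
        exact hxy
      · by_cases hαS : α ∈ S
        · refine ⟨_, ⟨(DirectSum.of (fun α : S => rootSpaceOf 𝔞 (α : Module.Dual ℝ 𝔞)) ⟨α, hαS⟩
            ⟨x, hx⟩, 0), rfl⟩, ?_⟩
          rw [hT, DirectSum.coeLinearMap_of, map_zero, ZeroMemClass.coe_zero, add_zero]
        · have hx0 : 𝔥.toSubmodule.mkQ x = 0 := by
            rw [Submodule.mkQ_apply, Submodule.Quotient.mk_eq_zero]
            exact hSc α hα0 hαS x hx
          rw [hx0]
          exact zero_mem _
  refine ⟨ι, LinearEquiv.ofBijective _ ⟨hinj, hsurj⟩, fun x A => ?_⟩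
  exact congrArg 𝔥.toSubmodule.mkQ (hT x A)

end Decomposition

/-! ### Imaginary quaternions and `𝔰𝔬(3)` -/

section SoThree

/-- The identification of `𝔰𝔬(3)` with the imaginary quaternions. -/
def soToQuat : LieAlgebra.Orthogonal.so (Fin 3) ℝ →ₗ[ℝ] ℍ[ℝ] where
  -- The halves compensate for `i j - j i = 2k`, so that matrix commutators become quaternion
  -- commutators.
  toFun A := (A.1 2 1 / 2) • quatI + (A.1 0 2 / 2) • quatJ + (A.1 1 0 / 2) • quatK
  map_add' A A' := by
    have h (i j) : (A + A').1 i j = A.1 i j + A'.1 i j := rfl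
    rw [h, h, h, add_div, add_div, add_div]
    module
  map_smul' c A := by
    have h (i j) : (c • A).1 i j = c * A.1 i j := rfl
    rw [h, h, h, RingHom.id_apply]
    module

theorem soToQuat_apply (A : LieAlgebra.Orthogonal.so (Fin 3) ℝ) :
    soToQuat A = (A.1 2 1 / 2) • quatI + (A.1 0 2 / 2) • quatJ + (A.1 1 0 / 2) • quatK := rfl

theorem star_soToQuat (A : LieAlgebra.Orthogonal.so (Fin 3) ℝ) :
    star (soToQuat A) = -soToQuat A := by
  ext <;> simp [soToQuat_apply]

theorem so_apply_swap (A : LieAlgebra.Orthogonal.so (Fin 3) ℝ) (i j : Fin 3) :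
    A.1 i j = -A.1 j i :=
  congrFun (congrFun ((LieAlgebra.Orthogonal.mem_so _ _ _).mp A.2) j) i

theorem soToQuat_lie (A A' : LieAlgebra.Orthogonal.so (Fin 3) ℝ) :
    soToQuat ⁅A, A'⁆ = soToQuat A * soToQuat A' - soToQuat A' * soToQuat A := by
  have hlie : (⁅A, A'⁆ : LieAlgebra.Orthogonal.so (Fin 3) ℝ).1 = A.1 * A'.1 - A'.1 * A.1 := rfl
  have hd : ∀ (A : LieAlgebra.Orthogonal.so (Fin 3) ℝ) i, A.1 i i = 0 := fun A i => by
    have := so_apply_swap A i i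
    linarith
  have h1 := fun A => so_apply_swap A 1 2
  have h2 := fun A => so_apply_swap A 2 0
  have h3 := fun A => so_apply_swap A 0 1
  ext <;> simp [soToQuat_apply, hlie, Matrix.mul_apply, Fin.sum_univ_three, hd, h1, h2, h3] <;> ring

theorem soToQuat_injective : Function.Injective soToQuat := by
  rw [injective_iff_map_eq_zero]
  intro A hA
  have hd : ∀ i, A.1 i i = 0 := fun i => by
    have := so_apply_swap A i i
    linarith
  have h1 : A.1 2 1 = 0 := by
    simpa [soToQuat_apply] using congrArg (fun z : ℍ[ℝ] => z.imI) hA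
  have h2 : A.1 0 2 = 0 := by
    simpa [soToQuat_apply] using congrArg (fun z : ℍ[ℝ] => z.imJ) hA
  have h3 : A.1 1 0 = 0 := by
    simpa [soToQuat_apply] using congrArg (fun z : ℍ[ℝ] => z.imK) hA
  have h4 := so_apply_swap A 1 2
  have h5 := so_apply_swap A 2 0
  have h6 := so_apply_swap A 0 1
  apply Subtype.ext
  ext i j
  change A.1 i j = 0
  fin_cases i <;> fin_cases j <;> first | exact hd _ | (dsimp; linarith)

theorem exists_soToQuat_eq {r : ℍ[ℝ]} (hr : star r = -r) : ∃ A, soToQuat A = r := by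
  have hre : r.re = 0 := by
    have := congrArg (fun z : ℍ[ℝ] => z.re) hr
    simp only [Quaternion.re_star, Quaternion.re_neg] at this
    linarith
  refine ⟨⟨!![0, -(2 * r.imK), 2 * r.imJ; 2 * r.imK, 0, -(2 * r.imI); -(2 * r.imJ), 2 * r.imI, 0],
    ?_⟩, ?_⟩
  · rw [LieAlgebra.Orthogonal.mem_so]
    ext i j
    fin_cases i <;> fin_cases j <;> simp
  · ext <;> simp [soToQuat_apply, hre]

/-- A Lie algebra parametrized by the imaginary quaternions with their commutator is `𝔰𝔬(3)`. -/
theorem nonempty_so_three_equiv {𝔤 : Type*} [LieRing 𝔤] [LieAlgebra ℝ 𝔤] {𝔨 : LieSubalgebra ℝ 𝔤}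
    (T : ℍ[ℝ] →ₗ[ℝ] 𝔤) (hlie : ∀ r s, ⁅T r, T s⁆ = T (r * s - s * r))
    (hinj : ∀ r, T r = 0 → r = 0) (h𝔨 : ∀ x, x ∈ 𝔨 ↔ ∃ r, star r = -r ∧ x = T r) :
    Nonempty (LieAlgebra.Orthogonal.so (Fin 3) ℝ ≃ₗ⁅ℝ⁆ 𝔨) := by
  let ψ : LieAlgebra.Orthogonal.so (Fin 3) ℝ →ₗ[ℝ] 𝔨 :=
    (T ∘ₗ soToQuat).codRestrict 𝔨.toSubmodule fun A => (h𝔨 _).mpr ⟨_, star_soToQuat A, rfl⟩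
  have hψ : ∀ A, (ψ A : 𝔤) = T (soToQuat A) := fun A => rfl
  let φ : LieAlgebra.Orthogonal.so (Fin 3) ℝ →ₗ⁅ℝ⁆ 𝔨 :=
    { ψ with
      map_lie' := fun {A A'} => Subtype.ext (by
        change T (soToQuat ⁅A, A'⁆) = ⁅T (soToQuat A), T (soToQuat A')⁆
        rw [hlie, soToQuat_lie]) }
  refine ⟨LieEquiv.ofBijective φ ⟨?_, ?_⟩⟩
  · intro A A' hAA
    apply soToQuat_injective
    rw [← sub_eq_zero]
    apply hinj
    rw [map_sub, sub_eq_zero]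
    exact congrArg Subtype.val hAA
  · rintro ⟨x, hx⟩
    obtain ⟨r, hr, rfl⟩ := (h𝔨 x).mp hx
    obtain ⟨A, rfl⟩ := exists_soToQuat_eq hr
    exact ⟨A, rfl⟩

end SoThree


/-! ### Determination of `𝔥` and conclusion -/

section Isotropy

variable {p q : ℕ} {𝔞 : Submodule ℝ (spLie p q)} {e : Fin p → Module.Dual ℝ 𝔞} {h : Fin p → 𝔞}
  {f f' : Fin p → QuatVec p q} {𝔥 : LieSubalgebra ℝ (spLie p q)}

theorem lie_square (X : spLie p q) (u : QuatVec p q) (r : ℍ[ℝ]) :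
    ⁅X, square u r⁆ =
      (2⁻¹ : ℝ) • (wedge (act X u <• r) u + wedge (u <• r) (act X u)) := by
  rw [square_apply, lie_smul, lie_wedge, act_rsmul]

theorem lie_lie_square {X : spLie p q} {u : QuatVec p q} (hu : act X (act X u) = 0) (r : ℍ[ℝ]) :
    ⁅X, ⁅X, square u r⁆⁆ = (2 : ℝ) • square (act X u) r := by
  rw [lie_square, lie_smul, lie_add, lie_wedge, lie_wedge, square_apply]
  simp only [act_rsmul, hu, smul_zero, map_zero, LinearMap.zero_apply]
  module

/-- The square is quadratic in `u`, so `(ad X)⁴` expands by the binomial rule; only the middle term,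
with coefficient `6`, survives `X³ u = 0`. -/
theorem lie_iterate_square {X : spLie p q} {u : QuatVec p q} (hu : act X (act X (act X u)) = 0)
    (r : ℍ[ℝ]) :
    ⁅X, ⁅X, ⁅X, ⁅X, square u r⁆⁆⁆⁆ = (6 : ℝ) • square (act X (act X u)) r := by
  rw [lie_square, square_apply]
  simp only [lie_smul, lie_add, lie_wedge, lie_zero, act_rsmul, hu, smul_zero, map_zero,
    LinearMap.zero_apply]
  module

namespace IsWittFrame

variable (F : IsWittFrame 𝔞 e h f f')
include F

/-- Treats `-(eₖ ± eⱼ)` together, with `l = ∓eⱼ` and `g` of weight `-l`. Two brackets of `x` with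
squares of `g` give squares of `x g`, of weight `-2eₖ` and in `𝔥`, so `x g = 0`. Skewness then gives
`x fₖ = 0`, and `x` sends all other weights outside the admissible ones. -/
theorem eq_zero_of_mem_mixed {k j : Fin p} (hjk : j ≠ k)
    (h2k : ∀ x ∈ rootSpaceOf 𝔞 (-(2 • e k)), x ∈ 𝔥 → x = 0) {l : Module.Dual ℝ 𝔞}
    {g : QuatVec p q} (hg : g ∈ vecWeight 𝔞 (-l)) (h2l : ∀ r, square g r ∈ 𝔥)
    (hl : ∀ w ∈ vecWeight 𝔞 l, herm g w = 0 → w = 0) (hlk : l (h k) = 0) (hlj : l (h j) ≠ 0)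
    (hf : ∀ i, f i = g ∨ (l + e i) (h j) ≠ 0) (hf' : ∀ i, f' i = g ∨ (l - e i) (h j) ≠ 0)
    {x : spLie p q} (hx : x ∈ rootSpaceOf 𝔞 (-e k + l)) (hx𝔥 : x ∈ 𝔥) : x = 0 := by
  have hk : ∀ i, e i (h k) = if i = k then 1 else 0 := fun i => F.coord i k
  have hj : e k (h j) = 0 := by rw [F.coord, if_neg (Ne.symm hjk)]
  have hxg : act x g = 0 := by
    have h1 := act_mem_vecWeight hx hg
    have h2 : act x (act x g) = 0 := by
      refine F.eq_zero_of_coord (act_mem_vecWeight hx h1) k ?_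
      simp [hk, hlk]
      norm_num
    refine eq_zero_of_square_eq_zero star_quatI quatI_ne_zero (h2k _ ?_ ?_)
    · rw [add_neg_cancel_right] at h1
      have h3 := wedge_mem_rootSpaceOf (rsmul_mem_vecWeight h1 quatI) h1
      rw [← neg_add, ← two_nsmul] at h3
      exact Submodule.smul_mem _ _ h3
    · have h3 := 𝔥.lie_mem hx𝔥 (𝔥.lie_mem hx𝔥 (h2l quatI))
      rw [lie_lie_square h2] at h3
      exact (Submodule.smul_mem_iff 𝔥.toSubmodule two_ne_zero).mp h3
  apply F.ext_act
  · intro i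
    rw [map_zero, LinearMap.zero_apply]
    by_cases hik : i = k
    · subst hik
      have h1 := act_mem_vecWeight hx (F.mem_f i)
      rw [add_comm, add_neg_cancel_left] at h1
      apply hl _ h1
      rw [← neg_eq_zero, ← herm_act_left, hxg, map_zero, LinearMap.zero_apply]
    · rcases hf i with h1 | h1
      · rw [h1, hxg]
      · refine F.eq_zero_of_two_coords (act_mem_vecWeight hx (F.mem_f i)) (Ne.symm hjk) ?_ ?_
        · simp [hk, hlk, hik]
        · simpa [hj] using h1
  · intro i
    rw [map_zero, LinearMap.zero_apply]
    by_cases hik : i = k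
    · refine F.eq_zero_of_coord (act_mem_vecWeight hx (F.mem_f' i)) k ?_
      simp [hk, hlk, hik]
      norm_num
    · rcases hf' i with h1 | h1
      · rw [h1, hxg]
      · refine F.eq_zero_of_two_coords (act_mem_vecWeight hx (F.mem_f' i)) (Ne.symm hjk) ?_ ?_
        · simp [hk, hlk, hik]
        · simpa [hj, sub_eq_add_neg] using h1
  · intro w hw
    rw [map_zero, LinearMap.zero_apply]
    refine F.eq_zero_of_two_coords (act_mem_vecWeight hx hw) (Ne.symm hjk) ?_ ?_
    · simp [hk, hlk]
    · simpa [hj] using hlj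

theorem eq_zero_of_mem_add {k j : Fin p} (hjk : j ≠ k)
    (h2k : ∀ x ∈ rootSpaceOf 𝔞 (-(2 • e k)), x ∈ 𝔥 → x = 0)
    (h2j : ∀ x ∈ rootSpaceOf 𝔞 (2 • e j), x ∈ 𝔥) {x : spLie p q}
    (hx : x ∈ rootSpaceOf 𝔞 (-(e k + e j))) (hx𝔥 : x ∈ 𝔥) : x = 0 := by
  have hj : ∀ i, e i (h j) = if i = j then 1 else 0 := fun i => F.coord i j
  refine F.eq_zero_of_mem_mixed hjk h2k (l := -e j) (g := f j) (by rw [neg_neg]; exact F.mem_f j)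
    (fun r => h2j _ (F.square_f_mem j r)) ?_ ?_ ?_ ?_ ?_ (by rwa [← neg_add]) hx𝔥
  · intro w hw hw0
    rw [F.eq_rsmul_f' hw, hw0]
    simp
  · simp [F.coord, hjk]
  · simp [hj]
  · intro i
    by_cases hij : i = j
    · exact Or.inl (by rw [hij])
    · right; simp [hj, hij]
  · intro i
    right
    by_cases hij : i = j
    · simp [hj, hij]; norm_num
    · simp [hj, hij]

theorem eq_zero_of_mem_sub {k j : Fin p} (hjk : j ≠ k)
    (h2k : ∀ x ∈ rootSpaceOf 𝔞 (-(2 • e k)), x ∈ 𝔥 → x = 0)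
    (h2j : ∀ x ∈ rootSpaceOf 𝔞 (-(2 • e j)), x ∈ 𝔥) {x : spLie p q}
    (hx : x ∈ rootSpaceOf 𝔞 (-(e k - e j))) (hx𝔥 : x ∈ 𝔥) : x = 0 := by
  have hj : ∀ i, e i (h j) = if i = j then 1 else 0 := fun i => F.coord i j
  refine F.eq_zero_of_mem_mixed hjk h2k (l := e j) (g := f' j) (F.mem_f' j)
    (fun r => h2j _ (F.square_f'_mem j r)) ?_ ?_ ?_ ?_ ?_ (by rwa [neg_add_eq_sub, ← neg_sub]) hx𝔥
  · intro w hw hw0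
    rw [F.eq_rsmul_f hw, hw0]
    simp
  · simp [F.coord, hjk]
  · simp [hj]
  · intro i
    right
    by_cases hij : i = j
    · simp [hj, hij]
    · simp [hj, hij]
  · intro i
    by_cases hij : i = j
    · exact Or.inl (by rw [hij])
    · right; simp [hj, hij]

/-- Here `x` maps `fₖ` to weight `0` and then to weight `-eₖ`. Four brackets with a square of `fₖ`
give a square of `x² fₖ` in `𝔥`, so `x² fₖ = 0`. Hence `x fₖ` is isotropic in the anisotropic
weight-0 space and vanishes, and skewness disposes of the rest. -/
theorem eq_zero_of_mem_short {k : Fin p} (h2k : ∀ x ∈ rootSpaceOf 𝔞 (-(2 • e k)), x ∈ 𝔥 → x = 0)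
    (h2k' : ∀ x ∈ rootSpaceOf 𝔞 (2 • e k), x ∈ 𝔥) {x : spLie p q}
    (hx : x ∈ rootSpaceOf 𝔞 (-e k)) (hx𝔥 : x ∈ 𝔥) : x = 0 := by
  have hk : ∀ i, e i (h k) = if i = k then 1 else 0 := fun i => F.coord i k
  have h1 : act x (f k) ∈ vecWeight 𝔞 0 := by
    simpa using act_mem_vecWeight hx (F.mem_f k)
  have h2 : act x (act x (f k)) ∈ vecWeight 𝔞 (-e k) := by
    simpa using act_mem_vecWeight hx h1
  have h3 : act x (act x (act x (f k))) = 0 := by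
    refine F.eq_zero_of_coord (act_mem_vecWeight hx h2) k ?_
    simp [hk]
    norm_num
  have h4 : act x (act x (f k)) = 0 := by
    refine eq_zero_of_square_eq_zero star_quatI quatI_ne_zero (h2k _ ?_ ?_)
    · have h5 := wedge_mem_rootSpaceOf (rsmul_mem_vecWeight h2 quatI) h2
      rw [← neg_add, ← two_nsmul] at h5
      exact Submodule.smul_mem _ _ h5
    · have h5 := 𝔥.lie_mem hx𝔥 (𝔥.lie_mem hx𝔥 (𝔥.lie_mem hx𝔥 (𝔥.lie_mem hx𝔥
        (h2k' _ (F.square_f_mem k quatI)))))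
      rw [lie_iterate_square h3] at h5
      exact (Submodule.smul_mem_iff 𝔥.toSubmodule (by norm_num)).mp h5
  have h5 : act x (f k) = 0 := F.eq_zero_of_isotropic h1 (by
    rw [herm_act_left, h4, map_zero, neg_zero])
  apply F.ext_act
  · intro i
    rw [map_zero, LinearMap.zero_apply]
    by_cases hik : i = k
    · rw [hik, h5]
    · refine F.eq_zero_of_two_coords (act_mem_vecWeight hx (F.mem_f i)) hik ?_ ?_
      · simp [F.coord, Ne.symm hik]
      · simp [hk, hik]
  · intro i
    rw [map_zero, LinearMap.zero_apply]
    by_cases hik : i = k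
    · refine F.eq_zero_of_coord (act_mem_vecWeight hx (F.mem_f' i)) k ?_
      simp [hk, hik]
      norm_num
    · refine F.eq_zero_of_two_coords (act_mem_vecWeight hx (F.mem_f' i)) hik ?_ ?_
      · simp [F.coord, Ne.symm hik]
      · simp [hk, hik]
  · intro w hw
    rw [map_zero, LinearMap.zero_apply]
    have h6 : act x w ∈ vecWeight 𝔞 (-e k) := by simpa using act_mem_vecWeight hx hw
    have h7 : herm (f k) (act x w) = 0 := by
      rw [← neg_eq_zero, ← herm_act_left, h5, map_zero, LinearMap.zero_apply]
    rw [F.eq_rsmul_f' h6, h7]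
    simp

variable {B : LinearMap.BilinForm ℝ (spLie p q)} {δ : Module.Dual ℝ 𝔞}

/-- The partner weight `δ - α` has `k`-th coordinate `-2 - α(hₖ)`. For the remaining roots this is
`-4` or `-3`, or else `-2`, which only `-2eₖ` attains; so `𝔤_α` has nothing to pair with. -/
theorem mem_of_not_mem_quotient (hΔ : rootSet 𝔞 = canonicalRoots p q e) {𝔫 : Submodule ℝ (spLie p q)} {k : Fin p}
    (hB : IsConformalTriple 𝔞 𝔫 𝔥 B (-(2 • e k))) {α : Module.Dual ℝ 𝔞} (h0 : α ≠ 0)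
    (h1 : α ≠ -(2 • e k)) (h2 : ¬(p < q ∧ α = -e k))
    (h3 : ¬∃ j, j ≠ k ∧ (α = -(e k + e j) ∨ α = -(e k - e j))) {x : spLie p q}
    (hx : x ∈ rootSpaceOf 𝔞 α) : x ∈ 𝔥 := by
  by_cases hα : α ∈ canonicalRoots p q e
  swap
  · rw [rootSpaceOf_eq_bot hΔ h0 hα, Submodule.mem_bot] at hx
    rw [hx]
    exact zero_mem _
  refine hB.mem_of_pairing (iSup_rootSpaceOf_eq_top F.span) hx fun y hy => ?_
  have hβ : (-(2 • e k) - α) (h k) = -2 - α (h k) := by simp [F.coord]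
  suffices hbot : rootSpaceOf 𝔞 (-(2 • e k) - α) = ⊥ by
    rw [hbot, Submodule.mem_bot] at hy
    rw [hy, map_zero]
  rcases canonicalRoots_coord F.coord hα k with ⟨h4, _⟩ | ⟨_, h4⟩ | ⟨_, h4 | h4⟩ | h4 | h4
  · apply F.rootSpaceOf_eq_bot_of_coord hΔ k
    rw [hβ, h4]
    norm_num
  · exact absurd h4 h1
  · exact absurd h4 h2
  · exact absurd h4 h3
  · rw [h4, sub_zero] at hβ
    apply rootSpaceOf_eq_bot hΔ
    · intro h5
      rw [h5, LinearMap.zero_apply] at hβ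
      norm_num at hβ
    · intro h5
      rcases canonicalRoots_coord F.coord h5 k with ⟨h6, _⟩ | ⟨_, h6⟩ | ⟨h6, _⟩ | h6 | h6
      · rw [hβ] at h6; norm_num at h6
      · exact h0 (sub_eq_self.mp h6)
      all_goals rw [hβ] at h6; norm_num at h6
  · apply F.rootSpaceOf_eq_bot_of_coord hΔ k
    rw [hβ, h4]
    norm_num

theorem quotientDecomposes (hΔ : rootSet 𝔞 = canonicalRoots p q e)
    {Θ : spLie p q ≃ₗ⁅ℝ⁆ spLie p q} (hΘ : IsCartanInvolution Θ) (h𝔞 : IsCartanSubspace Θ 𝔞)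
    {k : Fin p}
    (hB : IsConformalTriple 𝔞 (⨆ α ∈ canonicalPosRoots p q e, rootSpaceOf 𝔞 α) 𝔥 B (-(2 • e k)))
    (hm : ¬mHat Θ 𝔞 (-(2 • e k)) ≤ 𝔥) {S : Set (Module.Dual ℝ 𝔞)}
    (hS : ∀ α, α ∈ S ↔ α = -(2 • e k) ∨ (p < q ∧ α = -e k) ∨
      ∃ j, j ≠ k ∧ (α = -(e k + e j) ∨ α = -(e k - e j))) :
    QuotientDecomposes 𝔞 𝔥 (mHat Θ 𝔞 (-(2 • e k))) S := by
  have htop := iSup_rootSpaceOf_eq_top F.span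
  obtain ⟨c, hc⟩ := F.exists_pairing_eq_dot hΔ hB k
  have hmHat := F.mem_mHat_iff hΘ h𝔞 hΔ k
  have himag : ∀ {r : ℍ[ℝ]}, star r = -r → r.re = 0 := fun {r} hr => by
    have := congrArg (fun z : ℍ[ℝ] => z.re) hr
    simp only [Quaternion.re_star, Quaternion.re_neg] at this
    linarith
  have hmem : ∀ x ∈ rootSpaceOf 𝔞 0, (∀ s, star s = -s → B x (square (f' k) s) = 0) → x ∈ 𝔥 := by
    intro x hx hxs
    refine hB.mem_of_pairing htop hx fun y hy => ?_
    rw [sub_zero] at hy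
    obtain ⟨s, hs, rfl⟩ := F.exists_eq_square_f' hy
    exact hxs s hs
  -- With `c = 0`, all of `𝔪̂` would be orthogonal to `𝔤_δ` and therefore contained in `𝔥`.
  have hc0 : c ≠ 0 := by
    rintro rfl
    refine hm fun x hx => ?_
    obtain ⟨r, hr, rfl⟩ := (hmHat x).mp hx
    exact hmem _ (F.tilt_mem k r) fun s hs => by rw [hc r s hs, zero_mul]
  have hdef : ∀ r : ℍ[ℝ], star r = -r → B (tilt (f k) (f' k) r) (square (f' k) r) = 0 → r = 0 := by
    intro r hr h1
    rw [hc r r hr, mul_eq_zero, or_iff_right hc0] at h1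
    have h2 : r.imI = 0 := by nlinarith [mul_self_nonneg r.imI, mul_self_nonneg r.imJ, mul_self_nonneg r.imK]
    have h3 : r.imJ = 0 := by nlinarith [mul_self_nonneg r.imI, mul_self_nonneg r.imJ, mul_self_nonneg r.imK]
    have h4 : r.imK = 0 := by nlinarith [mul_self_nonneg r.imI, mul_self_nonneg r.imJ, mul_self_nonneg r.imK]
    ext <;> simp [himag hr, h2, h3, h4]
  have hlong : ∀ x ∈ rootSpaceOf 𝔞 (-(2 • e k)), x ∈ 𝔥 → x = 0 := by
    intro x hx hx𝔥
    obtain ⟨s, hs, rfl⟩ := F.exists_eq_square_f' hx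
    rw [hdef s hs (by rw [hB.symm]; exact (hB.ker_eq _).mp hx𝔥 _), map_zero]
  have hout : ∀ α, α ≠ 0 → α ∉ S → ∀ x ∈ rootSpaceOf 𝔞 α, x ∈ 𝔥 := by
    intro α h0 hα x hx
    rw [hS, not_or, not_or] at hα
    exact F.mem_of_not_mem_quotient hΔ hB h0 hα.1 hα.2.1 hα.2.2 hx
  have hcoordS : ∀ α ∈ S, α (h k) = -2 ∨ α (h k) = -1 := by
    intro α hα
    rcases (hS α).mp hα with rfl | ⟨_, rfl⟩ | ⟨j, hj, rfl | rfl⟩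
    · left; simp [F.coord]
    · right; simp [F.coord]
    · right; simp [F.coord, hj]
    · right; simp [F.coord, hj]
  have hnotS : ∀ α : Module.Dual ℝ 𝔞, 0 ≤ α (h k) → α ∉ S := fun α h1 h2 => by
    rcases hcoordS α h2 with h3 | h3 <;> linarith
  have h2ne : ∀ i, 2 • e i ≠ 0 := fun i => ne_zero_of_mem_pos hΔ (Or.inl ⟨i, rfl⟩)
  have hpos : ∀ i, ∀ x ∈ rootSpaceOf 𝔞 (2 • e i), x ∈ 𝔥 := fun i =>
    hout _ (h2ne i) (hnotS _ (by simp [F.coord]; split_ifs <;> norm_num))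
  have hneg : ∀ j, j ≠ k → ∀ x ∈ rootSpaceOf 𝔞 (-(2 • e j)), x ∈ 𝔥 := fun j hj =>
    hout _ (neg_ne_zero.mpr (h2ne j)) (hnotS _ (by simp [F.coord, hj]))
  obtain ⟨ι⟩ := nonempty_so_three_equiv (𝔨 := mHat Θ 𝔞 (-(2 • e k))) (tilt (f k) (f' k))
    (lie_tilt_tilt (F.herm_ff k k) (F.herm_f'f' k k) (F.herm_ff'_self k))
    (fun r hr => by
      have h1 := act_tilt (f k) (f' k) (f k) r
      rw [hr, F.herm_f'f_self, F.herm_ff, map_zero, LinearMap.zero_apply, mul_one, mul_zero,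
        MulOpposite.op_zero, zero_smul, sub_zero] at h1
      have h2 := congrArg (herm (f' k)) h1
      rw [herm_rsmul_right, F.herm_f'f_self, one_mul, map_zero] at h2
      exact h2.symm) hmHat
  refine hB.quotientDecomposes htop ι (hnotS 0 le_rfl) ?_ hout ?_ ?_ ?_
  · intro α hα x hx hx𝔥
    rcases (hS α).mp hα with rfl | ⟨_, rfl⟩ | ⟨j, hj, rfl | rfl⟩
    · exact hlong x hx hx𝔥
    · exact F.eq_zero_of_mem_short hlong (hpos k) hx hx𝔥
    · exact F.eq_zero_of_mem_add hj hlong (hpos j) hx hx𝔥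
    · exact F.eq_zero_of_mem_sub hj hlong (hneg j hj) hx hx𝔥
  · intro x hx
    obtain ⟨r, _, rfl⟩ := (hmHat x).mp hx
    exact F.tilt_mem k r
  · intro x hx hx𝔥
    obtain ⟨r, hr, rfl⟩ := (hmHat x).mp hx
    rw [hdef r hr ((hB.ker_eq _).mp hx𝔥 _), map_zero]
  · intro x hx
    -- The imaginary quaternion which represents the functional `s ↦ B(x, square s)` through `c`
    -- times the scalar product; subtracting its tilt makes `x` orthogonal to `𝔤_δ`.
    let r : ℍ[ℝ] := (B x (square (f' k) quatI) / c) • quatI +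
      (B x (square (f' k) quatJ) / c) • quatJ + (B x (square (f' k) quatK) / c) • quatK
    have hr : star r = -r := by ext <;> simp [r]
    refine ⟨tilt (f k) (f' k) r, (hmHat _).mpr ⟨r, hr, rfl⟩, hmem _ (sub_mem hx (F.tilt_mem k r)) ?_⟩
    intro s hs
    have hs' : s = s.imI • quatI + s.imJ • quatJ + s.imK • quatK := by
      ext <;> simp [himag hs]
    have h1 : B x (square (f' k) s) = s.imI * B x (square (f' k) quatI) +
        s.imJ * B x (square (f' k) quatJ) + s.imK * B x (square (f' k) quatK) := by
      conv_lhs => rw [hs']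
      simp only [map_add, map_smul, smul_eq_mul]
    have hrI : r.imI = B x (square (f' k) quatI) / c := by simp [r]
    have hrJ : r.imJ = B x (square (f' k) quatJ) / c := by simp [r]
    have hrK : r.imK = B x (square (f' k) quatK) / c := by simp [r]
    rw [map_sub, LinearMap.sub_apply, hc r s hs, h1, hrI, hrJ, hrK]
    field_simp
    ring

end IsWittFrame

end Isotropy

end

/-! ### The theorem -/

theorem mainTheorem6 (p q : ℕ) [NeZero p] (hpq : p ≤ q)
    (Θ : spLie p q ≃ₗ⁅ℝ⁆ spLie p q) (hΘ : IsCartanInvolution Θ)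
    (𝔞 : Submodule ℝ (spLie p q)) (h𝔞 : IsCartanSubspace Θ 𝔞)
    (e : Module.Basis (Fin p) ℝ (Module.Dual ℝ 𝔞))
    (hΔ : rootSet 𝔞 = canonicalRoots p q e)
    (𝔥 : LieSubalgebra ℝ (spLie p q))
    (B : LinearMap.BilinForm ℝ (spLie p q)) (δ : Module.Dual ℝ 𝔞)
    (hB : IsConformalTriple 𝔞 (⨆ α ∈ canonicalPosRoots p q e, rootSpaceOf 𝔞 α) 𝔥 B δ)
    (hm : ¬ mHat Θ 𝔞 δ ≤ 𝔥) :
    (p < q → QuotientDecomposes 𝔞 𝔥 (mHat Θ 𝔞 δ) (quotientWeightsLt e)) ∧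
    (p = q → QuotientDecomposes 𝔞 𝔥 (mHat Θ 𝔞 δ) (quotientWeightsEq e)) := by
  obtain ⟨h, f, f', F⟩ := exists_isWittFrame hΘ h𝔞.prop e hΔ
  obtain ⟨v, hv, hv𝔥⟩ := SetLike.not_le_iff_exists.mp hm
  have hv0 : v ∈ rootSpaceOf 𝔞 0 := fun H => by
    rw [hv.1.2 H H.2, LinearMap.zero_apply, zero_smul]
  -- An element of weight 0 outside the kernel can only be detected by `𝔤_δ`.
  obtain ⟨w, hw, hvw⟩ : ∃ w ∈ rootSpaceOf 𝔞 δ, B v w ≠ 0 := by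
    by_contra! hall
    exact hv𝔥 (hB.mem_of_pairing (iSup_rootSpaceOf_eq_top F.span) hv0
      fun y hy => hall y (by rwa [sub_zero] at hy))
  obtain rfl := F.distortion_eq hΔ hB hv0 hw hvw
  constructor
  · intro hlt
    refine F.quotientDecomposes hΔ hΘ h𝔞 hB hm fun α => ?_
    simp only [quotientWeightsLt, Set.mem_ofPred_eq, hlt, true_and, Fin.pos_iff_ne_zero]
  · intro heq
    refine F.quotientDecomposes hΔ hΘ h𝔞 hB hm fun α => ?_
    simp only [quotientWeightsEq, Set.mem_ofPred_eq, heq, lt_irrefl, false_and, false_or,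
      Fin.pos_iff_ne_zero]
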